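/- For $N\ge 3$ and $\theta>0$ let $\operatorname{Conf}(N;\theta)$ be the set of $N$-tuples $(u_1,\dots,u_N)$ of (labelled) points of the unit sphere $S^2\subset\mathbb R^3$ with pairwise angular distances at least $\theta$. For $r>0$ let $\operatorname{Conf}(N)[r]$ be the set of $N$-tuples of touching points of $N$ labelled spheres of radius $r$ that touch $S^2$ from outside and have pairwise disjoint interiors. Let $\operatorname{BConf}(N;\theta)=\operatorname{Conf}(N;\theta)/SO(3)$ and $\operatorname{BConf}(N)[r]=\operatorname{Conf}(N)[r]/SO(3)$ be the quotients by simultaneous rotation, with the quotient topology, and let $r_{\max}(N)$ be the supremum of the $r>0$ for which $\operatorname{Conf}(N)[r]\neq\emptyset$. Say that the Purity Property holds for $N$ if there is $\varepsilon>0$ such that for all $r$ with $r_{\max}(N)-\varepsilon<r<r_{\max}(N)$ there is an integer $s\ge1$ with $H^0(\operatorname{BConf}(N)[r];\mathbb Q)\cong\mathbb Q^{s}$ and $H^k(\operatorname{BConf}(N)[r];\mathbb Q)=0$ for all $k\ge1$ (singular cohomology). For $N=5$ the following hold. 1. The maximal radius is attained, $r_{\max}(5)=1+\sqrt2$, and $\operatorname{Conf}(5)[1+\sqrt2]=\operatorname{Conf}(5;\tfrac{\pi}{2})$.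 2. A $5$-tuple of points of $S^2$ lies in $\operatorname{Conf}(5;\tfrac\pi2)$ if and only if, up to a relabelling, it has the form $$\big(e_1,\;-e_1,\;e_3,\;\cos a\,e_2-\sin a\,e_3,\;-\cos b\,e_2-\sin b\,e_3\big)$$ for some orthonormal basis $(e_1,e_2,e_3)$ of $\mathbb R^3$ and some $a,b\ge0$ with $a+b\le\frac{\pi}{2}$; that is, it arises from the five vertices $\pm e_1,\pm e_2,e_3$ of a regular octahedron by moving the vertices of the antipodal pair $\pm e_2$ towards the unoccupied vertex $-e_3$ through the angles $a$ and $b$. 3. $\operatorname{BConf}(5;\tfrac\pi2)$ is a $2$-dimensional simplicial complex: there is a homeomorphism onto it from the underlying space of a finite simplicial complex, each of whose simplices is a face of a triangle and which has no simplices of dimension greater than $2$. The homeomorphism can be chosen so that the vertices correspond exactly to the classes of configurations consisting of five vertices of a regular octahedron, and the closed triangles correspond exactly to the families in (2) obtained by fixing the orthonormal basis and the relabelling and letting $(a,b)$ vary. 4. $\operatorname{BConf}(5;\tfrac\pi2)$ is connected and not contractible. Its rational homology is finite dimensional in each degree and zero in all large degrees, and its Euler characteristic (the alternating sum of its Betti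 numbers) is $-10$. 5. The Purity Property does not hold for $N=5$. -/

import Mathlib

namespace SphereConf

/-- Euclidean three-space. -/
abbrev E3 : Type := EuclideanSpace ℝ (Fin 3)

/-- The unit two-sphere in `E3`. -/
abbrev S2 : Type := Metric.sphere (0 : E3) 1

/-- `Conf(N; θ)`: labelled `N`-tuples of points of the unit sphere at pairwise angular distance
at least `θ`. -/
def confAngle (N : ℕ) (θ : ℝ) : Set (Fin N → S2) :=
  {U | ∀ i j : Fin N, i < j → θ ≤ InnerProductGeometry.angle (U i : E3) (U j : E3)}

/-- `Conf(N)[r]`: labelled `N`-tuples of touching points of `N` spheres of radius `r` which touch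
the central unit sphere from outside and have pairwise disjoint interiors.  The sphere touching at
`u` has centre `(1 + r) u`. -/
def confRadius (N : ℕ) (r : ℝ) : Set (Fin N → S2) :=
  {U | ∀ i j : Fin N, i < j →
    Disjoint (Metric.ball ((1 + r) • (U i : E3)) r) (Metric.ball ((1 + r) • (U j : E3)) r)}

/-- The radii `r > 0` for which `N` spheres of radius `r` fit around the unit sphere. -/
def admissibleRadii (N : ℕ) : Set ℝ := {r | 0 < r ∧ (confRadius N r).Nonempty}

/-- `r_max(N)`, meaningful for `N ≥ 3`. -/
noncomputable def rMax (N : ℕ) : ℝ := sSup (admissibleRadii N)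

/-- Two configurations are equivalent when one rotation in `SO(3)` carries the first to the
second, respecting the labels. -/
def rotationSetoid {N : ℕ} (S : Set (Fin N → S2)) : Setoid S where
  r U V := ∃ A ∈ Matrix.specialOrthogonalGroup (Fin 3) ℝ,
    ∀ i, (V.1 i : E3) = Matrix.toEuclideanLin A (U.1 i : E3)
  iseqv :=
    { refl := fun U => ⟨1, one_mem _, fun i => by simp⟩
      symm := by
        rintro U V ⟨A, hA, h⟩
        have hA' : star A * A = 1 :=
          ((Matrix.mem_specialOrthogonalGroup_iff.1 hA).1).1
        refine ⟨star A, (star (⟨A, hA⟩ : Matrix.specialOrthogonalGroup (Fin 3) ℝ)).2,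
          fun i => ?_⟩
        rw [h i]
        simp [Matrix.toLpLin_apply, hA']
      trans := by
        rintro U V W ⟨A, hA, h⟩ ⟨B, hB, h'⟩
        refine ⟨B * A, mul_mem hB hA, fun i => ?_⟩
        rw [h' i, h i]
        simp [Matrix.toLpLin_apply] }

/-- The quotient by `SO(3)` of a set of configurations, with the quotient topology. -/
abbrev RotationQuotient {N : ℕ} (S : Set (Fin N → S2)) : Type := Quotient (rotationSetoid S)

/-- `BConf(N; θ) = Conf(N; θ) / SO(3)`. -/
abbrev BConfAngle (N : ℕ) (θ : ℝ) : Type := RotationQuotient (confAngle N θ)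

/-- `BConf(N)[r] = Conf(N)[r] / SO(3)`. -/
abbrev BConfRadius (N : ℕ) (r : ℝ) : Type := RotationQuotient (confRadius N r)

section Homology

/-- The singular chain complex of `X` with rational coefficients. -/
noncomputable abbrev singularChains (X : Type) [TopologicalSpace X] :
    ChainComplex (ModuleCat.{0} ℚ) ℕ :=
  ((AlgebraicTopology.singularChainComplexFunctor (ModuleCat.{0} ℚ)).obj (ModuleCat.of ℚ ℚ)).obj
    (TopCat.of X)

/-- The singular `k`-cochains of `X` with rational coefficients. -/
abbrev Cochain (X : Type) [TopologicalSpace X] (k : ℕ) : Type :=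
  (singularChains X).X k →ₗ[ℚ] ℚ

/-- Precomposition with the boundary map from `i`-chains to `j`-chains (which is zero unless
`i = j + 1`). -/
noncomputable def coboundary (X : Type) [TopologicalSpace X] (j i : ℕ) :
    Cochain X j →ₗ[ℚ] Cochain X i :=
  LinearMap.lcomp ℚ ℚ ((singularChains X).d i j).hom

/-- `H^k(X; ℚ)`: cocycles modulo coboundaries.  For `k = 0` the map
`coboundary X (0 - 1) 0` is zero. -/
abbrev SingularCohomology (X : Type) [TopologicalSpace X] (k : ℕ) : Type :=
  LinearMap.ker (coboundary X k (k + 1)) ⧸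
    (LinearMap.range (coboundary X (k - 1) k)).submoduleOf
      (LinearMap.ker (coboundary X k (k + 1)))

/-- The rational singular homology of `X` is finite dimensional in each degree and vanishes in all
large degrees, and the alternating sum of the Betti numbers is `χ`. -/
def HasEulerCharacteristic (X : Type) [TopologicalSpace X] (χ : ℤ) : Prop :=
  (∀ k, Module.Finite ℚ ((singularChains X).homology k)) ∧
  (∃ n, ∀ k, n < k → Subsingleton ((singularChains X).homology k)) ∧
  (singularChains X).homologyEulerChar = χ

end Homology

/-- The Purity Property for `N`: for all radii slightly below `r_max(N)`, the rational cohomology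
of `BConf(N)[r]` is concentrated in degree zero, where it has finite rank at least one. -/
def PurityProperty (N : ℕ) : Prop :=
  ∃ ε : ℝ, 0 < ε ∧ ∀ r : ℝ, rMax N - ε < r → r < rMax N →
    ∃ s : ℕ, 1 ≤ s ∧
      Nonempty (SingularCohomology (BConfRadius N r) 0 ≃ₗ[ℚ] (Fin s → ℚ)) ∧
      ∀ k, 1 ≤ k → Subsingleton (SingularCohomology (BConfRadius N r) k)

/-- The points of `U` are among the six vertices `± e k` of a regular octahedron. -/
def OnOctahedron {N : ℕ} (U : Fin N → S2) : Prop :=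
  ∃ e : OrthonormalBasis (Fin 3) ℝ E3, ∀ i, ∃ k, (U i : E3) = e k ∨ (U i : E3) = -e k

/-- Start from the five octahedron vertices `e 0, -e 0, e 2, e 1, -e 1`, the vertex `-e 2` being
unoccupied, and move the antipodal pair `e 1, -e 1` towards `-e 2` through the angles `a`, `b`. -/
noncomputable def freePairPoint (e : OrthonormalBasis (Fin 3) ℝ E3) (a b : ℝ) : Fin 5 → E3 :=
  ![e 0, -e 0, e 2,
    Real.cos a • e 1 - Real.sin a • e 2,
    -(Real.cos b • e 1) - Real.sin b • e 2]

/-- `U` is, with labels assigned by `σ`, one of the configurations obtained from five vertices of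
the octahedron with frame `e` by moving the free pair. -/
def IsFreePairConfig (e : OrthonormalBasis (Fin 3) ℝ E3) (σ : Equiv.Perm (Fin 5))
    (U : Fin 5 → S2) : Prop :=
  ∃ a b : ℝ, 0 ≤ a ∧ 0 ≤ b ∧ a + b ≤ Real.pi / 2 ∧
    ∀ i, (U i : E3) = freePairPoint e a b (σ i)

/-- The family of classes in `BConf(5; π/2)` swept out by moving the free pair. -/
def freePairFamily (e : OrthonormalBasis (Fin 3) ℝ E3) (σ : Equiv.Perm (Fin 5)) :
    Set (BConfAngle 5 (Real.pi / 2)) :=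
  {x | ∃ U : confAngle 5 (Real.pi / 2), IsFreePairConfig e σ U.1 ∧
    x = Quotient.mk (rotationSetoid _) U}

/-- `K` is a finite simplicial complex which is purely of dimension two: it is nonempty and each
of its simplices is a face of a triangle of `K`, and there are no larger simplices. -/
def IsFinitePureTwoComplex {n : ℕ}
    (K : Geometry.SimplicialComplex ℝ (EuclideanSpace ℝ (Fin n))) : Prop :=
  K.faces.Finite ∧ K.faces.Nonempty ∧ (∀ s ∈ K.faces, s.card ≤ 3) ∧
    ∀ s ∈ K.faces, ∃ t ∈ K.faces, s ⊆ t ∧ t.card = 3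

/-- The homeomorphism `h` triangulates `BConf(5; π/2)` by `K` so that the vertices are the classes
of configurations of octahedron vertices and the triangles are the families obtained by moving a
free pair. -/
def IsFreePairTriangulation {n : ℕ}
    (K : Geometry.SimplicialComplex ℝ (EuclideanSpace ℝ (Fin n)))
    (h : K.space ≃ₜ BConfAngle 5 (Real.pi / 2)) : Prop :=
  (∀ U : confAngle 5 (Real.pi / 2),
    ((h.symm (Quotient.mk (rotationSetoid _) U) : K.space) : EuclideanSpace ℝ (Fin n)) ∈ K.vertices
      ↔ OnOctahedron U.1) ∧
  {T : Set (BConfAngle 5 (Real.pi / 2)) | ∃ s ∈ K.faces, s.card = 3 ∧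
      T = h '' {x | (x : EuclideanSpace ℝ (Fin n)) ∈
        convexHull ℝ (s : Set (EuclideanSpace ℝ (Fin n)))}} =
    {T | ∃ e σ, T = freePairFamily e σ}

end SphereConf

/-! Geometry. A product `det(u, v, c) * det(u, v, d)` is a mixed Gram determinant. If the inner
products of distinct unit vectors are nonpositive, every term of its expansion is nonpositive. For
five such vectors the three numbers `det(u 4, u 3, u i)`, `i = 0, 1, 2`, therefore have pairwise
nonpositive products, so one of them vanishes, and the equality case produces an antipodal pair
(`IsObtuse.exists_eq_neg`). Every other point is orthogonal to that pair, so the remaining three lie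
on a great circle with gaps at least `π / 2`, which is the free pair form
(`IsObtuse.exists_freePt`). Radii beyond `1 + √2` would make all inner products strictly negative,
which the antipodal pair forbids.

Quotient. For fixed labels the free pair family is a triangle with barycentric coordinates `2a/π`,
`2b/π`, `1 - 2(a+b)/π`, the rescaled excesses of the three coplanar gaps over a right angle. Among
the 120 labellings, 6 give the same family and 4 give the same octahedral corner, so there are 20
triangles on 30 corners, and two triangles share at most one corner. To make this gluing
topological, each corner gets a function `coord` on configurations: a product of two rescaled
angles, cut off by the sign of a triple product which tells a labelled octahedron from its mirror
image. These functions are rotation invariant and continuous and restrict to the barycentric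
coordinates on every family (`triangulation_cls`), so they embed the compact quotient in
30-dimensional space (`triangulationHomeo`).

Homology. A complex of triangles meeting only at vertices is covered by the complement of the
vertices and a neighbourhood of the vertices. These are homotopy equivalent to 20 and 30 points, and
their intersection to the 60 incidences. Mayer-Vietoris confines homology to degrees 0 and 1 and
gives `20 + 30 - 60 = -10`, whereas a contractible space has Euler characteristic 1. Mayer-Vietoris
rests on the small simplices theorem (`exists_sub_d_mem_smallChains`), proved by carrying out
barycentric subdivision on tuples of points and pushing it along singular simplices.

Purity. The number `(⟨u 0, u 1⟩ + 1/2) + i (⟨u 2, u 3⟩ + 1/2)` is never zero on optimal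
configurations (`not_half_half`), hence by compactness not for some radii arbitrarily close below
the maximum (`exists_radius`). If the first cohomology vanished, its winding along paths would be
the difference of a potential (`exists_potential`). Quarter turns of single points lead from an
octahedral configuration to its mirror image while this number circles the origin once. The number
does not see reflections, so the mirrored path returns with the same increment, and the two
increments cannot cancel (`not_purityProperty`). -/

section

/-! ### Singular simplices as a basis of singular chains -/

open CategoryTheory Limits AlgebraicTopology Simplicial Opposite

namespace SingularChains

/-- The standard topological `n`-simplex. -/
abbrev Simplex (n : ℕ) : Type := stdSimplex ℝ (Fin (n + 1))

/-- The inclusion of the `i`-th face of the standard simplex. -/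
noncomputable def face {n : ℕ} (i : Fin (n + 2)) : C(Simplex n, Simplex (n + 1)) :=
  ⟨stdSimplex.map i.succAbove, stdSimplex.continuous_map _⟩

variable {X Y : Type} [TopologicalSpace X] [TopologicalSpace Y]

open SphereConf (singularChains)

/-- The chain map induced by a continuous map. -/
noncomputable def chainMap (f : C(X, Y)) : singularChains X ⟶ singularChains Y :=
  ((singularChainComplexFunctor (ModuleCat.{0} ℚ)).obj (ModuleCat.of ℚ ℚ)).map (TopCat.ofHom f)

/-- A continuous map out of the standard simplex, as a simplex of the singular set. -/
noncomputable def toSing {n : ℕ} (σ : C(Simplex n, X)) :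
    (TopCat.toSSet.obj (TopCat.of X)).obj (op ⦋n⦌) :=
  (TopCat.toSSetObjEquiv (TopCat.of X) (op ⦋n⦌)).symm σ

/-- A continuous map out of the standard simplex, as a singular chain. -/
noncomputable def simplexChain {n : ℕ} (σ : C(Simplex n, X)) : (singularChains X).X n :=
  ((TopCat.toSSet.obj (TopCat.of X)).ιChainComplex (R := ModuleCat.of ℚ ℚ) (n := n)
    (toSing σ)).hom (1 : ℚ)

theorem δ_toSing {n : ℕ} (σ : C(Simplex (n + 1), X)) (i : Fin (n + 2)) :
    (TopCat.toSSet.obj (TopCat.of X)).δ i (toSing σ) = toSing (σ.comp (face i)) :=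
  rfl

theorem d_simplexChain {n : ℕ} (σ : C(Simplex (n + 1), X)) :
    ((singularChains X).d (n + 1) n).hom (simplexChain σ) =
      ∑ i : Fin (n + 2), ((-1) ^ (i : ℕ) : ℚ) • simplexChain (σ.comp (face i)) := by
  have h := congrArg (fun f => f.hom (1 : ℚ))
    ((TopCat.toSSet.obj (TopCat.of X)).ιChainComplex_d (ModuleCat.of ℚ ℚ) (toSing σ))
  refine Eq.trans h ?_
  simp only [ModuleCat.hom_sum, LinearMap.sum_apply]
  refine Finset.sum_congr rfl fun i _ => ?_
  rw [δ_toSing]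
  -- The signs on the two sides live in different scalar rings; parity turns both into `1` or `-1`.
  rcases Nat.even_or_odd (i : ℕ) with h | h
  · rw [h.neg_one_pow, h.neg_one_pow, one_smul]
    exact (one_smul ℚ _).symm
  · rw [h.neg_one_pow, h.neg_one_pow, neg_smul, neg_smul, one_smul]
    exact congrArg Neg.neg (one_smul ℚ _).symm

theorem chainMap_simplexChain (f : C(X, Y)) {n : ℕ} (σ : C(Simplex n, X)) :
    ((chainMap f).f n).hom (simplexChain σ) = simplexChain (f.comp σ) :=
  congrArg (fun f => f.hom (1 : ℚ)) (SSet.ι_chainComplexMap_f _ _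
    (TopCat.toSSet.map (TopCat.ofHom f)) (ModuleCat.of ℚ ℚ) (toSing σ))

/-- The coordinates of a singular chain in the basis of singular simplices. -/
noncomputable def chainCoord (X : Type) [TopologicalSpace X] (n : ℕ) :
    (singularChains X).X n ⟶ ModuleCat.of ℚ (C(Simplex n, X) →₀ ℚ) :=
  Cofan.IsColimit.desc
    ((TopCat.toSSet.obj (TopCat.of X)).isColimitChainComplexXCofan (ModuleCat.of ℚ ℚ) n)
    fun x => ModuleCat.ofHom
      (Finsupp.lsingle (M := ℚ) (R := ℚ) (TopCat.toSSetObjEquiv (TopCat.of X) (op ⦋n⦌) x))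

theorem ι_chainCoord {n : ℕ} (x : (TopCat.toSSet.obj (TopCat.of X)).obj (op ⦋n⦌)) :
    (TopCat.toSSet.obj (TopCat.of X)).ιChainComplex x ≫ chainCoord X n = ModuleCat.ofHom
      (Finsupp.lsingle (M := ℚ) (R := ℚ) (TopCat.toSSetObjEquiv (TopCat.of X) (op ⦋n⦌) x)) :=
  Cofan.IsColimit.fac
    ((TopCat.toSSet.obj (TopCat.of X)).isColimitChainComplexXCofan (ModuleCat.of ℚ ℚ) n) _ x

theorem chainCoord_simplexChain {n : ℕ} (σ : C(Simplex n, X)) :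
    (chainCoord X n).hom (simplexChain σ) = Finsupp.single σ 1 := by
  have h := congrArg (fun f => f.hom (1 : ℚ)) (ι_chainCoord (toSing σ))
  refine Eq.trans h ?_
  simp [toSing]

/-- The singular simplices form a basis of the singular chains. -/
noncomputable def chainEquiv (X : Type) [TopologicalSpace X] (n : ℕ) :
    (C(Simplex n, X) →₀ ℚ) ≃ₗ[ℚ] (singularChains X).X n :=
  LinearEquiv.ofLinearMap (Finsupp.linearCombination ℚ simplexChain) (chainCoord X n).hom
    (by
      have h : chainCoord X n ≫ ModuleCat.ofHom (Finsupp.linearCombination ℚ simplexChain) =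
          𝟙 ((singularChains X).X n) := by
        refine SSet.chainComplex_hom_ext fun x => ?_
        obtain ⟨σ, rfl⟩ : ∃ σ : C(Simplex n, X), toSing σ = x :=
          ⟨_, Equiv.symm_apply_apply _ x⟩
        ext
        have h1 := chainCoord_simplexChain σ
        change Finsupp.linearCombination ℚ simplexChain ((chainCoord X n).hom (simplexChain σ)) = _
        rw [h1, Finsupp.linearCombination_single]
        exact one_smul ℚ _
      exact congrArg ModuleCat.Hom.hom h)
    (Finsupp.lhom_ext' fun σ => LinearMap.ext_ring (by
      change (chainCoord X n).hom (Finsupp.linearCombination ℚ simplexChain (Finsupp.single σ 1)) = _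
      rw [Finsupp.linearCombination_single, one_smul]
      exact chainCoord_simplexChain σ))

theorem chainEquiv_single {n : ℕ} (σ : C(Simplex n, X)) (q : ℚ) :
    chainEquiv X n (Finsupp.single σ q) = q • simplexChain σ :=
  Finsupp.linearCombination_single _ _ _

theorem span_simplexChain (X : Type) [TopologicalSpace X] (n : ℕ) :
    Submodule.span ℚ (Set.range (simplexChain (X := X) (n := n))) = ⊤ := by
  rw [← Finsupp.range_linearCombination]
  exact (chainEquiv X n).range

theorem chainMap_chainEquiv (f : C(X, Y)) (n : ℕ) (c : C(Simplex n, X) →₀ ℚ) :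
    ((chainMap f).f n).hom (chainEquiv X n c) =
      chainEquiv Y n (Finsupp.mapDomain f.comp c) := by
  induction c using Finsupp.induction_linear with
  | zero => simp
  | add a b ha hb => simp only [map_add, ha, hb, Finsupp.mapDomain_add]
  | single σ q => simp [Finsupp.mapDomain_single, chainEquiv_single, chainMap_simplexChain]

end SingularChains

end

/-! ### Algebraic subdivision of tuples -/

section

/-- Augmented chains of tuples: `TupleChain V k` is spanned by the `k`-tuples of elements of `V`. -/
abbrev TupleChain (V : Type) (k : ℕ) : Type := (Fin k → V) →₀ ℚ

namespace TupleChain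

variable {V W : Type}

/-- The alternating sum of the faces of a tuple. -/
noncomputable def bdry (V : Type) (k : ℕ) : TupleChain V (k + 1) →ₗ[ℚ] TupleChain V k :=
  Finsupp.linearCombination ℚ fun p =>
    ∑ i : Fin (k + 1), ((-1) ^ (i : ℕ) : ℚ) • Finsupp.single (p ∘ i.succAbove) 1

/-- Adding a first entry to tuples. -/
noncomputable def cone (b : V) (k : ℕ) : TupleChain V k →ₗ[ℚ] TupleChain V (k + 1) :=
  Finsupp.lmapDomain ℚ ℚ fun p => (Fin.cons b p : Fin (k + 1) → V)

/-- The map of tuple chains induced by a function. -/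
noncomputable def map (g : V → W) (k : ℕ) : TupleChain V k →ₗ[ℚ] TupleChain W k :=
  Finsupp.lmapDomain ℚ ℚ (g ∘ ·)

theorem bdry_single {k : ℕ} (p : Fin (k + 1) → V) :
    bdry V k (Finsupp.single p 1) =
      ∑ i : Fin (k + 1), ((-1) ^ (i : ℕ) : ℚ) • Finsupp.single (p ∘ i.succAbove) 1 := by
  simp [bdry]

theorem cone_single (b : V) {k : ℕ} (p : Fin k → V) (q : ℚ) :
    cone b k (Finsupp.single p q) = Finsupp.single (Fin.cons b p) q := by
  simp [cone]

theorem map_single (g : V → W) {k : ℕ} (p : Fin k → V) (q : ℚ) :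
    map g k (Finsupp.single p q) = Finsupp.single (g ∘ p) q := by
  simp [map]

theorem cons_comp_succAbove_succ (b : V) {k : ℕ} (p : Fin (k + 1) → V) (i : Fin (k + 1)) :
    (Fin.cons b p : Fin (k + 2) → V) ∘ i.succ.succAbove =
      (Fin.cons b (p ∘ i.succAbove) : Fin (k + 1) → V) := by
  ext j
  refine Fin.cases ?_ (fun j => ?_) j <;> simp

/-- Chains are augmented: `bdry V 0` lands in the line spanned by the empty tuple. This makes the
cone formula hold here without a correction term. -/
theorem bdry_cone_zero (b : V) (c : TupleChain V 0) : bdry V 0 (cone b 0 c) = c := by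
  induction c using Finsupp.induction_linear with
  | zero => simp
  | add x y hx hy => simp only [map_add, hx, hy]
  | single p q =>
    rw [← mul_one q, ← smul_eq_mul, ← Finsupp.smul_single, map_smul, map_smul, cone_single,
      bdry_single]
    rw [Fin.sum_univ_succ, Finset.univ_eq_empty, Finset.sum_empty, add_zero]
    congr 1
    simp only [Fin.val_zero, pow_zero, one_smul]
    congr 1

/-- Deleting the apex returns `c`; deleting a later entry gives the cone over a face, with the sign
shifted by one. -/
theorem bdry_cone_succ (b : V) {k : ℕ} (c : TupleChain V (k + 1)) :
    bdry V (k + 1) (cone b (k + 1) c) = c - cone b k (bdry V k c) := by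
  induction c using Finsupp.induction_linear with
  | zero => simp
  | add x y hx hy => simp only [map_add, hx, hy]; abel
  | single p q =>
    rw [← mul_one q, ← smul_eq_mul, ← Finsupp.smul_single]
    simp only [map_smul, cone_single, bdry_single, ← smul_sub]
    congr 1
    rw [Fin.sum_univ_succ, map_sum, sub_eq_add_neg, ← Finset.sum_neg_distrib]
    congr 1
    · simp only [Fin.val_zero, pow_zero, one_smul]
      congr 1
    · refine Finset.sum_congr rfl fun i _ => ?_
      rw [cons_comp_succAbove_succ, map_smul, cone_single, Fin.val_succ, pow_succ]
      simp

theorem eq_cone {k : ℕ} (p : Fin (k + 1) → V) :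
    Finsupp.single p (1 : ℚ) = cone (p 0) k (Finsupp.single (Fin.tail p) 1) := by
  rw [cone_single, Fin.cons_self_tail]

theorem hom_ext {k : ℕ} {M : Type*} [AddCommGroup M] [Module ℚ M]
    {f g : TupleChain V k →ₗ[ℚ] M}
    (h : ∀ p : Fin k → V, f (Finsupp.single p 1) = g (Finsupp.single p 1)) : f = g :=
  Finsupp.lhom_ext' fun p => LinearMap.ext_ring (h p)

/-- Each tuple is the cone on its tail from its first entry, so two uses of the cone formula reduce
the claim to the tail. -/
theorem bdry_bdry {k : ℕ} (c : TupleChain V (k + 2)) : bdry V k (bdry V (k + 1) c) = 0 := by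
  suffices h : bdry V k ∘ₗ bdry V (k + 1) = 0 from LinearMap.congr_fun h c
  clear c
  induction k with
  | zero =>
    refine hom_ext fun p => ?_
    rw [eq_cone, LinearMap.comp_apply, bdry_cone_succ, map_sub, bdry_cone_zero, sub_self]; rfl
  | succ k ih =>
    refine hom_ext fun p => ?_
    have := LinearMap.congr_fun ih (Finsupp.single (Fin.tail p) 1)
    rw [LinearMap.comp_apply] at this
    rw [eq_cone, LinearMap.comp_apply, bdry_cone_succ, map_sub, bdry_cone_succ, this]
    simp

theorem map_bdry (g : V → W) {k : ℕ} (c : TupleChain V (k + 1)) :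
    map g k (bdry V k c) = bdry W k (map g (k + 1) c) := by
  suffices h : map g k ∘ₗ bdry V k = bdry W k ∘ₗ map g (k + 1) from LinearMap.congr_fun h c
  refine hom_ext fun p => ?_
  simp [map_single, bdry_single, Function.comp_assoc]

theorem map_cone (g : V → W) (b : V) {k : ℕ} (c : TupleChain V k) :
    map g (k + 1) (cone b k c) = cone (g b) k (map g k c) := by
  suffices h : map g (k + 1) ∘ₗ cone b k = cone (g b) k ∘ₗ map g k from LinearMap.congr_fun h c
  refine hom_ext fun p => ?_
  simp only [LinearMap.comp_apply, cone_single, map_single]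
  congr 1
  ext j
  refine Fin.cases ?_ (fun j => ?_) j <;> simp

variable (β : ∀ k : ℕ, (Fin (k + 1) → V) → V) (γ : ∀ k : ℕ, (Fin (k + 1) → W) → W)

/-- The subdivision operator determined by a choice of centres. -/
noncomputable def sd : ∀ k : ℕ, TupleChain V k →ₗ[ℚ] TupleChain V k
  | 0 => LinearMap.id
  | k + 1 => Finsupp.linearCombination ℚ fun p =>
      cone (β k p) k (sd k (bdry V k (Finsupp.single p 1)))

/-- The chain homotopy from the identity to the subdivision operator. -/
noncomputable def sdHomotopy : ∀ k : ℕ, TupleChain V k →ₗ[ℚ] TupleChain V (k + 1)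
  | 0 => 0
  | k + 1 => Finsupp.linearCombination ℚ fun p =>
      cone (β k p) (k + 1) (Finsupp.single p 1 - sdHomotopy k (bdry V k (Finsupp.single p 1)))

theorem sd_single {k : ℕ} (p : Fin (k + 1) → V) :
    sd β (k + 1) (Finsupp.single p 1) =
      cone (β k p) k (sd β k (bdry V k (Finsupp.single p 1))) := by
  simp [sd]

theorem sdHomotopy_single {k : ℕ} (p : Fin (k + 1) → V) :
    sdHomotopy β (k + 1) (Finsupp.single p 1) =
      cone (β k p) (k + 1)
        (Finsupp.single p 1 - sdHomotopy β k (bdry V k (Finsupp.single p 1))) := by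
  simp [sdHomotopy]

/-- The boundary of the cone on `sd ∂p` is `sd ∂p` minus the cone on `∂ sd ∂p`; by induction the
latter is `sd ∂∂p = 0`. -/
theorem bdry_sd {k : ℕ} (c : TupleChain V (k + 1)) :
    bdry V k (sd β (k + 1) c) = sd β k (bdry V k c) := by
  suffices h : bdry V k ∘ₗ sd β (k + 1) = sd β k ∘ₗ bdry V k from LinearMap.congr_fun h c
  clear c
  induction k with
  | zero =>
    refine hom_ext fun p => ?_
    rw [LinearMap.comp_apply, sd_single, bdry_cone_zero]; rfl
  | succ k ih =>
    refine hom_ext fun p => ?_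
    have := LinearMap.congr_fun ih (bdry V (k + 1) (Finsupp.single p 1))
    rw [LinearMap.comp_apply, LinearMap.comp_apply, bdry_bdry, map_zero] at this
    rw [LinearMap.comp_apply, sd_single, bdry_cone_succ, this]
    simp

theorem bdry_sdHomotopy {k : ℕ} (c : TupleChain V (k + 1)) :
    bdry V (k + 1) (sdHomotopy β (k + 1) c) + sdHomotopy β k (bdry V k c) =
      c - sd β (k + 1) c := by
  suffices h : bdry V (k + 1) ∘ₗ sdHomotopy β (k + 1) + sdHomotopy β k ∘ₗ bdry V k =
      LinearMap.id - sd β (k + 1) from LinearMap.congr_fun h c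
  clear c
  induction k with
  | zero =>
    refine hom_ext fun p => ?_
    simp only [LinearMap.add_apply, LinearMap.comp_apply, sdHomotopy_single, bdry_cone_succ,
      LinearMap.sub_apply, sd_single]
    simp [sdHomotopy, sd]
  | succ k ih =>
    refine hom_ext fun p => ?_
    have := LinearMap.congr_fun ih (bdry V (k + 1) (Finsupp.single p 1))
    simp only [LinearMap.add_apply, LinearMap.comp_apply, bdry_bdry, map_zero, add_zero,
      LinearMap.sub_apply, LinearMap.id_apply] at this
    simp only [LinearMap.add_apply, LinearMap.comp_apply, sdHomotopy_single β p, bdry_cone_succ,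
      LinearMap.sub_apply, sd_single β p, map_sub, this, LinearMap.id_apply]
    abel

/-- The iterated subdivision operator. -/
noncomputable def sdIter (m k : ℕ) : TupleChain V k →ₗ[ℚ] TupleChain V k := (sd β k) ^ m

/-- The chain homotopy from the identity to the iterated subdivision operator. -/
noncomputable def sdIterHomotopy (m k : ℕ) : TupleChain V k →ₗ[ℚ] TupleChain V (k + 1) :=
  ∑ j ∈ Finset.range m, sdHomotopy β k ∘ₗ sdIter β j k

theorem sdIter_succ (m k : ℕ) (c : TupleChain V k) :
    sdIter β (m + 1) k c = sd β k (sdIter β m k c) := by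
  rw [sdIter, pow_succ']; rfl

theorem bdry_sdIter (m : ℕ) {k : ℕ} (c : TupleChain V (k + 1)) :
    bdry V k (sdIter β m (k + 1) c) = sdIter β m k (bdry V k c) := by
  induction m with
  | zero => rfl
  | succ m ih => rw [sdIter_succ, sdIter_succ, bdry_sd, ih]

/-- The single-step homotopy identities, applied to successive subdivisions of `c`, telescope. -/
theorem bdry_sdIterHomotopy (m : ℕ) {k : ℕ} (c : TupleChain V (k + 1)) :
    bdry V (k + 1) (sdIterHomotopy β m (k + 1) c) + sdIterHomotopy β m k (bdry V k c) =
      c - sdIter β m (k + 1) c := by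
  induction m with
  | zero => simp [sdIterHomotopy, sdIter]
  | succ m ih =>
    have h := bdry_sdHomotopy β (sdIter β m (k + 1) c)
    rw [sdIterHomotopy, sdIterHomotopy, Finset.sum_range_succ, Finset.sum_range_succ,
      ← sdIterHomotopy, ← sdIterHomotopy, LinearMap.add_apply, LinearMap.add_apply, map_add,
      add_add_add_comm, ih, LinearMap.comp_apply, LinearMap.comp_apply, ← bdry_sdIter, h,
      sdIter_succ]
    abel

variable {β γ} {g : V → W}

/-- Naturality needs only that `g` carry centres to centres. For face inclusions this is
`face_center`. -/
theorem map_sd (hg : ∀ k (p : Fin (k + 1) → V), g (β k p) = γ k (g ∘ p))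
    {k : ℕ} (c : TupleChain V k) : map g k (sd β k c) = sd γ k (map g k c) := by
  suffices h : map g k ∘ₗ sd β k = sd γ k ∘ₗ map g k from LinearMap.congr_fun h c
  clear c
  induction k with
  | zero => rfl
  | succ k ih =>
    refine hom_ext fun p => ?_
    have := LinearMap.congr_fun ih (bdry V k (Finsupp.single p 1))
    simp only [LinearMap.comp_apply, map_bdry] at this
    rw [LinearMap.comp_apply, sd_single, map_cone, this, hg, LinearMap.comp_apply, map_single,
      sd_single]

theorem map_sdHomotopy (hg : ∀ k (p : Fin (k + 1) → V), g (β k p) = γ k (g ∘ p))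
    {k : ℕ} (c : TupleChain V k) :
    map g (k + 1) (sdHomotopy β k c) = sdHomotopy γ k (map g k c) := by
  suffices h : map g (k + 1) ∘ₗ sdHomotopy β k = sdHomotopy γ k ∘ₗ map g k from
    LinearMap.congr_fun h c
  clear c
  induction k with
  | zero => simp [sdHomotopy]
  | succ k ih =>
    refine hom_ext fun p => ?_
    have := LinearMap.congr_fun ih (bdry V k (Finsupp.single p 1))
    simp only [LinearMap.comp_apply, map_bdry] at this
    rw [LinearMap.comp_apply, sdHomotopy_single, map_cone, map_sub, this, hg,
      LinearMap.comp_apply, map_single, sdHomotopy_single]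

theorem map_sdIter (hg : ∀ k (p : Fin (k + 1) → V), g (β k p) = γ k (g ∘ p))
    (m : ℕ) {k : ℕ} (c : TupleChain V k) :
    map g k (sdIter β m k c) = sdIter γ m k (map g k c) := by
  induction m with
  | zero => rfl
  | succ m ih => rw [sdIter_succ, sdIter_succ, map_sd hg, ih]

theorem map_sdIterHomotopy
    (hg : ∀ k (p : Fin (k + 1) → V), g (β k p) = γ k (g ∘ p))
    (m : ℕ) {k : ℕ} (c : TupleChain V k) :
    map g (k + 1) (sdIterHomotopy β m k c) = sdIterHomotopy γ m k (map g k c) := by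
  simp [sdIterHomotopy, map_sdHomotopy hg, map_sdIter hg]

end TupleChain

end

/-! ### Affine simplices and the shrinking of barycentric subdivision -/

section

namespace SingularChains

open SphereConf (singularChains)

/-- The affine map between standard simplices taking the vertices to the entries of `p`. -/
noncomputable def affineSimplex {n k : ℕ} (p : Fin (k + 1) → Simplex n) :
    C(Simplex k, Simplex n) where
  toFun t := ⟨∑ i, t i • (p i).1,
    (convex_stdSimplex ℝ _).sum_mem (fun i _ => t.2.1 i) t.2.2 (fun i _ => (p i).2)⟩
  continuous_toFun := by
    refine Continuous.subtype_mk (continuous_finsetSum _ fun i _ => ?_) _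
    exact ((continuous_apply i).comp continuous_subtype_val).smul continuous_const

theorem affineSimplex_coe {n k : ℕ} (p : Fin (k + 1) → Simplex n) (t : Simplex k) :
    (affineSimplex p t).1 = ∑ i, t i • (p i).1 := rfl

theorem face_coe {n : ℕ} (i : Fin (n + 2)) (t : Simplex n) (j : Fin (n + 2)) :
    (face i t).1 j = ∑ l, t l * (Pi.single (i.succAbove l) 1 : Fin (n + 2) → ℝ) j := by
  change (stdSimplex.map i.succAbove t : Fin (n + 2) → ℝ) j = _
  rw [stdSimplex.map_coe, FunOnFinite.linearMap_apply_apply, Finset.sum_filter]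
  refine Finset.sum_congr rfl fun l _ => ?_
  rw [Pi.single_apply]
  split_ifs with h1 h2 h2
  · simp
  · exact absurd h1.symm h2
  · exact absurd h2.symm h1
  · simp

theorem affineSimplex_comp_face {n k : ℕ} (p : Fin (k + 2) → Simplex n) (i : Fin (k + 2)) :
    (affineSimplex p).comp (face i) = affineSimplex (p ∘ i.succAbove) := by
  ext t j
  change (affineSimplex p (face i t)).1 j = (affineSimplex (p ∘ i.succAbove) t).1 j
  simp only [affineSimplex_coe, Finset.sum_apply, Pi.smul_apply, smul_eq_mul, Function.comp]
  rw [Fin.sum_univ_succAbove _ i]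
  have h0 : (face i t).1 i = 0 := by
    refine (face_coe i t i).trans (Finset.sum_eq_zero fun l _ => ?_)
    rw [Pi.single_eq_of_ne (Fin.succAbove_ne i l).symm, mul_zero]
  have h1 : ∀ l, (face i t).1 (i.succAbove l) = t l := fun l => by
    refine (face_coe i t _).trans ?_
    rw [Finset.sum_eq_single l]
    · simp
    · intro b _ hb
      rw [Pi.single_eq_of_ne (fun h => hb (Fin.succAbove_right_injective h).symm), mul_zero]
    · simp
  refine (congrArg (· * _ + _) h0).trans ?_
  rw [zero_mul, zero_add]
  exact Finset.sum_congr rfl fun l _ => congrArg (· * _) (h1 l)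

theorem face_comp_affineSimplex {n k : ℕ} (p : Fin (k + 1) → Simplex n) (i : Fin (n + 2)) :
    (face i).comp (affineSimplex p) = affineSimplex (face i ∘ p) := by
  ext t j
  change (face i (affineSimplex p t)).1 j =
    (affineSimplex (face i ∘ p) t).1 j
  have h : ∀ l, affineSimplex p t l = ∑ a, t a * (p a).1 l := fun l => by
    change (affineSimplex p t).1 l = _
    simp [affineSimplex_coe]
  rw [face_coe, affineSimplex_coe]
  simp only [h, Finset.sum_apply, Pi.smul_apply, smul_eq_mul, Function.comp, Finset.sum_mul]
  rw [Finset.sum_comm]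
  refine Finset.sum_congr rfl fun l _ => ?_
  rw [face_coe, Finset.mul_sum]
  exact Finset.sum_congr rfl fun a _ => mul_assoc _ _ _

/-- The vertices of the standard simplex. -/
noncomputable def vertices (n : ℕ) : Fin (n + 1) → Simplex n := fun i => stdSimplex.vertex i

theorem affineSimplex_vertices (n : ℕ) : affineSimplex (vertices n) = ContinuousMap.id _ := by
  ext t j
  change (affineSimplex (vertices n) t).1 j = t j
  rw [affineSimplex_coe]
  simp [vertices, Finset.sum_apply, Pi.single_apply]

theorem face_vertices {n : ℕ} (i : Fin (n + 2)) :
    face i ∘ vertices n = vertices (n + 1) ∘ i.succAbove := by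
  funext j
  exact stdSimplex.map_vertex _ _

/-- The barycenter of a tuple of points of a standard simplex. -/
noncomputable def center {n : ℕ} (k : ℕ) (p : Fin (k + 1) → Simplex n) : Simplex n :=
  affineSimplex p stdSimplex.barycenter

theorem face_center {n : ℕ} (i : Fin (n + 2)) (k : ℕ) (p : Fin (k + 1) → Simplex n) :
    face i (center k p) = center k (face i ∘ p) :=
  congrArg (fun f : C(Simplex k, Simplex (n + 1)) => f stdSimplex.barycenter)
    (face_comp_affineSimplex p i)

theorem center_coe {n k : ℕ} (p : Fin (k + 1) → Simplex n) :
    (center k p).1 = ∑ i, ((k : ℝ) + 1)⁻¹ • (p i).1 := by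
  rw [center, affineSimplex_coe]
  refine Finset.sum_congr rfl fun i _ => ?_
  congr 1
  exact (stdSimplex.barycenter_apply i).trans (by simp)

/-- The difference from the barycentre is the average of `k + 1` differences of entries, one of
which is zero; hence the factor `k / (k + 1)`. -/
theorem dist_center_le {n k : ℕ} (p : Fin (k + 1) → Simplex n) {d : ℝ}
    (hd : ∀ i j, dist (p i) (p j) ≤ d) (i : Fin (k + 1)) :
    dist (p i) (center k p) ≤ k / (k + 1) * d := by
  have hk : (0 : ℝ) < k + 1 := by positivity
  rw [Subtype.dist_eq, dist_eq_norm, center_coe]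
  have h : (p i).1 - ∑ j, ((k : ℝ) + 1)⁻¹ • (p j).1 =
      ((k : ℝ) + 1)⁻¹ • ∑ j, ((p i).1 - (p j).1) := by
    rw [Finset.sum_sub_distrib, smul_sub, Finset.smul_sum (s := Finset.univ) (f := fun j => (p j).1)]
    congr 1
    simp only [Finset.sum_const, Finset.card_univ, Fintype.card_fin]
    rw [← Nat.cast_smul_eq_nsmul ℝ, smul_smul]
    push_cast
    rw [inv_mul_cancel₀ hk.ne', one_smul]
  rw [h, norm_smul, Real.norm_of_nonneg (by positivity), Fin.sum_univ_succAbove _ i, sub_self,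
    zero_add, div_eq_inv_mul, mul_assoc]
  refine mul_le_mul_of_nonneg_left ?_ (by positivity)
  refine (norm_sum_le _ _).trans ((Finset.sum_le_card_nsmul _ _ d fun j _ => ?_).trans ?_)
  · rw [← dist_eq_norm, ← Subtype.dist_eq]; exact hd _ _
  · simp

/-- The `k`-tuples of points of the standard simplex in `S` whose entries are `d`-close. -/
def smallTuples {n : ℕ} (S : Set (Fin (n + 1) → ℝ)) (d : ℝ) (k : ℕ) : Set (Fin k → Simplex n) :=
  {q | (∀ i, (q i).1 ∈ S) ∧ ∀ i j, dist (q i) (q j) ≤ d}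

theorem map_mem_of_mem_supported {α M : Type*} [AddCommGroup M] [Module ℚ M]
    {f : (α →₀ ℚ) →ₗ[ℚ] M} {s : Set α} {N : Submodule ℚ M}
    (h : ∀ a ∈ s, f (Finsupp.single a 1) ∈ N) {c : α →₀ ℚ} (hc : c ∈ Finsupp.supported ℚ ℚ s) :
    f c ∈ N := by
  rw [Finsupp.supported_eq_span_single] at hc
  have : Submodule.span ℚ ((fun i => Finsupp.single i (1 : ℚ)) '' s) ≤ N.comap f := by
    rw [Submodule.span_le]
    rintro _ ⟨a, ha, rfl⟩
    exact h a ha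
  exact this hc

open TupleChain in
-- The ratio is fixed by the top dimension `N`, so that one contraction factor serves all faces. The
-- convex set `S` is carried along to record that the subdivision does not leave the hull of the
-- tuple.
theorem sd_mem_supported {n : ℕ} (N : ℕ) {d : ℝ} (hd : 0 ≤ d) (k : ℕ) (hk : k ≤ N + 1)
    (S : Set (Fin (n + 1) → ℝ)) (hS : Convex ℝ S) (p : Fin k → Simplex n)
    (hp : p ∈ smallTuples S d k) :
    sd (center (n := n)) k (Finsupp.single p 1) ∈
      Finsupp.supported ℚ ℚ (smallTuples S ((N : ℝ) / (N + 1) * d) k) := by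
  induction k generalizing S with
  | zero => exact Finsupp.single_mem_supported _ _ ⟨fun i => i.elim0, fun i => i.elim0⟩
  | succ k ih =>
    have hle : (k : ℝ) / (k + 1) * d ≤ N / (N + 1) * d := by
      refine mul_le_mul_of_nonneg_right ?_ hd
      rw [div_le_div_iff₀ (by positivity) (by positivity)]
      have : (k : ℝ) ≤ N := by exact_mod_cast Nat.le_of_succ_le_succ hk
      nlinarith
    have hN : 0 ≤ (N : ℝ) / (N + 1) * d := by positivity
    -- The induction is applied to the faces with this hull in place of `S`: all their pieces then
    -- lie in the ball around the centre, so coning keeps tuples small.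
    set S' := convexHull ℝ (Set.range fun i => (p i).1) with hS'
    have hS'S : S' ⊆ S := convexHull_min (by rintro _ ⟨i, rfl⟩; exact hp.1 i) hS
    have hb : (center k p).1 ∈ S' :=
      (convex_convexHull ℝ _).sum_mem (fun i _ => stdSimplex.barycenter.2.1 i)
        stdSimplex.barycenter.2.2 (fun i _ => subset_convexHull ℝ _ (Set.mem_range_self i))
    have hball : S' ⊆ Metric.closedBall (center k p).1 (N / (N + 1) * d) := by
      refine convexHull_min ?_ (convex_closedBall _ _)
      rintro _ ⟨i, rfl⟩
      exact (dist_center_le p hp.2 i).trans hle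
    rw [sd_single]
    refine map_mem_of_mem_supported
      (s := smallTuples S' ((N : ℝ) / (N + 1) * d) k) (fun q hq => ?_) ?_
    · rw [cone_single]
      refine Finsupp.single_mem_supported _ _ ⟨fun i => ?_, fun i j => ?_⟩
      · refine Fin.cases ?_ (fun i => ?_) i
        · exact hS'S hb
        · exact hS'S (hq.1 i)
      · refine Fin.cases ?_ (fun i => ?_) i <;> refine Fin.cases ?_ (fun j => ?_) j
        · simpa using hN
        · rw [dist_comm]; exact hball (hq.1 j)
        · exact hball (hq.1 i)
        · exact hq.2 i j
    · rw [bdry_single, map_sum]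
      refine Submodule.sum_mem _ fun i _ => ?_
      rw [map_smul]
      refine Submodule.smul_mem _ _ (ih (by omega) S' (convex_convexHull ℝ _) _
        ⟨fun j => subset_convexHull ℝ _ (Set.mem_range_self (i.succAbove j)), fun j l => hp.2 _ _⟩)

open TupleChain in
theorem sdIter_mem_supported {n : ℕ} (N : ℕ) {d : ℝ} (hd : 0 ≤ d) (k : ℕ) (hk : k ≤ N + 1)
    (p : Fin k → Simplex n) (hp : p ∈ smallTuples Set.univ d k) (m : ℕ) :
    sdIter (center (n := n)) m k (Finsupp.single p 1) ∈
      Finsupp.supported ℚ ℚ (smallTuples Set.univ (((N : ℝ) / (N + 1)) ^ m * d) k) := by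
  induction m with
  | zero => simpa [sdIter] using Finsupp.single_mem_supported _ _ hp
  | succ m ih =>
    rw [sdIter_succ, pow_succ', mul_assoc]
    exact map_mem_of_mem_supported
      (fun q hq => sd_mem_supported N (by positivity) k hk _ convex_univ q hq) ih

end SingularChains

end

/-! ### Subdivision of singular chains and the small simplices theorem -/

section

namespace SingularChains

open SphereConf (singularChains)
open TupleChain

variable {X Y : Type} [TopologicalSpace X] [TopologicalSpace Y] {M : Type*} [AddCommGroup M]
  [Module ℚ M]

theorem chain_hom_ext {n : ℕ} {f g : (singularChains X).X n →ₗ[ℚ] M}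
    (h : ∀ σ : C(Simplex n, X), f (simplexChain σ) = g (simplexChain σ)) : f = g :=
  LinearMap.ext_on_range (span_simplexChain X n) h

/-- The linear map on singular chains with prescribed values on singular simplices. -/
noncomputable def liftChain {n : ℕ} (F : C(Simplex n, X) → M) : (singularChains X).X n →ₗ[ℚ] M :=
  Finsupp.linearCombination ℚ F ∘ₗ (chainEquiv X n).symm.toLinearMap

theorem liftChain_simplexChain {n : ℕ} (F : C(Simplex n, X) → M) (σ : C(Simplex n, X)) :
    liftChain F (simplexChain σ) = F σ := by
  have h : (chainEquiv X n).symm (simplexChain σ) = Finsupp.single σ 1 := by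
    rw [LinearEquiv.symm_apply_eq, chainEquiv_single, one_smul]
  simp [liftChain, h]

/-- The singular chain of affine simplices inside a singular simplex. -/
noncomputable def push {n : ℕ} (σ : C(Simplex n, X)) (k : ℕ) :
    TupleChain (Simplex n) (k + 1) →ₗ[ℚ] (singularChains X).X k :=
  Finsupp.linearCombination ℚ fun p => simplexChain (σ.comp (affineSimplex p))

theorem push_single {n : ℕ} (σ : C(Simplex n, X)) {k : ℕ} (p : Fin (k + 1) → Simplex n) :
    push σ k (Finsupp.single p 1) = simplexChain (σ.comp (affineSimplex p)) := by
  simp [push]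

/-- Pushing along `σ` is a chain map, with an index shift: a `k`-simplex is a tuple of length `k +
1`. -/
theorem d_push {n : ℕ} (σ : C(Simplex n, X)) {k : ℕ} (c : TupleChain (Simplex n) (k + 2)) :
    ((singularChains X).d (k + 1) k).hom (push σ (k + 1) c) = push σ k (bdry _ (k + 1) c) := by
  suffices h : ((singularChains X).d (k + 1) k).hom ∘ₗ push σ (k + 1) =
    push σ k ∘ₗ bdry _ (k + 1) from LinearMap.congr_fun h c
  refine TupleChain.hom_ext fun p => ?_
  rw [LinearMap.comp_apply, LinearMap.comp_apply, push_single, d_simplexChain, bdry_single,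
    map_sum]
  refine Finset.sum_congr rfl fun i _ => ?_
  rw [map_smul, push_single, ContinuousMap.comp_assoc, affineSimplex_comp_face]

theorem push_face {n : ℕ} (σ : C(Simplex (n + 1), X)) (i : Fin (n + 2)) {k : ℕ}
    (c : TupleChain (Simplex n) (k + 1)) :
    push (σ.comp (face i)) k c = push σ k (TupleChain.map (face i) (k + 1) c) := by
  suffices h : push (σ.comp (face i)) k = push σ k ∘ₗ TupleChain.map (face i) (k + 1) from
    LinearMap.congr_fun h c
  refine TupleChain.hom_ext fun p => ?_
  rw [LinearMap.comp_apply, map_single, push_single, push_single, ContinuousMap.comp_assoc,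
    face_comp_affineSimplex]

theorem push_vertices {n : ℕ} (σ : C(Simplex n, X)) :
    push σ n (Finsupp.single (vertices n) 1) = simplexChain σ := by
  rw [push_single, affineSimplex_vertices, ContinuousMap.comp_id]

/-- Iterated barycentric subdivision of singular chains. -/
noncomputable def subdiv (X : Type) [TopologicalSpace X] (m n : ℕ) :
    (singularChains X).X n →ₗ[ℚ] (singularChains X).X n :=
  liftChain fun σ => push σ n (sdIter center m (n + 1) (Finsupp.single (vertices n) 1))

/-- The chain homotopy from the identity to iterated barycentric subdivision. -/
noncomputable def subdivHomotopy (X : Type) [TopologicalSpace X] (m n : ℕ) :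
    (singularChains X).X n →ₗ[ℚ] (singularChains X).X (n + 1) :=
  liftChain fun σ => push σ (n + 1) (sdIterHomotopy center m (n + 1)
    (Finsupp.single (vertices n) 1))

/-- On one simplex this is the tuple identity for the tuple of vertices, pushed forward; naturality
under face inclusions matches the boundary terms. -/
theorem d_subdivHomotopy (m : ℕ) {n : ℕ} (c : (singularChains X).X (n + 1)) :
    ((singularChains X).d (n + 2) (n + 1)).hom (subdivHomotopy X m (n + 1) c) +
      subdivHomotopy X m n (((singularChains X).d (n + 1) n).hom c) =
    c - subdiv X m (n + 1) c := by
  suffices h : ((singularChains X).d (n + 2) (n + 1)).hom ∘ₗ subdivHomotopy X m (n + 1) +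
      subdivHomotopy X m n ∘ₗ ((singularChains X).d (n + 1) n).hom =
      LinearMap.id - subdiv X m (n + 1) from LinearMap.congr_fun h c
  refine chain_hom_ext fun σ => ?_
  have h := congrArg (push σ (n + 1)) (bdry_sdIterHomotopy (center (n := n + 1)) m
    (Finsupp.single (vertices (n + 1)) 1))
  rw [map_add, map_sub, push_vertices, ← d_push] at h
  simp only [LinearMap.add_apply, LinearMap.comp_apply, LinearMap.sub_apply, LinearMap.id_apply]
  rw [subdivHomotopy, subdiv, liftChain_simplexChain, liftChain_simplexChain, ← h]
  congr 1
  rw [d_simplexChain, map_sum, bdry_single, map_sum, map_sum]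
  refine Finset.sum_congr rfl fun i _ => ?_
  rw [map_smul, map_smul, map_smul, subdivHomotopy, liftChain_simplexChain, push_face,
    map_sdIterHomotopy (γ := center) (face_center i), map_single, face_vertices]

/-- The singular chains spanned by simplices contained in a member of the family `U`. -/
noncomputable def smallChains {ι : Type*} (U : ι → Set X) (n : ℕ) : Submodule ℚ ((singularChains X).X n) :=
  Submodule.span ℚ (simplexChain '' {σ : C(Simplex n, X) | ∃ i, Set.range σ ⊆ U i})

variable {ι : Type*} {U : ι → Set X}

theorem map_mem_of_mem_smallChains {n : ℕ} {f : (singularChains X).X n →ₗ[ℚ] M}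
    {N : Submodule ℚ M} (h : ∀ (σ : C(Simplex n, X)) (i : ι), Set.range σ ⊆ U i →
      f (simplexChain σ) ∈ N) {c : (singularChains X).X n} (hc : c ∈ smallChains U n) :
    f c ∈ N := by
  have : smallChains U n ≤ N.comap f := by
    rw [smallChains, Submodule.span_le]
    rintro _ ⟨σ, ⟨i, hi⟩, rfl⟩
    exact h σ i hi
  exact this hc

theorem push_mem_smallChains {n : ℕ} {σ : C(Simplex n, X)} {k : ℕ} {s : Set (Fin (k + 1) → Simplex n)}
    (h : ∀ p ∈ s, ∃ i, Set.range (σ.comp (affineSimplex p)) ⊆ U i)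
    {c : TupleChain (Simplex n) (k + 1)} (hc : c ∈ Finsupp.supported ℚ ℚ s) :
    push σ k c ∈ smallChains U k :=
  map_mem_of_mem_supported (fun p hp => by
    rw [push_single]
    exact Submodule.subset_span ⟨_, h p hp, rfl⟩) hc

/-- Every simplex occurring in the homotopy factors through the given one, so it stays in the same
member of the family. -/
theorem subdivHomotopy_mem (m : ℕ) {n : ℕ} {c : (singularChains X).X n}
    (hc : c ∈ smallChains U n) : subdivHomotopy X m n c ∈ smallChains U (n + 1) := by
  refine map_mem_of_mem_smallChains (fun σ i hi => ?_) hc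
  rw [subdivHomotopy, liftChain_simplexChain]
  refine push_mem_smallChains (s := Set.univ) (fun p _ => ⟨i, ?_⟩)
    (by rw [Finsupp.supported_univ]; trivial)
  rintro _ ⟨t, rfl⟩
  exact hi ⟨_, rfl⟩

/-- A Lebesgue number of the pulled-back cover eventually exceeds `(n / (n + 1)) ^ m`, which bounds
the size of the pieces because the standard simplex has diameter at most 1. -/
theorem exists_subdiv_simplexChain_mem (hU : ∀ i, IsOpen (U i)) (hcov : ⋃ i, U i = Set.univ)
    {n : ℕ} (σ : C(Simplex n, X)) :
    ∃ m₀, ∀ m ≥ m₀, subdiv X m n (simplexChain σ) ∈ smallChains U n := by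
  obtain ⟨δ, hδ, hL⟩ := lebesgue_number_lemma_of_metric (s := (Set.univ : Set (Simplex n)))
    (c := fun i => σ ⁻¹' U i) isCompact_univ (fun i => (hU i).preimage σ.continuous)
    (by rw [← Set.preimage_iUnion, hcov]; simp)
  have hlim : Filter.Tendsto (fun m : ℕ => ((n : ℝ) / (n + 1)) ^ m * 1) Filter.atTop (nhds 0) := by
    simpa using (tendsto_pow_atTop_nhds_zero_of_lt_one (by positivity)
      (by rw [div_lt_one (by positivity)]; linarith : (n : ℝ) / (n + 1) < 1)).mul_const 1
  obtain ⟨m₀, hm₀⟩ := Filter.eventually_atTop.1 (hlim.eventually_lt_const hδ)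
  refine ⟨m₀, fun m hm => ?_⟩
  rw [subdiv, liftChain_simplexChain]
  refine push_mem_smallChains (fun p hp => ?_)
    (sdIter_mem_supported n zero_le_one (n + 1) le_rfl (vertices n) ⟨fun _ => trivial,
      fun i j => ?_⟩ m)
  · obtain ⟨i, hi⟩ := hL (p 0) trivial
    refine ⟨i, ?_⟩
    rintro _ ⟨t, rfl⟩
    refine hi ?_
    have hsub : Set.range (fun j => (p j).1) ⊆
        Metric.closedBall (p 0).1 (((n : ℝ) / (n + 1)) ^ m * 1) := by
      rintro _ ⟨j, rfl⟩
      exact hp.2 j 0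
    have := convexHull_min hsub (convex_closedBall _ _)
      ((convex_convexHull ℝ _).sum_mem (fun i _ => t.2.1 i) t.2.2
        (fun i _ => subset_convexHull ℝ _ (Set.mem_range_self i)))
    exact lt_of_le_of_lt this (hm₀ m hm)
  · refine (Metric.dist_le_diam_of_mem (bounded_stdSimplex _) (vertices n i).2
      (vertices n j).2).trans diam_stdSimplex_le

theorem exists_subdiv_mem (hU : ∀ i, IsOpen (U i)) (hcov : ⋃ i, U i = Set.univ)
    {n : ℕ} (c : (singularChains X).X n) :
    ∃ m₀, ∀ m ≥ m₀, subdiv X m n c ∈ smallChains U n := by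
  have hc : c ∈ Submodule.span ℚ (Set.range (simplexChain (X := X) (n := n))) := by
    rw [span_simplexChain]; trivial
  induction hc using Submodule.span_induction with
  | mem x hx =>
    obtain ⟨σ, rfl⟩ := hx
    exact exists_subdiv_simplexChain_mem hU hcov σ
  | zero => exact ⟨0, fun m _ => by rw [map_zero]; exact zero_mem _⟩
  | add x y _ _ hx hy =>
    obtain ⟨a, ha⟩ := hx
    obtain ⟨b, hb⟩ := hy
    refine ⟨max a b, fun m hm => ?_⟩
    rw [map_add]
    exact add_mem (ha m (le_trans (le_max_left _ _) hm)) (hb m (le_trans (le_max_right _ _) hm))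
  | smul q x _ hx =>
    obtain ⟨a, ha⟩ := hx
    exact ⟨a, fun m hm => by rw [map_smul]; exact Submodule.smul_mem _ _ (ha m hm)⟩

theorem sub_eq_add_of_add_eq_sub {G : Type*} [AddCommGroup G] {a b c s : G} (h : a + b = c - s) :
    c - a = s + b := by
  have : c = a + b + s := by rw [h]; abel
  rw [this]; abel

/-- Small simplices: a chain with small boundary is small up to a boundary. -/
theorem exists_sub_d_mem_smallChains (hU : ∀ i, IsOpen (U i)) (hcov : ⋃ i, U i = Set.univ)
    {n : ℕ} (c : (singularChains X).X (n + 1))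
    (hc : ((singularChains X).d (n + 1) n).hom c ∈ smallChains U n) :
    ∃ e, c - ((singularChains X).d (n + 2) (n + 1)).hom e ∈ smallChains U (n + 1) := by
  obtain ⟨m, hm⟩ := exists_subdiv_mem hU hcov c
  refine ⟨subdivHomotopy X m (n + 1) c, ?_⟩
  have h := d_subdivHomotopy m c
  rw [sub_eq_add_of_add_eq_sub h]
  exact add_mem (hm m le_rfl) (subdivHomotopy_mem m hc)

theorem mem_smallChains_zero (hcov : ⋃ i, U i = Set.univ) (c : (singularChains X).X 0) :
    c ∈ smallChains U 0 := by
  have hc : c ∈ Submodule.span ℚ (Set.range (simplexChain (X := X) (n := 0))) := by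
    rw [span_simplexChain]; trivial
  refine Submodule.span_mono ?_ hc
  rintro _ ⟨σ, rfl⟩
  have h : σ default ∈ ⋃ i, U i := by rw [hcov]; trivial
  obtain ⟨i, hi⟩ := Set.mem_iUnion.1 h
  refine ⟨σ, ⟨i, ?_⟩, rfl⟩
  rintro _ ⟨t, rfl⟩
  rwa [Subsingleton.elim t default]

end SingularChains

end

/-! ### Homology of points and graphs, and the long exact sequence -/

section

open CategoryTheory Limits AlgebraicTopology

namespace SingularChains

open SphereConf (singularChains)

/-- The complex has the homology of `n` points. -/
structure HasDiscreteHomology (K : ChainComplex (ModuleCat.{0} ℚ) ℕ) (n : ℕ) : Prop where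
  subsingleton : ∀ k, 1 ≤ k → Subsingleton (K.homology k)
  finite_zero : Module.Finite ℚ (K.homology 0)
  finrank_zero : Module.finrank ℚ (K.homology 0) = n

/-- The complex has the homology of a finite graph of Euler characteristic `χ`. -/
structure HasGraphHomology (K : ChainComplex (ModuleCat.{0} ℚ) ℕ) (χ : ℤ) : Prop where
  subsingleton : ∀ k, 2 ≤ k → Subsingleton (K.homology k)
  finite_zero : Module.Finite ℚ (K.homology 0)
  finite_one : Module.Finite ℚ (K.homology 1)
  finrank_sub_finrank : (Module.finrank ℚ (K.homology 0) : ℤ) - Module.finrank ℚ (K.homology 1) = χ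

theorem HasDiscreteHomology.of_iso {K L : ChainComplex (ModuleCat.{0} ℚ) ℕ} {n : ℕ}
    (h : HasDiscreteHomology K n) (e : ∀ k, K.homology k ≅ L.homology k) :
    HasDiscreteHomology L n where
  subsingleton k hk := by
    have := h.subsingleton k hk
    exact (e k).toLinearEquiv.symm.subsingleton
  finite_zero := by
    have := h.finite_zero
    exact Module.Finite.equiv (e 0).toLinearEquiv
  finrank_zero := by rw [← h.finrank_zero, (e 0).toLinearEquiv.finrank_eq]

theorem HasGraphHomology.of_iso {K L : ChainComplex (ModuleCat.{0} ℚ) ℕ} {χ : ℤ}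
    (h : HasGraphHomology K χ) (e : ∀ k, K.homology k ≅ L.homology k) :
    HasGraphHomology L χ where
  subsingleton k hk := by
    have := h.subsingleton k hk
    exact (e k).toLinearEquiv.symm.subsingleton
  finite_zero := by
    have := h.finite_zero
    exact Module.Finite.equiv (e 0).toLinearEquiv
  finite_one := by
    have := h.finite_one
    exact Module.Finite.equiv (e 1).toLinearEquiv
  finrank_sub_finrank := by
    rw [← h.finrank_sub_finrank, (e 0).toLinearEquiv.finrank_eq, (e 1).toLinearEquiv.finrank_eq]

theorem HasGraphHomology.homologyEulerChar {K : ChainComplex (ModuleCat.{0} ℚ) ℕ} {χ : ℤ}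
    (h : HasGraphHomology K χ) : K.homologyEulerChar = χ := by
  rw [HomologicalComplex.homologyEulerChar_eq_sum_finSet_of_finrankSupport_subset K {0, 1}]
  · rw [Finset.sum_pair zero_ne_one, ← h.finrank_sub_finrank]
    simp
    ring
  · rw [GradedObject.finrankSupport_subset_iff]
    intro k hk
    have hk' : 2 ≤ k := by
      by_contra hlt
      have : k = 0 ∨ k = 1 := by omega
      rcases this with rfl | rfl <;> simp at hk
    have := h.subsingleton k hk'
    exact Module.finrank_zero_of_subsingleton

theorem HasGraphHomology.hasEulerCharacteristic {X : Type} [TopologicalSpace X] {χ : ℤ}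
    (h : HasGraphHomology (singularChains X) χ) : SphereConf.HasEulerCharacteristic X χ := by
  refine ⟨fun k => ?_, ⟨1, fun k hk => h.subsingleton k hk⟩, h.homologyEulerChar⟩
  rcases k with _ | _ | k
  · exact h.finite_zero
  · exact h.finite_one
  · have := h.subsingleton (k + 2) (by omega)
    infer_instance

theorem HasDiscreteHomology.hasGraphHomology {K : ChainComplex (ModuleCat.{0} ℚ) ℕ} {n : ℕ}
    (h : HasDiscreteHomology K n) : HasGraphHomology K n where
  subsingleton k hk := h.subsingleton k (by omega)
  finite_zero := h.finite_zero
  finite_one := by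
    have := h.subsingleton 1 le_rfl
    infer_instance
  finrank_sub_finrank := by
    have := h.subsingleton 1 le_rfl
    rw [h.finrank_zero, Module.finrank_zero_of_subsingleton (M := K.homology 1)]
    simp

/-- The long exact sequence collapses to `0 → H₁(X₃) → H₀(X₁) → H₀(X₂) → H₀(X₃) → 0`, and higher
homology of `X₃` is squeezed between zeros; the ranks alternate to zero. -/
theorem hasGraphHomology_of_shortExact {S : ShortComplex (ChainComplex (ModuleCat.{0} ℚ) ℕ)}
    (hS : S.ShortExact) {m n : ℕ} (h₁ : HasDiscreteHomology S.X₁ m)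
    (h₂ : HasDiscreteHomology S.X₂ n) : HasGraphHomology S.X₃ ((n : ℤ) - m) := by
  have f₁ := h₁.finite_zero
  have f₂ := h₂.finite_zero
  have s₂ := h₂.subsingleton 1 le_rfl
  have hrel : (ComplexShape.down ℕ).Rel 1 0 := rfl
  have e₁ := hS.homology_exact₁ 1 0 hrel
  have e₂ := hS.homology_exact₂ 0
  have : Mono (hS.δ 1 0 hrel) := hS.mono_δ 1 0 hrel (ModuleCat.isZero_of_subsingleton _)
  have hg : Epi (HomologicalComplex.homologyMap S.g 0) := by
    have := hS.epi_g
    exact HomologicalComplex.epi_homologyMap_of_epi_of_not_rel S.g 0 (by simp)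
  set δ := (hS.δ 1 0 hrel).hom with hδ
  set φ := (HomologicalComplex.homologyMap S.f 0).hom with hφ
  set ψ := (HomologicalComplex.homologyMap S.g 0).hom with hψ
  have iδ : Function.Injective δ := (ModuleCat.mono_iff_injective _).1 this
  have sψ : Function.Surjective ψ := (ModuleCat.epi_iff_surjective _).1 hg
  have r₁ : LinearMap.range δ = LinearMap.ker φ := e₁.moduleCat_range_eq_ker
  have r₂ : LinearMap.range φ = LinearMap.ker ψ := e₂.moduleCat_range_eq_ker
  have fin1 : Module.Finite ℚ (S.X₃.homology 1) := Module.Finite.of_injective δ iδ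
  refine ⟨fun k hk => ?_, Module.Finite.of_surjective ψ sψ, fin1, ?_⟩
  · obtain ⟨j, rfl⟩ : ∃ j, k = j + 1 := ⟨k - 1, by omega⟩
    have a := h₂.subsingleton (j + 1) (by omega)
    have b := h₁.subsingleton j (by omega)
    have := (hS.homology_exact₃ (j + 1) j rfl).isZero_X₂
      ((ModuleCat.isZero_of_subsingleton _).eq_of_src _ _)
      ((ModuleCat.isZero_of_subsingleton _).eq_of_tgt _ _)
    exact ModuleCat.subsingleton_of_isZero this
  · have a := φ.finrank_range_add_finrank_ker
    have b := ψ.finrank_range_add_finrank_ker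
    have c := LinearMap.finrank_range_of_inj iδ
    rw [LinearMap.range_eq_top.2 sψ, finrank_top, ← r₂, h₂.finrank_zero] at b
    rw [← r₁, c, h₁.finrank_zero] at a
    omega

/-- A morphism of complexes which is injective with acyclic cokernel induces isomorphisms in
homology. -/
theorem isIso_homologyMap_of_shortExact {S : ShortComplex (ChainComplex (ModuleCat.{0} ℚ) ℕ)}
    (hS : S.ShortExact) (h : ∀ k, Subsingleton (S.X₃.homology k)) (k : ℕ) :
    IsIso (HomologicalComplex.homologyMap S.f k) := by
  have := h k
  have := h (k + 1)
  have h1 : Mono (HomologicalComplex.homologyMap S.f k) :=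
    (hS.homology_exact₁ (k + 1) k rfl).mono_g
      ((ModuleCat.isZero_of_subsingleton _).eq_of_src _ _)
  have h2 : Epi (HomologicalComplex.homologyMap S.f k) :=
    (hS.homology_exact₂ k).epi_f ((ModuleCat.isZero_of_subsingleton _).eq_of_tgt _ _)
  exact isIso_of_mono_of_epi _

variable {X Y : Type} [TopologicalSpace X] [TopologicalSpace Y]

theorem chainMap_id : chainMap (ContinuousMap.id X) = 𝟙 _ :=
  (((singularChainComplexFunctor (ModuleCat.{0} ℚ)).obj (ModuleCat.of ℚ ℚ))).map_id _

theorem chainMap_comp {Z : Type} [TopologicalSpace Z] (f : C(X, Y)) (g : C(Y, Z)) :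
    chainMap (g.comp f) = chainMap f ≫ chainMap g :=
  (((singularChainComplexFunctor (ModuleCat.{0} ℚ)).obj (ModuleCat.of ℚ ℚ))).map_comp
    (TopCat.ofHom f) (TopCat.ofHom g)

theorem homologyMap_chainMap_eq {f g : C(X, Y)} (h : f.Homotopic g) (k : ℕ) :
    HomologicalComplex.homologyMap (chainMap f) k =
      HomologicalComplex.homologyMap (chainMap g) k := by
  obtain ⟨H⟩ := h
  exact TopCat.Homotopy.congr_homologyMap_singularChainComplexFunctor
    (f := TopCat.ofHom f) (g := TopCat.ofHom g) H (ModuleCat.of ℚ ℚ) k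

/-- Homotopy equivalent spaces have isomorphic homology. -/
noncomputable def homologyIso (e : ContinuousMap.HomotopyEquiv X Y) (k : ℕ) :
    (singularChains X).homology k ≅ (singularChains Y).homology k where
  hom := HomologicalComplex.homologyMap (chainMap e.toFun) k
  inv := HomologicalComplex.homologyMap (chainMap e.invFun) k
  hom_inv_id := by
    rw [← HomologicalComplex.homologyMap_comp, ← chainMap_comp, homologyMap_chainMap_eq e.left_inv,
      chainMap_id, HomologicalComplex.homologyMap_id]
  inv_hom_id := by
    rw [← HomologicalComplex.homologyMap_comp, ← chainMap_comp,
      homologyMap_chainMap_eq e.right_inv, chainMap_id, HomologicalComplex.homologyMap_id]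

open scoped Classical in
theorem hasDiscreteHomology_of_discrete (D : Type) [TopologicalSpace D] [DiscreteTopology D]
    [Fintype D] : HasDiscreteHomology (singularChains D) (Fintype.card D) := by
  have e : (singularChains D).homology 0 ≃ₗ[ℚ] (D →₀ ℚ) :=
    ((singularHomologyFunctorZeroOfTotallyDisconnectedSpace (ModuleCat.{0} ℚ)
      (ModuleCat.of ℚ ℚ) (TopCat.of D)) ≪≫
      (ModuleCat.coprodIsoDirectSum (fun _ : D => ModuleCat.of ℚ ℚ))).toLinearEquiv ≪≫ₗ
      (finsuppLEquivDirectSum ℚ ℚ D).symm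
  refine ⟨fun k hk => ?_, Module.Finite.equiv e.symm, ?_⟩
  · exact ModuleCat.subsingleton_of_isZero
      (isZero_singularHomologyFunctor_of_totallyDisconnectedSpace (ModuleCat.{0} ℚ) k
        (ModuleCat.of ℚ ℚ) (TopCat.of D) (by omega))
  · rw [e.finrank_eq, Module.finrank_finsupp_self]

theorem hasDiscreteHomology_of_homotopyEquiv {D : Type} [TopologicalSpace D] [DiscreteTopology D]
    [Fintype D] (e : ContinuousMap.HomotopyEquiv X D) :
    HasDiscreteHomology (singularChains X) (Fintype.card D) :=
  (hasDiscreteHomology_of_discrete D).of_iso fun k => (homologyIso e k).symm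

end SingularChains

end

/-! ### The Mayer-Vietoris sequence -/

section

open CategoryTheory Limits AlgebraicTopology

namespace SingularChains

open SphereConf (singularChains)

/-- The last map need not be surjective. Its image is a copy of the cokernel of `T.f`, to which the
short exact case applies, and `h_zero` and `h_succ` say that the quotient of `T.X₃` by this image is
acyclic. -/
theorem hasGraphHomology_of_exact {T : ShortComplex (ChainComplex (ModuleCat.{0} ℚ) ℕ)}
    (hT : T.Exact) [Mono T.f] (h_zero : ∀ c, c ∈ LinearMap.range (T.g.f 0).hom)
    (h_succ : ∀ k c, (T.X₃.d (k + 1) k).hom c ∈ LinearMap.range (T.g.f k).hom →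
      ∃ e, c - (T.X₃.d (k + 2) (k + 1)).hom e ∈ LinearMap.range (T.g.f (k + 1)).hom)
    {m n : ℕ} (h₁ : HasDiscreteHomology T.X₁ m) (h₂ : HasDiscreteHomology T.X₂ n) :
    HasGraphHomology T.X₃ ((n : ℤ) - m) := by
  have hmono : Mono (cokernel.desc T.f T.g T.zero) := hT.mono_cokernelDesc
  have hcomp : cokernel.π T.f ≫ cokernel.desc T.f T.g T.zero = T.g := cokernel.π_desc _ _ _
  set h := cokernel.desc T.f T.g T.zero
  have hS₁ : (ShortComplex.mk T.f (cokernel.π T.f) (cokernel.condition T.f)).ShortExact :=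
    { exact := ShortComplex.exact_cokernel T.f
      mono_f := inferInstance
      epi_g := inferInstanceAs (Epi (cokernel.π T.f)) }
  have hS₂ : (ShortComplex.mk h (cokernel.π h) (cokernel.condition h)).ShortExact :=
    { exact := ShortComplex.exact_cokernel h
      mono_f := hmono
      epi_g := inferInstanceAs (Epi (cokernel.π h)) }
  have hG := hasGraphHomology_of_shortExact hS₁ h₁ h₂
  have hsurj : ∀ k, Function.Surjective ((cokernel.π h).f k).hom := fun k =>
    (ModuleCat.epi_iff_surjective _).1 inferInstance
  have hker : ∀ k, LinearMap.range (h.f k).hom = LinearMap.ker ((cokernel.π h).f k).hom := fun k =>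
    (hS₂.exact.map (HomologicalComplex.eval _ _ k)).moduleCat_range_eq_ker
  have hmem : ∀ k c, c ∈ LinearMap.range (T.g.f k).hom ↔ ((cokernel.π h).f k).hom c = 0 := by
    intro k c
    have hs : Function.Surjective ((cokernel.π T.f).f k).hom :=
      (ModuleCat.epi_iff_surjective _).1 inferInstance
    rw [← hcomp, HomologicalComplex.comp_f, ModuleCat.hom_comp,
      LinearMap.range_comp_of_range_eq_top _ (LinearMap.range_eq_top.2 hs), hker]
    exact LinearMap.mem_ker
  have hcomm : ∀ i j x, ((cokernel h).d i j).hom (((cokernel.π h).f i).hom x) =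
      ((cokernel.π h).f j).hom ((T.X₃.d i j).hom x) := fun i j x =>
    congrArg (fun φ => φ.hom x) ((cokernel.π h).comm i j)
  have hacyc : ∀ k, Subsingleton ((cokernel h).homology k) := by
    intro k
    refine ModuleCat.subsingleton_of_isZero ?_
    rw [← HomologicalComplex.exactAt_iff_isZero_homology]
    rcases k with _ | k
    · rw [HomologicalComplex.exactAt_iff' _ 1 0 0 (by simp) (by simp),
        ShortComplex.moduleCat_exact_iff]
      intro x _
      obtain ⟨c, rfl⟩ := hsurj 0 x
      exact ⟨0, (map_zero _).trans ((hmem 0 c).1 (h_zero c)).symm⟩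
    · rw [HomologicalComplex.exactAt_iff' _ (k + 2) (k + 1) k (by simp) (by simp),
        ShortComplex.moduleCat_exact_iff]
      intro x hx
      obtain ⟨c, rfl⟩ := hsurj (k + 1) x
      obtain ⟨e, he⟩ := h_succ k c ((hmem k _).2 ((hcomm _ _ _).symm.trans hx))
      have he' := sub_eq_zero.1 ((map_sub _ _ _).symm.trans ((hmem _ _).1 he))
      exact ⟨((cokernel.π h).f (k + 2)).hom e, (hcomm _ _ _).trans he'.symm⟩
  exact hG.of_iso fun k =>
    @asIso _ _ _ _ _ (isIso_homologyMap_of_shortExact hS₂ hacyc k)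

theorem mapDomain_sub_injective {P Q : Type*} {a b : P → Q} (ha : Function.Injective a)
    (hab : ∀ p p', a p ≠ b p') {c : P →₀ ℚ}
    (h : Finsupp.mapDomain a c - Finsupp.mapDomain b c = 0) : c = 0 := by
  ext p
  have h' := DFunLike.congr_fun h (a p)
  rwa [Finsupp.sub_apply, Finsupp.mapDomain_apply ha, Finsupp.mapDomain_of_notMem_range, sub_zero] at h'
  rintro ⟨p', hp'⟩
  exact hab p p' hp'.symm

/-- Subtracting the difference built from the coefficients of `c` on the range of `a` leaves a chain
off that range. There `π` is injective, so a chain killed by `π` is zero. -/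
theorem exists_mapDomain_sub_eq {P Q R : Type*} {a b : P → Q} {π : Q → R}
    (ha : Function.Injective a) (hab : ∀ p p', a p ≠ b p') (hπ : π ∘ a = π ∘ b)
    (hinj : Set.InjOn π (Set.range a)ᶜ) {c : Q →₀ ℚ} (hc : Finsupp.mapDomain π c = 0) :
    ∃ e : P →₀ ℚ, Finsupp.mapDomain a e - Finsupp.mapDomain b e = c := by
  refine ⟨Finsupp.comapDomain a c ha.injOn, ?_⟩
  set e := Finsupp.comapDomain a c ha.injOn with he
  set c' := c - (Finsupp.mapDomain a e - Finsupp.mapDomain b e) with hc'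
  have hz : Finsupp.mapDomain π c' = 0 := by
    have : ∀ x y : Q →₀ ℚ, Finsupp.mapDomain π (x - y) =
        Finsupp.mapDomain π x - Finsupp.mapDomain π y :=
      fun x y => map_sub (Finsupp.mapDomain.addMonoidHom π) x y
    rw [hc', this, this, hc, ← Finsupp.mapDomain_comp, ← Finsupp.mapDomain_comp, hπ]
    simp
  have hsupp : (c'.support : Set Q) ⊆ (Set.range a)ᶜ := by
    intro q hq
    rintro ⟨p, rfl⟩
    rw [Finset.mem_coe, Finsupp.mem_support_iff] at hq
    apply hq
    rw [hc', Finsupp.sub_apply, Finsupp.sub_apply, Finsupp.mapDomain_apply ha,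
      Finsupp.mapDomain_of_notMem_range, he, Finsupp.comapDomain_apply]
    · simp
    · rintro ⟨p', hp'⟩
      exact hab p p' hp'.symm
  have h0 : c' = 0 := by
    refine Finsupp.mapDomain_injOn _ hinj hsupp (by simp) ?_
    rw [hz, Finsupp.mapDomain_zero]
  exact (sub_eq_zero.1 h0).symm

variable {X : Type} [TopologicalSpace X] (A B : Set X)

/-- The inclusion of the intersection in the first summand. -/
def inclLeft : C(↥(A ∩ B), ↥A ⊕ ↥B) :=
  ⟨fun x => Sum.inl ⟨x.1, x.2.1⟩, continuous_inl.comp (by fun_prop)⟩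

/-- The inclusion of the intersection in the second summand. -/
def inclRight : C(↥(A ∩ B), ↥A ⊕ ↥B) :=
  ⟨fun x => Sum.inr ⟨x.1, x.2.2⟩, continuous_inr.comp (by fun_prop)⟩

/-- The map from the disjoint union of two subspaces. -/
def sumMap : C(↥A ⊕ ↥B, X) :=
  ⟨Sum.elim Subtype.val Subtype.val, continuous_subtype_val.sumElim continuous_subtype_val⟩

theorem sumMap_comp_inclLeft : (sumMap A B).comp (inclLeft A B) =
    (sumMap A B).comp (inclRight A B) := rfl

variable {A B}

/-- A simplex is connected, so its image cannot meet both summands. -/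
theorem exists_inl_or_inr {n : ℕ} (σ : C(Simplex n, ↥A ⊕ ↥B)) :
    (∃ τ : C(Simplex n, ↥A), ∀ t, σ t = Sum.inl (τ t)) ∨
      ∃ τ : C(Simplex n, ↥B), ∀ t, σ t = Sum.inr (τ t) := by
  rcases Sum.isPreconnected_iff.1 (isPreconnected_range σ.continuous) with ⟨s, -, hs⟩ | ⟨s, -, hs⟩
  · have h : ∀ t, ∃ x, σ t = Sum.inl x := fun t => by
      obtain ⟨x, -, hx⟩ := hs ▸ Set.mem_range_self t
      exact ⟨x, hx.symm⟩
    choose τ hτ using h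
    exact Or.inl ⟨⟨τ, Topology.IsEmbedding.inl.continuous_iff.2
      (σ.continuous.congr fun t => hτ t)⟩, hτ⟩
  · have h : ∀ t, ∃ x, σ t = Sum.inr x := fun t => by
      obtain ⟨x, -, hx⟩ := hs ▸ Set.mem_range_self t
      exact ⟨x, hx.symm⟩
    choose τ hτ using h
    exact Or.inr ⟨⟨τ, Topology.IsEmbedding.inr.continuous_iff.2
      (σ.continuous.congr fun t => hτ t)⟩, hτ⟩

theorem inclLeft_comp_injective (n : ℕ) :
    Function.Injective fun σ : C(Simplex n, ↥(A ∩ B)) => (inclLeft A B).comp σ := by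
  intro σ τ h
  ext t
  have := DFunLike.congr_fun h t
  exact congrArg (sumMap A B) this

theorem inclLeft_comp_ne_inclRight_comp {n : ℕ} (σ τ : C(Simplex n, ↥(A ∩ B))) :
    (inclLeft A B).comp σ ≠ (inclRight A B).comp τ := by
  intro h
  have := DFunLike.congr_fun h (stdSimplex.vertex 0)
  simp [inclLeft, inclRight] at this

/-- Two simplices with the same image in `X` but from different summands lie over `A ∩ B`, and the
one in the left summand is then among those removed. -/
theorem sumMap_comp_injOn (n : ℕ) :
    Set.InjOn (fun σ : C(Simplex n, ↥A ⊕ ↥B) => (sumMap A B).comp σ)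
      (Set.range fun σ : C(Simplex n, ↥(A ∩ B)) => (inclLeft A B).comp σ)ᶜ := by
  have key : ∀ (σ σ' : C(Simplex n, ↥A ⊕ ↥B)) (τ : C(Simplex n, ↥A)) (τ' : C(Simplex n, ↥B)),
      (∀ t, σ t = Sum.inl (τ t)) → (∀ t, σ' t = Sum.inr (τ' t)) →
      (sumMap A B).comp σ = (sumMap A B).comp σ' →
      σ ∈ Set.range fun σ : C(Simplex n, ↥(A ∩ B)) => (inclLeft A B).comp σ := by
    intro σ σ' τ τ' hτ hτ' h
    have h' : ∀ t, (τ t : X) = τ' t := fun t => by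
      have := DFunLike.congr_fun h t
      simpa [sumMap, hτ, hτ'] using this
    refine ⟨⟨fun t => ⟨τ t, (τ t).2, by rw [h']; exact (τ' t).2⟩, by fun_prop⟩, ?_⟩
    ext1 t
    rw [hτ]; rfl
  intro σ hσ σ' hσ' h
  rcases exists_inl_or_inr σ with ⟨τ, hτ⟩ | ⟨τ, hτ⟩ <;>
    rcases exists_inl_or_inr σ' with ⟨τ', hτ'⟩ | ⟨τ', hτ'⟩
  · ext1 t
    have := DFunLike.congr_fun h t
    rw [hτ, hτ']
    exact congrArg _ (Subtype.ext (by simpa [sumMap, hτ, hτ'] using this))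
  · exact absurd (key σ σ' τ τ' hτ hτ' h) hσ
  · exact absurd (key σ' σ τ' τ hτ' hτ h.symm) hσ'
  · ext1 t
    have := DFunLike.congr_fun h t
    rw [hτ, hτ']
    exact congrArg _ (Subtype.ext (by simpa [sumMap, hτ, hτ'] using this))

variable (A B)

/-- The Mayer-Vietoris sequence of two subspaces, before the last map is made surjective. -/
noncomputable def mayerVietoris : ShortComplex (ChainComplex (ModuleCat.{0} ℚ) ℕ) :=
  ShortComplex.mk (chainMap (inclLeft A B) - chainMap (inclRight A B)) (chainMap (sumMap A B)) (by
    rw [Preadditive.sub_comp, ← chainMap_comp, ← chainMap_comp, sumMap_comp_inclLeft, sub_self])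

theorem mayerVietoris_f_chainEquiv (n : ℕ) (c : C(Simplex n, ↥(A ∩ B)) →₀ ℚ) :
    ((mayerVietoris A B).f.f n).hom (chainEquiv _ n c) = chainEquiv _ n
      (Finsupp.mapDomain (inclLeft A B).comp c - Finsupp.mapDomain (inclRight A B).comp c) := by
  rw [map_sub, ← chainMap_chainEquiv, ← chainMap_chainEquiv]
  rfl

instance : Mono (mayerVietoris A B).f := by
  refine HomologicalComplex.mono_of_mono_f _ fun n => ?_
  rw [ModuleCat.mono_iff_injective, ← LinearMap.ker_eq_bot, LinearMap.ker_eq_bot']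
  intro x hx
  obtain ⟨c, rfl⟩ := (chainEquiv _ n).surjective x
  have hx' := (LinearEquiv.map_eq_zero_iff (chainEquiv _ n)).1
    ((mayerVietoris_f_chainEquiv A B n c).symm.trans hx)
  rw [mapDomain_sub_injective (inclLeft_comp_injective n) inclLeft_comp_ne_inclRight_comp hx']
  exact map_zero _

theorem mayerVietoris_exact : (mayerVietoris A B).Exact := by
  refine HomologicalComplex.exact_of_degreewise_exact _ fun n => ?_
  rw [ShortComplex.moduleCat_exact_iff]
  intro x hx
  obtain ⟨c, rfl⟩ := (chainEquiv _ n).surjective x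
  have hx' : ((chainMap (sumMap A B)).f n).hom (chainEquiv _ n c) = 0 := hx
  rw [chainMap_chainEquiv, LinearEquiv.map_eq_zero_iff] at hx'
  obtain ⟨e, he⟩ := exists_mapDomain_sub_eq (inclLeft_comp_injective n)
    inclLeft_comp_ne_inclRight_comp rfl (sumMap_comp_injOn n) hx'
  refine ⟨chainEquiv _ n e, ?_⟩
  exact (mayerVietoris_f_chainEquiv A B n e).trans (congrArg _ he)

/-- This lets the small simplices theorem supply the acyclicity hypotheses for the Mayer-Vietoris
sequence. -/
theorem smallChains_eq_range (n : ℕ) :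
    smallChains (fun b : Bool => cond b A B) n =
      LinearMap.range ((chainMap (sumMap A B)).f n).hom := by
  refine le_antisymm ?_ ?_
  · rw [smallChains, Submodule.span_le]
    rintro _ ⟨σ, ⟨b, hb⟩, rfl⟩
    cases b
    · refine ⟨simplexChain ⟨fun t => Sum.inr ⟨σ t, hb ⟨t, rfl⟩⟩,
        continuous_inr.comp (by fun_prop)⟩, ?_⟩
      rw [chainMap_simplexChain]; rfl
    · refine ⟨simplexChain ⟨fun t => Sum.inl ⟨σ t, hb ⟨t, rfl⟩⟩,
        continuous_inl.comp (by fun_prop)⟩, ?_⟩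
      rw [chainMap_simplexChain]; rfl
  · rw [LinearMap.range_eq_map, ← span_simplexChain, Submodule.map_span_le]
    rintro _ ⟨σ, rfl⟩
    rw [chainMap_simplexChain]
    refine Submodule.subset_span ⟨_, ?_, rfl⟩
    rcases exists_inl_or_inr σ with ⟨τ, hτ⟩ | ⟨τ, hτ⟩
    · refine ⟨true, ?_⟩
      rintro _ ⟨t, rfl⟩
      simp [sumMap, hτ]
    · refine ⟨false, ?_⟩
      rintro _ ⟨t, rfl⟩
      simp [sumMap, hτ]

variable {A B}

/-- Mayer-Vietoris for a space covered by two open subspaces whose disjoint union, and whose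
intersection, have the homology of finitely many points. -/
theorem hasGraphHomology_of_isOpen_cover (hA : IsOpen A) (hB : IsOpen B) (hAB : A ∪ B = Set.univ)
    {m n : ℕ} (h₁ : HasDiscreteHomology (singularChains ↥(A ∩ B)) m)
    (h₂ : HasDiscreteHomology (singularChains (↥A ⊕ ↥B)) n) :
    HasGraphHomology (singularChains X) ((n : ℤ) - m) := by
  have hcov : ⋃ b : Bool, cond b A B = Set.univ := by rw [← hAB, Set.union_eq_iUnion]
  have hop : ∀ b : Bool, IsOpen (cond b A B) := fun b => by cases b <;> assumption
  refine hasGraphHomology_of_exact (mayerVietoris_exact A B) (fun c => ?_) (fun k c hc => ?_) h₁ h₂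
  · exact (smallChains_eq_range A B 0).le (mem_smallChains_zero hcov c)
  · obtain ⟨e, he⟩ := exists_sub_d_mem_smallChains hop hcov c
      ((smallChains_eq_range A B k).ge hc)
    exact ⟨e, (smallChains_eq_range A B (k + 1)).le he⟩

end SingularChains

end

/-! ### Simplicial complexes spanned by coordinate vectors -/

section

namespace CoordinateComplex

variable {n : ℕ}

/-- The `i`-th standard basis vector. -/
noncomputable abbrev basisVec (i : Fin n) : EuclideanSpace ℝ (Fin n) := EuclideanSpace.single i 1

theorem basisVec_injective : Function.Injective (basisVec (n := n)) := by
  intro i j h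
  by_contra hij
  have := congrArg (fun x : EuclideanSpace ℝ (Fin n) => x i) h
  simp [hij] at this

/-- The face of the standard simplex spanned by the basis vectors with index in `u`. -/
def hull (u : Finset (Fin n)) : Set (EuclideanSpace ℝ (Fin n)) :=
  {x | (∀ i, 0 ≤ x i) ∧ ∑ i, x i = 1 ∧ ∀ i ∉ u, x i = 0}

theorem convex_hull (u : Finset (Fin n)) : Convex ℝ (hull u) := by
  intro x hx y hy a b ha hb hab
  refine ⟨fun i => ?_, ?_, fun i hi => ?_⟩
  · have := hx.1 i
    have := hy.1 i
    simp only [PiLp.add_apply, PiLp.smul_apply, smul_eq_mul]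
    positivity
  · simp only [PiLp.add_apply, PiLp.smul_apply, smul_eq_mul, Finset.sum_add_distrib,
      ← Finset.mul_sum, hx.2.1, hy.2.1]
    linarith
  · simp [hx.2.2 i hi, hy.2.2 i hi]

theorem basisVec_mem_hull {u : Finset (Fin n)} {i : Fin n} (hi : i ∈ u) : basisVec i ∈ hull u := by
  refine ⟨fun j => ?_, ?_, fun j hj => ?_⟩
  · rw [PiLp.single_apply]; split_ifs <;> simp
  · simp
  · have : j ≠ i := fun h => hj (h ▸ hi)
    simp [this]

theorem sum_smul_basisVec (x : EuclideanSpace ℝ (Fin n)) : ∑ i, x i • basisVec i = x := by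
  ext j
  simp [Pi.single_apply]

theorem convexHull_image_basisVec (u : Finset (Fin n)) :
    convexHull ℝ ((u.image basisVec : Finset (EuclideanSpace ℝ (Fin n))) :
      Set (EuclideanSpace ℝ (Fin n))) = hull u := by
  refine Set.Subset.antisymm (convexHull_min ?_ (convex_hull u)) fun x hx => ?_
  · intro y hy
    obtain ⟨i, hi, rfl⟩ := Finset.mem_image.1 (Finset.mem_coe.1 hy)
    exact basisVec_mem_hull hi
  · have h1 : ∑ i ∈ u, x i = 1 := by
      rw [← hx.2.1]
      exact Finset.sum_subset (Finset.subset_univ _) fun i _ hi => hx.2.2 i hi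
    have h2 : ∑ i ∈ u, x i • basisVec i = x := by
      conv_rhs => rw [← sum_smul_basisVec x]
      exact Finset.sum_subset (Finset.subset_univ _) fun i _ hi => by rw [hx.2.2 i hi, zero_smul]
    rw [← h2]
    exact (convex_convexHull ℝ _).sum_mem (fun i _ => hx.1 i) h1 fun i hi =>
      subset_convexHull ℝ _ (Finset.mem_coe.2 (Finset.mem_image_of_mem _ hi))

variable {T : Type} (tri : T → Finset (Fin n))

/-- The simplicial complex in coordinate space whose maximal faces are spanned by the sets
`tri t` of basis vectors. -/
noncomputable def complex : Geometry.SimplicialComplex ℝ (EuclideanSpace ℝ (Fin n)) where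
  faces := {s | s.Nonempty ∧ ∃ t, s ⊆ (tri t).image basisVec}
  isRelLowerSet_faces := by
    rintro s ⟨hs, t, ht⟩
    exact ⟨hs, fun s' hs' hne => ⟨hne, t, hs'.trans ht⟩⟩
  indep := by
    rintro s ⟨hs, t, ht⟩
    have h1 : AffineIndependent ℝ (basisVec (n := n)) := by
      have := (EuclideanSpace.basisFun (Fin n) ℝ).toBasis.linearIndependent.affineIndependent
      convert! this using 1
      ext i
      simp
    refine h1.range.mono fun x hx => ?_
    obtain ⟨i, -, rfl⟩ := Finset.mem_image.1 (ht hx)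
    exact ⟨i, rfl⟩
  inter_subset_convexHull := by
    rintro s s' ⟨-, t, ht⟩ ⟨-, t', ht'⟩
    obtain ⟨u, -, rfl⟩ := Finset.subset_image_iff.1 ht
    obtain ⟨u', -, rfl⟩ := Finset.subset_image_iff.1 ht'
    rintro x ⟨hx, hx'⟩
    rw [convexHull_image_basisVec] at hx hx'
    -- All faces share the ambient coordinates as barycentric coordinates, so two faces meet exactly
    -- where the coordinates outside `u ∩ u'` vanish.
    have h : x ∈ hull (u ∩ u') := ⟨hx.1, hx.2.1, fun i hi => by
      by_contra h0
      exact hi (Finset.mem_inter.2 ⟨by_contra fun h => h0 (hx.2.2 i h),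
        by_contra fun h => h0 (hx'.2.2 i h)⟩)⟩
    rw [← convexHull_image_basisVec] at h
    refine convexHull_mono ?_ h
    rw [Finset.image_inter _ _ basisVec_injective, Finset.coe_inter]

theorem mem_space {tri : T → Finset (Fin n)} (h3 : ∀ t, (tri t).card = 3)
    {x : EuclideanSpace ℝ (Fin n)} : x ∈ (complex tri).space ↔ ∃ t, x ∈ hull (tri t) := by
  rw [Geometry.SimplicialComplex.mem_space_iff]
  constructor
  · rintro ⟨s, ⟨-, t, ht⟩, hx⟩
    refine ⟨t, ?_⟩
    rw [← convexHull_image_basisVec]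
    exact convexHull_mono (Finset.coe_subset.2 ht) hx
  · rintro ⟨t, ht⟩
    refine ⟨(tri t).image basisVec, ⟨?_, t, subset_rfl⟩, ?_⟩
    · rw [Finset.image_nonempty, ← Finset.card_pos, h3]; norm_num
    · rwa [convexHull_image_basisVec]

theorem isFinitePureTwoComplex [Fintype T] [Nonempty T] {tri : T → Finset (Fin n)}
    (h3 : ∀ t, (tri t).card = 3) : SphereConf.IsFinitePureTwoComplex (complex tri) := by
  classical
  have hc : ∀ t, ((tri t).image basisVec : Finset (EuclideanSpace ℝ (Fin n))).card = 3 := fun t => by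
    rw [Finset.card_image_of_injective _ basisVec_injective, h3]
  have hne : ∀ t, ((tri t).image basisVec : Finset (EuclideanSpace ℝ (Fin n))).Nonempty :=
    fun t => by rw [← Finset.card_pos, hc]; norm_num
  refine ⟨?_, ?_, ?_, ?_⟩
  · refine ((Finset.univ.biUnion fun t => ((tri t).image basisVec).powerset).finite_toSet).subset ?_
    rintro s ⟨-, t, ht⟩
    simp only [Finset.coe_biUnion, Set.mem_iUnion]
    exact ⟨t, Finset.mem_coe.2 (Finset.mem_univ _), Finset.mem_coe.2 (Finset.mem_powerset.2 ht)⟩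
  · exact ⟨_, hne (Classical.arbitrary T), _, subset_rfl⟩
  · rintro s ⟨-, t, ht⟩
    exact (Finset.card_le_card ht).trans (hc t).le
  · rintro s ⟨-, t, ht⟩
    exact ⟨_, ⟨hne t, t, subset_rfl⟩, ht, hc t⟩

theorem faces_card_three {tri : T → Finset (Fin n)} (h3 : ∀ t, (tri t).card = 3)
    (s : Finset (EuclideanSpace ℝ (Fin n))) :
    (s ∈ (complex tri).faces ∧ s.card = 3) ↔ ∃ t, s = (tri t).image basisVec := by
  classical
  have hc : ∀ t, ((tri t).image basisVec : Finset (EuclideanSpace ℝ (Fin n))).card = 3 := fun t => by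
    rw [Finset.card_image_of_injective _ basisVec_injective, h3]
  constructor
  · rintro ⟨⟨-, t, ht⟩, hs⟩
    exact ⟨t, Finset.eq_of_subset_of_card_le ht (by rw [hc, hs])⟩
  · rintro ⟨t, rfl⟩
    exact ⟨⟨by rw [← Finset.card_pos, hc]; norm_num, t, subset_rfl⟩, hc t⟩

theorem mem_vertices {tri : T → Finset (Fin n)} {x : EuclideanSpace ℝ (Fin n)} :
    x ∈ (complex tri).vertices ↔ ∃ t, ∃ i ∈ tri t, x = basisVec i := by
  change ({x} : Finset _) ∈ (complex tri).faces ↔ _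
  constructor
  · rintro ⟨-, t, ht⟩
    obtain ⟨i, hi, h⟩ := Finset.mem_image.1 (Finset.singleton_subset_iff.1 ht)
    exact ⟨t, i, hi, h.symm⟩
  · rintro ⟨t, i, hi, rfl⟩
    exact ⟨Finset.singleton_nonempty _, t,
      Finset.singleton_subset_iff.2 (Finset.mem_image_of_mem _ hi)⟩

end CoordinateComplex

end

/-! ### Straight-line homotopy equivalences and intersections of faces -/

section

theorem continuous_of_isClosed_fibers {Z D : Type*} [TopologicalSpace Z] [TopologicalSpace D]
    [Finite D] {p : Z → D} (h : ∀ d, IsClosed (p ⁻¹' {d})) : Continuous p := by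
  refine continuous_iff_isClosed.2 fun s _ => ?_
  rw [← Set.biUnion_preimage_singleton]
  exact (Set.toFinite s).isClosed_biUnion fun d _ => h d

/-- Each piece of `Z` contracts to its centre along segments of a vector space; since `j` is an
embedding, continuity can be checked there. -/
theorem nonempty_homotopyEquiv_of_segment {Z D E : Type} [TopologicalSpace Z] [TopologicalSpace D]
    [DiscreteTopology D] [AddCommGroup E] [Module ℝ E] [TopologicalSpace E] [ContinuousSMul ℝ E]
    [IsTopologicalAddGroup E] {j : Z → E} (hj : Topology.IsEmbedding j) {p : Z → D}
    (hp : Continuous p) {c : D → Z} (hpc : ∀ d, p (c d) = d)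
    (hseg : ∀ z, ∀ s ∈ Set.Icc (0 : ℝ) 1, (1 - s) • j z + s • j (c (p z)) ∈ Set.range j) :
    Nonempty (ContinuousMap.HomotopyEquiv Z D) := by
  choose H hH using fun q : unitInterval × Z => hseg q.2 q.1 q.1.2
  have hcont : Continuous H := by
    rw [hj.continuous_iff]
    have : j ∘ H = fun q : unitInterval × Z =>
        (1 - (q.1 : ℝ)) • j q.2 + (q.1 : ℝ) • j (c (p q.2)) := funext hH
    rw [this]
    have h1 : Continuous fun q : unitInterval × Z => j q.2 := hj.continuous.comp continuous_snd
    have h2 : Continuous fun q : unitInterval × Z => j (c (p q.2)) :=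
      hj.continuous.comp (continuous_of_discreteTopology.comp (hp.comp continuous_snd))
    exact ((continuous_const.sub (continuous_subtype_val.comp continuous_fst)).smul h1).add
      ((continuous_subtype_val.comp continuous_fst).smul h2)
  refine ⟨⟨⟨p, hp⟩, ⟨c, continuous_of_discreteTopology⟩, ?_, ?_⟩⟩
  · refine ContinuousMap.Homotopic.symm ⟨⟨⟨H, hcont⟩, fun z => ?_, fun z => ?_⟩⟩
    · apply hj.injective
      simpa using hH (0, z)
    · apply hj.injective
      simpa using hH (1, z)
  · have : (⟨p, hp⟩ : C(Z, D)).comp ⟨c, continuous_of_discreteTopology⟩ = ContinuousMap.id D := by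
      ext d; exact hpc d
    rw [this]

/-- The disjoint union of two homotopies. -/
def sumHomotopy {A B A' B' : Type} [TopologicalSpace A] [TopologicalSpace B] [TopologicalSpace A']
    [TopologicalSpace B'] {f₀ f₁ : C(A, A')} {g₀ g₁ : C(B, B')} (F : f₀.Homotopy f₁)
    (G : g₀.Homotopy g₁) (h₀ h₁ : C(A ⊕ B, A' ⊕ B')) (e₀ : ∀ x, h₀ x = Sum.map f₀ g₀ x)
    (e₁ : ∀ x, h₁ x = Sum.map f₁ g₁ x) : h₀.Homotopy h₁ where
  toFun q := Sum.map F G (Homeomorph.prodSumDistrib q)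
  continuous_toFun := (F.continuous.sumMap G.continuous).comp Homeomorph.prodSumDistrib.continuous
  map_zero_left x := by
    rw [e₀]
    rcases x with x | x
    · exact congrArg Sum.inl (F.map_zero_left x)
    · exact congrArg Sum.inr (G.map_zero_left x)
  map_one_left x := by
    rw [e₁]
    rcases x with x | x
    · exact congrArg Sum.inl (F.map_one_left x)
    · exact congrArg Sum.inr (G.map_one_left x)

theorem nonempty_homotopyEquiv_sum {A B A' B' : Type} [TopologicalSpace A] [TopologicalSpace B]
    [TopologicalSpace A'] [TopologicalSpace B'] (e : ContinuousMap.HomotopyEquiv A A')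
    (f : ContinuousMap.HomotopyEquiv B B') :
    Nonempty (ContinuousMap.HomotopyEquiv (A ⊕ B) (A' ⊕ B')) := by
  obtain ⟨F⟩ := e.left_inv
  obtain ⟨G⟩ := f.left_inv
  obtain ⟨F'⟩ := e.right_inv
  obtain ⟨G'⟩ := f.right_inv
  exact ⟨⟨⟨Sum.map e.toFun f.toFun, e.toFun.continuous.sumMap f.toFun.continuous⟩,
    ⟨Sum.map e.invFun f.invFun, e.invFun.continuous.sumMap f.invFun.continuous⟩,
    ⟨sumHomotopy F G _ _ (by rintro (x | x) <;> rfl) (by rintro (x | x) <;> rfl)⟩,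
    ⟨sumHomotopy F' G' _ _ (by rintro (x | x) <;> rfl) (by rintro (x | x) <;> rfl)⟩⟩⟩

namespace CoordinateComplex

variable {n : ℕ} {T : Type} {tri : T → Finset (Fin n)}

theorem isClosed_hull (u : Finset (Fin n)) : IsClosed (hull u) := by
  have : hull u = (⋂ i, {x : EuclideanSpace ℝ (Fin n) | 0 ≤ x i}) ∩
      ({x | ∑ i, x i = 1} ∩ ⋂ i, ⋂ (_ : i ∉ u), {x | x i = 0}) := by
    ext x
    simp only [hull, Set.mem_ofPred_eq, Set.mem_inter_iff, Set.mem_iInter]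
  rw [this]
  refine (isClosed_iInter fun i => isClosed_le continuous_const (by fun_prop)).inter
    ((isClosed_eq (by fun_prop) continuous_const).inter
    (isClosed_iInter fun i => isClosed_iInter fun _ => isClosed_eq (by fun_prop) continuous_const))

theorem add_le_one_of_mem_hull {u : Finset (Fin n)} {x : EuclideanSpace ℝ (Fin n)} (hx : x ∈ hull u)
    {i j : Fin n} (hij : i ≠ j) : x i + x j ≤ 1 := by
  rw [← hx.2.1, ← Finset.sum_pair (f := fun i => x i) hij]
  exact Finset.sum_le_sum_of_subset_of_nonneg (Finset.subset_univ _) fun j _ _ => hx.1 j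

theorem eq_basisVec_of_mem_hull {u : Finset (Fin n)} {x : EuclideanSpace ℝ (Fin n)} (hx : x ∈ hull u)
    {i : Fin n} (hi : x i = 1) : x = basisVec i := by
  ext j
  by_cases hij : j = i
  · subst hij; simp [hi]
  · have h := add_le_one_of_mem_hull hx hij
    have h' := hx.1 j
    rw [PiLp.single_apply, if_neg hij]
    linarith

/-- Two faces meeting in at most one vertex have no common point other than that vertex. -/
theorem exists_eq_basisVec_of_mem_hull {u v : Finset (Fin n)} (huv : (u ∩ v).card ≤ 1)
    {x : EuclideanSpace ℝ (Fin n)} (hu : x ∈ hull u) (hv : x ∈ hull v) :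
    ∃ i ∈ u ∩ v, x = basisVec i := by
  have hsum : ∑ i ∈ u ∩ v, x i = 1 := by
    rw [← hu.2.1]
    refine Finset.sum_subset (Finset.subset_univ _) fun i _ hi => ?_
    rw [Finset.mem_inter, not_and_or] at hi
    exact hi.elim (hu.2.2 i) (hv.2.2 i)
  have hne : (u ∩ v).Nonempty := by
    by_contra h
    rw [Finset.not_nonempty_iff_eq_empty] at h
    simp [h] at hsum
  obtain ⟨i, hi⟩ := Finset.card_eq_one.1 (le_antisymm huv (Finset.card_pos.2 hne))
  rw [hi, Finset.sum_singleton] at hsum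
  exact ⟨i, by simp [hi], eq_basisVec_of_mem_hull hu hsum⟩

end CoordinateComplex

end

/-! ### Homology of triangles meeting only at vertices -/

section

namespace CoordinateComplex

variable {n : ℕ} {T : Type} {tri : T → Finset (Fin n)}

/-- The complement of the vertices. -/
def awayFromVertices (tri : T → Finset (Fin n)) : Set (complex tri).space :=
  {x | ∀ i, x.1 i < 1}

/-- The points with one large coordinate. -/
def nearVertices (tri : T → Finset (Fin n)) : Set (complex tri).space :=
  {x | ∃ i, 1 / 2 < x.1 i}

theorem isOpen_awayFromVertices : IsOpen (awayFromVertices tri) := by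
  have : awayFromVertices tri = ⋂ i, {x | x.1 i < 1} := by
    ext x; simp only [awayFromVertices, Set.mem_ofPred_eq, Set.mem_iInter]
  rw [this]
  exact isOpen_iInter_of_finite fun i => isOpen_lt (by fun_prop) continuous_const

theorem isOpen_nearVertices : IsOpen (nearVertices tri) := by
  have : nearVertices tri = ⋃ i, {x | 1 / 2 < x.1 i} := by
    ext x; simp only [nearVertices, Set.mem_ofPred_eq, Set.mem_iUnion]
  rw [this]
  exact isOpen_iUnion fun i => isOpen_lt continuous_const (by fun_prop)

theorem awayFromVertices_union_nearVertices :
    awayFromVertices tri ∪ nearVertices tri = Set.univ := by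
  refine Set.eq_univ_of_forall fun x => ?_
  by_cases h : ∀ i, x.1 i < 1
  · exact Or.inl h
  · push Not at h
    obtain ⟨i, hi⟩ := h
    exact Or.inr ⟨i, by linarith⟩

section

variable (h3 : ∀ t, (tri t).card = 3) (hinter : ∀ t t', t ≠ t' → (tri t ∩ tri t').card ≤ 1)

theorem eq_of_mem_hull (hinter : ∀ t t', t ≠ t' → (tri t ∩ tri t').card ≤ 1)
    {x : EuclideanSpace ℝ (Fin n)} (hx : ∀ i, x i < 1) {t t' : T}
    (h : x ∈ hull (tri t)) (h' : x ∈ hull (tri t')) : t = t' := by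
  by_contra hne
  obtain ⟨i, -, rfl⟩ := exists_eq_basisVec_of_mem_hull (hinter t t' hne) h h'
  simpa using hx i

/-- A triangle containing a point of the complex. -/
noncomputable def triangleOf (h3 : ∀ t, (tri t).card = 3) (x : (complex tri).space) : T :=
  ((mem_space h3).1 x.2).choose

theorem mem_hull_triangleOf (x : (complex tri).space) : x.1 ∈ hull (tri (triangleOf h3 x)) :=
  ((mem_space h3).1 x.2).choose_spec

include hinter in
theorem triangleOf_eq {x : (complex tri).space} (hx : x ∈ awayFromVertices tri) {t : T}
    (h : x.1 ∈ hull (tri t)) : triangleOf h3 x = t :=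
  eq_of_mem_hull hinter hx (mem_hull_triangleOf h3 x) h

include hinter in
-- Away from the vertices the triangles are disjoint, so the fibres are traces of closed faces and
-- there are finitely many of them.
theorem continuous_triangleOf [Finite T] [TopologicalSpace T] :
    Continuous fun x : awayFromVertices tri => triangleOf h3 x.1 := by
  refine continuous_of_isClosed_fibers fun t => ?_
  have : (fun x : awayFromVertices tri => triangleOf h3 x.1) ⁻¹' {t} =
      (fun x : awayFromVertices tri => x.1.1) ⁻¹' hull (tri t) := by
    ext x
    constructor
    · rintro rfl
      exact mem_hull_triangleOf h3 x.1
    · exact fun h => triangleOf_eq h3 hinter x.2 h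
  rw [this]
  exact (isClosed_hull _).preimage (by fun_prop)

/-- A point of a triangle with weight `w` at one vertex and equal weights at the other two. -/
noncomputable def weighted (u : Finset (Fin n)) (w : ℝ) (i : Fin n) : EuclideanSpace ℝ (Fin n) :=
  WithLp.toLp 2 fun j => if j = i then w else if j ∈ u then (1 - w) / 2 else 0

theorem weighted_mem_hull {u : Finset (Fin n)} (hu : u.card = 3) {i : Fin n} (hi : i ∈ u) {w : ℝ}
    (h0 : 0 ≤ w) (h1 : w ≤ 1) : weighted u w i ∈ hull u := by
  refine ⟨fun j => ?_, ?_, fun j hj => ?_⟩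
  · simp only [weighted]
    split_ifs <;> linarith
  · simp only [weighted]
    rw [← Finset.add_sum_erase _ _ (Finset.mem_univ i), if_pos rfl,
      ← Finset.sum_subset (s₁ := u.erase i) (Finset.erase_subset_erase _ (Finset.subset_univ _)),
      Finset.sum_congr rfl (g := fun _ => (1 - w) / 2), Finset.sum_const,
      Finset.card_erase_of_mem hi, hu]
    · simp; ring
    · intro j hj
      rw [if_neg (Finset.ne_of_mem_erase hj), if_pos (Finset.mem_of_mem_erase hj)]
    · intro j hj hj'
      have hji := Finset.ne_of_mem_erase hj
      rw [if_neg hji, if_neg fun h => hj' (Finset.mem_erase.2 ⟨hji, h⟩)]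
  · have hji : j ≠ i := fun h => hj (h ▸ hi)
    simp [weighted, hji, hj]

theorem weighted_apply_lt {u : Finset (Fin n)} {i : Fin n} {w : ℝ} (h0 : 0 ≤ w) (h1 : w < 1)
    (j : Fin n) : weighted u w i j < 1 := by
  simp only [weighted]
  split_ifs <;> linarith

theorem isEmbedding_val {A : Set (complex tri).space} :
    Topology.IsEmbedding fun x : A => (x.1.1 : EuclideanSpace ℝ (Fin n)) :=
  Topology.IsEmbedding.subtypeVal.comp Topology.IsEmbedding.subtypeVal

theorem segment_mem_hull {u : Finset (Fin n)} {x y : EuclideanSpace ℝ (Fin n)} (hx : x ∈ hull u)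
    (hy : y ∈ hull u) {s : ℝ} (hs : s ∈ Set.Icc (0 : ℝ) 1) : (1 - s) • x + s • y ∈ hull u :=
  convex_hull u hx hy (by linarith [hs.2]) hs.1 (by ring)

include h3 in
theorem exists_mem (t : T) : ∃ i, i ∈ tri t := by
  have : (tri t).Nonempty := by rw [← Finset.card_pos, h3]; norm_num
  exact this

include h3 hinter in
theorem nonempty_homotopyEquiv_awayFromVertices [Finite T] [TopologicalSpace T]
    [DiscreteTopology T] : Nonempty (ContinuousMap.HomotopyEquiv (awayFromVertices tri) T) := by
  choose v hv using exists_mem h3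
  -- Weight `1 / 3` gives the barycentre, whichever vertex `v t` is chosen.
  have hw : ∀ t, weighted (tri t) (1 / 3) (v t) ∈ hull (tri t) := fun t =>
    weighted_mem_hull (h3 t) (hv t) (by norm_num) (by norm_num)
  have hc1 : ∀ t i, weighted (tri t) (1 / 3) (v t) i < 1 := fun t =>
    weighted_apply_lt (by norm_num) (by norm_num)
  let c : T → awayFromVertices tri := fun t =>
    ⟨⟨weighted (tri t) (1 / 3) (v t), (mem_space h3).2 ⟨t, hw t⟩⟩, hc1 t⟩
  refine nonempty_homotopyEquiv_of_segment isEmbedding_val (continuous_triangleOf h3 hinter)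
    (c := c) (fun t => triangleOf_eq h3 hinter (c t).2 (hw t)) fun z s hs => ?_
  have hm := segment_mem_hull (mem_hull_triangleOf h3 z.1) (hw (triangleOf h3 z.1)) hs
  refine ⟨⟨⟨_, (mem_space h3).2 ⟨_, hm⟩⟩, fun i => ?_⟩, rfl⟩
  exact convex_Iio (𝕜 := ℝ) (1 : ℝ) (z.2 i) (hc1 (triangleOf h3 z.1) i)
    (by linarith [hs.2]) hs.1 (by ring)

/-- The vertex near a point. -/
noncomputable def vertexOf (x : nearVertices tri) : Fin n := x.2.choose

theorem vertexOf_spec (x : nearVertices tri) : 1 / 2 < x.1.1 (vertexOf x) := x.2.choose_spec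

include h3 in
-- Two coordinates above `1 / 2` would have sum above 1.
theorem vertexOf_eq {x : nearVertices tri} {i : Fin n} (h : 1 / 2 < x.1.1 i) : vertexOf x = i := by
  by_contra hne
  have := add_le_one_of_mem_hull (mem_hull_triangleOf h3 x.1) hne
  linarith [vertexOf_spec x]

include h3 in
theorem continuous_vertexOf : Continuous fun x : nearVertices tri => vertexOf x := by
  refine continuous_discrete_rng.2 fun i => ?_
  have : (fun x : nearVertices tri => vertexOf x) ⁻¹' {i} = {x | 1 / 2 < x.1.1 i} := by
    ext x
    constructor
    · rintro rfl
      exact vertexOf_spec x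
    · exact fun h => vertexOf_eq h3 h
  rw [this]
  exact isOpen_lt continuous_const (by fun_prop)

theorem vertexOf_mem {x : nearVertices tri} {t : T} (h : x.1.1 ∈ hull (tri t)) :
    vertexOf x ∈ tri t := by
  by_contra hi
  have := h.2.2 _ hi
  linarith [vertexOf_spec x]

include h3 in
theorem nonempty_homotopyEquiv_nearVertices (hcov : ∀ i, ∃ t, i ∈ tri t) :
    Nonempty (ContinuousMap.HomotopyEquiv (nearVertices tri) (Fin n)) := by
  choose τ hτ using hcov
  have hhalf : ∀ i : Fin n, 1 / 2 < (basisVec i) i := fun i => by simp; norm_num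
  let c : Fin n → nearVertices tri := fun i =>
    ⟨⟨basisVec i, (mem_space h3).2 ⟨τ i, basisVec_mem_hull (hτ i)⟩⟩, i, hhalf i⟩
  refine nonempty_homotopyEquiv_of_segment isEmbedding_val (continuous_vertexOf h3)
    (c := c) (fun i => vertexOf_eq h3 (hhalf i)) fun z s hs => ?_
  have hz := mem_hull_triangleOf h3 z.1
  have hm := segment_mem_hull hz (basisVec_mem_hull (vertexOf_mem hz)) hs
  refine ⟨⟨⟨_, (mem_space h3).2 ⟨_, hm⟩⟩, vertexOf z, ?_⟩, rfl⟩
  exact convex_Ioi (𝕜 := ℝ) (1 / 2 : ℝ) (vertexOf_spec z) (hhalf (vertexOf z))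
    (by linarith [hs.2]) hs.1 (by ring)

include h3 hinter in
theorem nonempty_homotopyEquiv_inter [Finite T] [TopologicalSpace T] [DiscreteTopology T] :
    Nonempty (ContinuousMap.HomotopyEquiv ↥(awayFromVertices tri ∩ nearVertices tri)
      {q : T × Fin n // q.2 ∈ tri q.1}) := by
  -- Any weight strictly between `1 / 2` and `1` puts the centre in both open sets.
  have hw : ∀ q : {q : T × Fin n // q.2 ∈ tri q.1}, weighted (tri q.1.1) (2 / 3) q.1.2 ∈
      hull (tri q.1.1) := fun q => weighted_mem_hull (h3 _) q.2 (by norm_num) (by norm_num)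
  have hc1 : ∀ (q : {q : T × Fin n // q.2 ∈ tri q.1}) i, weighted (tri q.1.1) (2 / 3) q.1.2 i < 1 :=
    fun q => weighted_apply_lt (by norm_num) (by norm_num)
  have hc2 : ∀ q : {q : T × Fin n // q.2 ∈ tri q.1},
      1 / 2 < weighted (tri q.1.1) (2 / 3) q.1.2 q.1.2 := fun q => by
    simp [weighted]; norm_num
  let c : {q : T × Fin n // q.2 ∈ tri q.1} → ↥(awayFromVertices tri ∩ nearVertices tri) := fun q =>
    ⟨⟨_, (mem_space h3).2 ⟨_, hw q⟩⟩, hc1 q, _, hc2 q⟩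
  let p : ↥(awayFromVertices tri ∩ nearVertices tri) → {q : T × Fin n // q.2 ∈ tri q.1} := fun x =>
    ⟨(triangleOf h3 x.1, vertexOf ⟨x.1, x.2.2⟩),
      vertexOf_mem (x := ⟨x.1, x.2.2⟩) (mem_hull_triangleOf h3 x.1)⟩
  have hp : Continuous p := by
    refine Continuous.subtype_mk (Continuous.prodMk ?_ ?_) _
    · exact (continuous_triangleOf h3 hinter).comp
        (f := fun x : ↥(awayFromVertices tri ∩ nearVertices tri) =>
          (⟨x.1, x.2.1⟩ : awayFromVertices tri)) (by fun_prop)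
    · exact (continuous_vertexOf h3).comp
        (f := fun x : ↥(awayFromVertices tri ∩ nearVertices tri) =>
          (⟨x.1, x.2.2⟩ : nearVertices tri)) (by fun_prop)
  refine nonempty_homotopyEquiv_of_segment isEmbedding_val hp (c := c) (fun q => ?_)
    fun z s hs => ?_
  · refine Subtype.ext (Prod.ext ?_ ?_)
    · exact triangleOf_eq h3 hinter (c q).2.1 (hw q)
    · exact vertexOf_eq (x := ⟨(c q).1, (c q).2.2⟩) h3 (hc2 q)
  · have hm := segment_mem_hull (mem_hull_triangleOf h3 z.1) (hw (p z)) hs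
    refine ⟨⟨⟨_, (mem_space h3).2 ⟨_, hm⟩⟩, fun i => ?_, (p z).1.2, ?_⟩, rfl⟩
    · exact convex_Iio (𝕜 := ℝ) (1 : ℝ) (z.2.1 i) (hc1 (p z) i)
        (by linarith [hs.2]) hs.1 (by ring)
    · exact convex_Ioi (𝕜 := ℝ) (1 / 2 : ℝ) (vertexOf_spec ⟨z.1, z.2.2⟩) (hc2 (p z))
        (by linarith [hs.2]) hs.1 (by ring)

include h3 in
theorem card_incidences [Fintype T] [DecidableEq T] :
    Fintype.card {q : T × Fin n // q.2 ∈ tri q.1} = 3 * Fintype.card T := by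
  rw [Fintype.card_congr (Equiv.subtypeProdEquivSigmaSubtype fun t i => i ∈ tri t),
    Fintype.card_sigma]
  simp [h3, mul_comm]

/-- The homology of a complex of triangles meeting only at vertices. -/
theorem hasGraphHomology [Fintype T] (h3 : ∀ t, (tri t).card = 3)
    (hinter : ∀ t t', t ≠ t' → (tri t ∩ tri t').card ≤ 1) (hcov : ∀ i, ∃ t, i ∈ tri t) :
    SingularChains.HasGraphHomology (SphereConf.singularChains (complex tri).space)
      ((n : ℤ) - 2 * Fintype.card T) := by
  classical
  let _ : TopologicalSpace T := ⊥
  have _ : DiscreteTopology T := ⟨rfl⟩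
  obtain ⟨e₁⟩ := nonempty_homotopyEquiv_awayFromVertices h3 hinter
  obtain ⟨e₂⟩ := nonempty_homotopyEquiv_nearVertices h3 hcov
  obtain ⟨e₃⟩ := nonempty_homotopyEquiv_inter h3 hinter
  obtain ⟨e⟩ := nonempty_homotopyEquiv_sum e₁ e₂
  have h := SingularChains.hasGraphHomology_of_isOpen_cover isOpen_awayFromVertices
    isOpen_nearVertices awayFromVertices_union_nearVertices
    (SingularChains.hasDiscreteHomology_of_homotopyEquiv e₃)
    (SingularChains.hasDiscreteHomology_of_homotopyEquiv e)
  convert h using 1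
  rw [card_incidences h3, Fintype.card_sum, Fintype.card_fin]
  push_cast
  ring

end

end CoordinateComplex

end

/-! ### Five vectors at obtuse angles contain an antipodal pair -/

section

open SphereConf

namespace SphereConf

theorem inner_E3 (x y : E3) : inner ℝ x y = x 0 * y 0 + x 1 * y 1 + x 2 * y 2 := by
  rw [PiLp.inner_apply, Fin.sum_univ_three]
  simp [mul_comm]

/-- The triple product of three vectors. -/
def det3 (x y z : E3) : ℝ :=
  x 0 * (y 1 * z 2 - y 2 * z 1) - x 1 * (y 0 * z 2 - y 2 * z 0) + x 2 * (y 0 * z 1 - y 1 * z 0)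

/-- The product of the two determinants is the determinant of the matrix of inner products of `a, b,
c` with `a, b, d`, expanded along its first row. -/
theorem det3_mul_det3 (a b c d : E3) :
    det3 a b c * det3 a b d =
      inner ℝ a a * (inner ℝ b b * inner ℝ c d - inner ℝ b d * inner ℝ c b) -
      inner ℝ a b * (inner ℝ b a * inner ℝ c d - inner ℝ b d * inner ℝ c a) +
      inner ℝ a d * (inner ℝ b a * inner ℝ c b - inner ℝ b b * inner ℝ c a) := by
  simp only [inner_E3, det3]
  ring

theorem inner_self_S2 (u : S2) : inner ℝ (u : E3) (u : E3) = 1 := by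
  rw [real_inner_self_eq_norm_sq, norm_eq_of_mem_sphere]; norm_num

/-- Two unit vectors with inner product `-1` are antipodal. -/
theorem eq_neg_of_inner_eq {x y : E3} (hx : inner ℝ x x = 1) (hy : inner ℝ y y = 1)
    (h : inner ℝ x y = -1) : y = -x := by
  have : inner ℝ (x + y) (x + y) = 0 := by
    rw [real_inner_add_add_self, hx, hy, h]; norm_num
  rw [inner_self_eq_zero] at this
  exact eq_neg_of_add_eq_zero_right this

/-- Two planes cannot be orthogonal in three-space, so one of the pairs spans only a line. Computing
`(det(x,y,z) det(x,y,w))²` in two ways gives `(1 - t²)² (1 - g²) = 0`, and the sign conditions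
exclude coincidence. -/
theorem eq_neg_of_orthogonal {x y z w : E3} (hx : inner ℝ x x = 1) (hy : inner ℝ y y = 1)
    (hz : inner ℝ z z = 1) (hw : inner ℝ w w = 1) (hxy : inner ℝ x y ≤ 0)
    (hxz : inner ℝ x z = 0) (hxw : inner ℝ x w = 0) (hyz : inner ℝ y z = 0)
    (hyw : inner ℝ y w = 0) (hzw : inner ℝ z w ≤ 0) : y = -x ∨ w = -z := by
  have h1 := det3_mul_det3 x y z w
  have h2 := det3_mul_det3 x y z z
  have h3 := det3_mul_det3 x y w w
  rw [real_inner_comm x y, real_inner_comm x z, real_inner_comm y z] at *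
  rw [real_inner_comm x w, real_inner_comm y w] at h3
  simp only [hx, hy, hz, hw, hxz, hxw, hyz, hyw] at h1 h2 h3
  set t := inner ℝ x y
  set g := inner ℝ z w
  have key : (1 - t ^ 2) ^ 2 * (1 - g ^ 2) = 0 := by
    have : (det3 x y z * det3 x y w) ^ 2 =
      (det3 x y z * det3 x y z) * (det3 x y w * det3 x y w) := by ring
    rw [h1, h2, h3] at this
    linear_combination -this
  rcases mul_eq_zero.1 key with h | h
  · left
    apply eq_neg_of_inner_eq hx hy
    have h' : (1 - t) * (1 + t) = 0 := by
      have := pow_eq_zero_iff (two_ne_zero) |>.1 h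
      linear_combination this
    rcases mul_eq_zero.1 h' with h'' | h'' <;> linarith
  · right
    apply eq_neg_of_inner_eq hz hw
    have h' : (1 - g) * (1 + g) = 0 := by linear_combination h
    rcases mul_eq_zero.1 h' with h'' | h'' <;> linarith

/-- The conditions on a family of unit vectors at pairwise angles at least `π / 2`. -/
structure IsObtuse {ι : Type*} (u : ι → E3) : Prop where
  inner_self : ∀ i, inner ℝ (u i) (u i) = 1
  inner_le : ∀ i j, i ≠ j → inner ℝ (u i) (u j) ≤ 0

theorem IsObtuse.comp {ι κ : Type*} {u : ι → E3} (h : IsObtuse u) {f : κ → ι}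
    (hf : Function.Injective f) : IsObtuse (u ∘ f) :=
  ⟨fun _ => h.inner_self _, fun _ _ hij => h.inner_le _ _ (hf.ne hij)⟩

/-- Nonpositive inner products make all four terms of the Gram expansion nonpositive, so if their
sum is zero each of them is zero. -/
theorem IsObtuse.det3_mul_det3_terms {u : Fin 5 → E3} (h : IsObtuse u) {i j : Fin 5} (hij : i ≠ j)
    (hi3 : i ≠ 3) (hi4 : i ≠ 4) (hj3 : j ≠ 3) (hj4 : j ≠ 4) :
    det3 (u 4) (u 3) (u i) * det3 (u 4) (u 3) (u j) ≤ 0 ∧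
    (det3 (u 4) (u 3) (u i) * det3 (u 4) (u 3) (u j) = 0 →
      (1 - inner ℝ (u 4) (u 3) ^ 2) * inner ℝ (u i) (u j) = 0 ∧
      inner ℝ (u 3) (u i) * inner ℝ (u 3) (u j) = 0 ∧
      inner ℝ (u 4) (u i) * inner ℝ (u 4) (u j) = 0) := by
  have e := det3_mul_det3 (u 4) (u 3) (u i) (u j)
  rw [h.inner_self, h.inner_self, real_inner_comm (u 4) (u 3), real_inner_comm (u 3) (u i),
    real_inner_comm (u 4) (u i)] at e
  have hx := h.inner_le 4 3 (by decide)
  have hki := h.inner_le 3 i hi3.symm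
  have hkj := h.inner_le 3 j hj3.symm
  have hhi := h.inner_le 4 i hi4.symm
  have hhj := h.inner_le 4 j hj4.symm
  have hg := h.inner_le i j hij
  have hx1 : inner ℝ (u 4) (u 3) ^ 2 ≤ 1 := by
    have := real_inner_mul_inner_self_le (u 4) (u 3)
    rw [h.inner_self, h.inner_self] at this
    linarith
  set x := inner ℝ (u 4) (u 3)
  set ki := inner ℝ (u 3) (u i)
  set kj := inner ℝ (u 3) (u j)
  set hi := inner ℝ (u 4) (u i)
  set hj := inner ℝ (u 4) (u j)
  set g := inner ℝ (u i) (u j)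
  have t1 : (1 - x ^ 2) * g ≤ 0 := mul_nonpos_of_nonneg_of_nonpos (by linarith) hg
  have t2 : 0 ≤ ki * kj := mul_nonneg_of_nonpos_of_nonpos hki hkj
  have t3 : 0 ≤ hi * hj := mul_nonneg_of_nonpos_of_nonpos hhi hhj
  have t4 : x * (kj * hi + hj * ki) ≤ 0 := mul_nonpos_of_nonpos_of_nonneg hx
    (add_nonneg (mul_nonneg_of_nonpos_of_nonpos hkj hhi) (mul_nonneg_of_nonpos_of_nonpos hhj hki))
  have e' : det3 (u 4) (u 3) (u i) * det3 (u 4) (u 3) (u j) =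
      (1 - x ^ 2) * g - ki * kj - hi * hj + x * (kj * hi + hj * ki) := by rw [e]; ring
  refine ⟨by linarith, fun h0 => ⟨by linarith, by linarith, by linarith⟩⟩

/-- Unless `u 3` and `u 4` are antipodal, the equality case makes `u 0` orthogonal to `u 1` and `u
2`. Lying in the plane of `u 3` and `u 4`, it is not orthogonal to both. The one to which it is not
orthogonal is itself orthogonal to `u 1` and `u 2`, which gives two mutually orthogonal pairs. -/
theorem IsObtuse.exists_eq_neg_of_det3_eq_zero {u : Fin 5 → E3} (h : IsObtuse u)
    (h0 : det3 (u 4) (u 3) (u 0) = 0) : ∃ i j, i ≠ j ∧ u j = -u i := by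
  obtain ⟨-, h1⟩ := h.det3_mul_det3_terms (i := 0) (j := 1) (by decide) (by decide) (by decide)
    (by decide) (by decide)
  obtain ⟨-, h2⟩ := h.det3_mul_det3_terms (i := 0) (j := 2) (by decide) (by decide) (by decide)
    (by decide) (by decide)
  obtain ⟨a1, b1, c1⟩ := h1 (by rw [h0, zero_mul])
  obtain ⟨a2, b2, c2⟩ := h2 (by rw [h0, zero_mul])
  have hx := h.inner_le 4 3 (by decide)
  by_cases hx1 : inner ℝ (u 4) (u 3) = -1
  · exact ⟨4, 3, by decide, eq_neg_of_inner_eq (h.inner_self _) (h.inner_self _) hx1⟩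
  have hne : (1 - inner ℝ (u 4) (u 3) ^ 2) ≠ 0 := by
    intro h'
    have : (1 - inner ℝ (u 4) (u 3)) * (1 + inner ℝ (u 4) (u 3)) = 0 := by linear_combination h'
    rcases mul_eq_zero.1 this with h'' | h''
    · linarith
    · exact hx1 (by linarith)
  have g1 := (mul_eq_zero.1 a1).resolve_left hne
  have g2 := (mul_eq_zero.1 a2).resolve_left hne
  have key : ∀ i : Fin 5, i ≠ 0 → i ≠ 1 → i ≠ 2 → inner ℝ (u i) (u 1) = 0 →
      inner ℝ (u i) (u 2) = 0 → ∃ i j, i ≠ j ∧ u j = -u i := by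
    intro i hi0 hi1 hi2 e1 e2
    rcases eq_neg_of_orthogonal (h.inner_self 0) (h.inner_self i) (h.inner_self 1)
      (h.inner_self 2) (h.inner_le 0 i hi0.symm) g1 g2 e1 e2 (h.inner_le 1 2 (by decide))
      with h' | h'
    · exact ⟨0, i, hi0.symm, h'⟩
    · exact ⟨1, 2, by decide, h'⟩
  by_cases k0 : inner ℝ (u 3) (u 0) = 0
  · by_cases h40 : inner ℝ (u 4) (u 0) = 0
    · exfalso
      have e := det3_mul_det3 (u 4) (u 3) (u 0) (u 0)
      rw [h0, h.inner_self, h.inner_self, h.inner_self, real_inner_comm (u 4) (u 3),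
        real_inner_comm (u 3) (u 0), k0, h40] at e
      apply hne
      linear_combination -e
    · exact key 4 (by decide) (by decide) (by decide) ((mul_eq_zero.1 c1).resolve_left h40)
        ((mul_eq_zero.1 c2).resolve_left h40)
  · exact key 3 (by decide) (by decide) (by decide) ((mul_eq_zero.1 b1).resolve_left k0)
        ((mul_eq_zero.1 b2).resolve_left k0)

/-- Five unit vectors of three-space at pairwise angles at least `π / 2` contain an antipodal
pair. -/
theorem IsObtuse.exists_eq_neg {u : Fin 5 → E3} (h : IsObtuse u) :
    ∃ i j, i ≠ j ∧ u j = -u i := by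
  have z01 := (h.det3_mul_det3_terms (i := 0) (j := 1) (by decide) (by decide) (by decide)
    (by decide) (by decide)).1
  have z02 := (h.det3_mul_det3_terms (i := 0) (j := 2) (by decide) (by decide) (by decide)
    (by decide) (by decide)).1
  have z12 := (h.det3_mul_det3_terms (i := 1) (j := 2) (by decide) (by decide) (by decide)
    (by decide) (by decide)).1
  have key : det3 (u 4) (u 3) (u 0) = 0 ∨ det3 (u 4) (u 3) (u 1) = 0 ∨
      det3 (u 4) (u 3) (u 2) = 0 := by
    by_contra hcon
    push Not at hcon
    obtain ⟨n0, n1, n2⟩ := hcon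
    have p1 := lt_of_le_of_ne z01 (mul_ne_zero n0 n1)
    have p2 := lt_of_le_of_ne z02 (mul_ne_zero n0 n2)
    have p3 := lt_of_le_of_ne z12 (mul_ne_zero n1 n2)
    have := mul_pos_of_neg_of_neg p1 p2
    have h' : 0 < (det3 (u 4) (u 3) (u 0)) ^ 2 := by positivity
    nlinarith [mul_neg_of_pos_of_neg h' p3]
  have swap : ∀ k : Fin 5, k ≠ 3 → k ≠ 4 → det3 (u 4) (u 3) (u k) = 0 →
      ∃ i j, i ≠ j ∧ u j = -u i := by
    intro k h3 h4 hk
    have h' := h.comp (Equiv.swap 0 k).injective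
    obtain ⟨i, j, hij, e⟩ := h'.exists_eq_neg_of_det3_eq_zero (by
      simp only [Function.comp]
      rw [Equiv.swap_apply_of_ne_of_ne (by decide) h4.symm,
        Equiv.swap_apply_of_ne_of_ne (by decide) h3.symm, Equiv.swap_apply_left]
      exact hk)
    exact ⟨_, _, (Equiv.swap 0 k).injective.ne hij, e⟩
  rcases key with h0 | h0 | h0
  · exact swap 0 (by decide) (by decide) h0
  · exact swap 1 (by decide) (by decide) h0
  · exact swap 2 (by decide) (by decide) h0

/-- The inner product with `u k` is nonpositive for both of two opposite vectors. -/
theorem IsObtuse.inner_eq_zero_of_eq_neg {ι : Type*} {u : ι → E3} (h : IsObtuse u) {i j k : ι}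
    (hij : u j = -u i) (hki : k ≠ i) (hkj : k ≠ j) : inner ℝ (u i) (u k) = 0 := by
  have h1 := h.inner_le i k hki.symm
  have h2 := h.inner_le j k hkj.symm
  rw [hij, inner_neg_left] at h2
  linarith

end SphereConf

end

/-! ### Frames, the free pair normal form and the maximal radius -/

section

open SphereConf

namespace SphereConf

/-- The vectors `x`, `y`, `z` form a positively oriented orthonormal frame. -/
structure IsFrame (x y z : E3) : Prop where
  xx : inner ℝ x x = 1
  yy : inner ℝ y y = 1
  zz : inner ℝ z z = 1
  xy : inner ℝ x y = 0
  xz : inner ℝ x z = 0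
  yz : inner ℝ y z = 0
  det : det3 x y z = 1

/-- The cross product of two vectors. -/
noncomputable def cross (x y : E3) : E3 :=
  !₂[x 1 * y 2 - x 2 * y 1, x 2 * y 0 - x 0 * y 2, x 0 * y 1 - x 1 * y 0]

theorem isFrame_cross {x z : E3} (hx : inner ℝ x x = 1) (hz : inner ℝ z z = 1)
    (hxz : inner ℝ x z = 0) : IsFrame x (cross z x) z := by
  rw [inner_E3] at hx hz hxz
  constructor <;> simp only [inner_E3, det3, cross, PiLp.toLp_apply, Matrix.cons_val]
  · exact hx
  · linear_combination hx * (z 0 * z 0 + z 1 * z 1 + z 2 * z 2) + hz -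
      hxz * (x 0 * z 0 + x 1 * z 1 + x 2 * z 2)
  · exact hz
  · ring
  · exact hxz
  · ring
  · linear_combination hx * (z 0 * z 0 + z 1 * z 1 + z 2 * z 2) + hz -
      hxz * (x 0 * z 0 + x 1 * z 1 + x 2 * z 2)

/-- An orthonormal frame, of either orientation, as a basis. -/
theorem exists_orthonormalBasis {x y z : E3} (xx : inner ℝ x x = 1) (yy : inner ℝ y y = 1)
    (zz : inner ℝ z z = 1) (xy : inner ℝ x y = 0) (xz : inner ℝ x z = 0) (yz : inner ℝ y z = 0) :
    ∃ e : OrthonormalBasis (Fin 3) ℝ E3, e 0 = x ∧ e 1 = y ∧ e 2 = z := by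
  have ho : Orthonormal ℝ ![x, y, z] := by
    rw [orthonormal_iff_ite]
    have yx := (real_inner_comm x y).trans xy
    have zx := (real_inner_comm x z).trans xz
    have zy := (real_inner_comm y z).trans yz
    intro i j
    fin_cases i <;> fin_cases j <;> first | exact xx | exact yy | exact zz | simpa
  have hs : ⊤ ≤ Submodule.span ℝ (Set.range ![x, y, z]) := by
    rw [ho.linearIndependent.span_eq_top_of_card_eq_finrank' (by simp)]
  exact ⟨OrthonormalBasis.mk ho hs, by simp, by simp, by simp⟩

theorem IsFrame.exists_orthonormalBasis {x y z : E3} (h : IsFrame x y z) :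
    ∃ e : OrthonormalBasis (Fin 3) ℝ E3, e 0 = x ∧ e 1 = y ∧ e 2 = z :=
  SphereConf.exists_orthonormalBasis h.xx h.yy h.zz h.xy h.xz h.yz

theorem IsFrame.eq_sum {x y z : E3} (h : IsFrame x y z) (v : E3) :
    v = inner ℝ x v • x + inner ℝ y v • y + inner ℝ z v • z := by
  obtain ⟨e, rfl, rfl, rfl⟩ := h.exists_orthonormalBasis
  conv_lhs => rw [← e.sum_repr' v, Fin.sum_univ_three]

theorem inner_orthonormalBasis (e : OrthonormalBasis (Fin 3) ℝ E3) (i j : Fin 3) :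
    inner ℝ (e i) (e j) = if i = j then 1 else 0 :=
  orthonormal_iff_ite.1 e.orthonormal i j

/-- An orthonormal basis is a positively oriented frame, possibly after reversing its first
vector. -/
theorem isFrame_or_isFrame_neg (e : OrthonormalBasis (Fin 3) ℝ E3) :
    IsFrame (e 0) (e 1) (e 2) ∨ IsFrame (-e 0) (e 1) (e 2) := by
  have hd : det3 (e 0) (e 1) (e 2) * det3 (e 0) (e 1) (e 2) = 1 := by
    rw [det3_mul_det3]
    simp
  have hd' : det3 (-e 0) (e 1) (e 2) = -det3 (e 0) (e 1) (e 2) := by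
    simp only [det3, PiLp.neg_apply]; ring
  rcases mul_self_eq_one_iff.1 hd with h | h
  · left
    constructor <;> simp [h]
  · right
    constructor <;> simp [h, hd']

/-- The five points of a free pair configuration, for arbitrary vectors in place of a frame. -/
noncomputable def freePt (x y z : E3) (a b : ℝ) : Fin 5 → E3 :=
  ![x, -x, z, Real.cos a • y - Real.sin a • z, -(Real.cos b • y) - Real.sin b • z]

theorem freePairPoint_eq (e : OrthonormalBasis (Fin 3) ℝ E3) (a b : ℝ) :
    freePairPoint e a b = freePt (e 0) (e 1) (e 2) a b := rfl

/-- The parameters of a free pair. -/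
structure IsParam (a b : ℝ) : Prop where
  left : 0 ≤ a
  right : 0 ≤ b
  add : a + b ≤ Real.pi / 2

theorem freePt_isObtuse {x y z : E3} (xx : inner ℝ x x = 1) (yy : inner ℝ y y = 1)
    (zz : inner ℝ z z = 1) (xy : inner ℝ x y = 0) (xz : inner ℝ x z = 0) (yz : inner ℝ y z = 0)
    {a b : ℝ} (hab : IsParam a b) : IsObtuse (freePt x y z a b) := by
  have yx := (real_inner_comm x y).trans xy
  have zx := (real_inner_comm x z).trans xz
  have zy := (real_inner_comm y z).trans yz
  obtain ⟨ha, hb, hab⟩ := hab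
  have hpi := Real.pi_pos
  have sa := Real.sin_nonneg_of_nonneg_of_le_pi ha (by linarith)
  have sb := Real.sin_nonneg_of_nonneg_of_le_pi hb (by linarith)
  have cab : 0 ≤ Real.cos (a + b) := Real.cos_nonneg_of_mem_Icc ⟨by linarith, hab⟩
  rw [Real.cos_add] at cab
  have ea := Real.sin_sq_add_cos_sq a
  have eb := Real.sin_sq_add_cos_sq b
  have nx : inner ℝ (-x) (-x) = 1 := by rw [inner_neg_neg, xx]
  constructor
  · intro i
    fin_cases i
    · exact xx
    · exact nx
    · exact zz
    all_goals
      simp [-inner_self_eq_norm_sq_to_K, freePt, inner_sub_left, inner_sub_right, inner_smul_left,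
        inner_smul_right, yy, zz, yz, zy]
      linarith
  · intro i j hij
    fin_cases i <;> fin_cases j <;> first | exact absurd rfl hij | skip
    all_goals
      simp [-inner_self_eq_norm_sq_to_K, freePt, inner_sub_left, inner_sub_right, inner_smul_left,
        inner_smul_right, xx, yy, zz, xy, xz, yz, yx, zx, zy]
      try linarith

/-- Disjointness means that the centres are at distance at least `2r`; squaring gives this. The
right side vanishes at `r = 1 + √2`. -/
theorem mem_confRadius_iff {N : ℕ} {r : ℝ} (hr : 0 < r) {U : Fin N → S2} :
    U ∈ confRadius N r ↔
      ∀ i j, i < j → (1 + r) ^ 2 * inner ℝ (U i : E3) (U j : E3) ≤ 2 - (r - 1) ^ 2 := by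
  refine forall_congr' fun i => forall_congr' fun j => forall_congr' fun _ => ?_
  rw [disjoint_ball_ball_iff hr hr, ← abs_of_pos (by linarith : 0 < r + r),
    ← abs_of_nonneg (dist_nonneg (x := (1 + r) • (U i : E3)) (y := (1 + r) • (U j : E3))),
    ← sq_le_sq, dist_eq_norm, ← smul_sub, norm_smul, mul_pow,
    ← real_inner_self_eq_norm_sq (_ - _),
    real_inner_sub_sub_self, inner_self_S2, inner_self_S2, Real.norm_eq_abs, sq_abs]
  constructor <;> intro h <;> linarith

theorem mem_confAngle_iff {N : ℕ} {U : Fin N → S2} :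
    U ∈ confAngle N (Real.pi / 2) ↔ ∀ i j, i < j → inner ℝ (U i : E3) (U j : E3) ≤ 0 := by
  refine forall_congr' fun i => forall_congr' fun j => forall_congr' fun _ => ?_
  rw [InnerProductGeometry.angle, norm_eq_of_mem_sphere, norm_eq_of_mem_sphere, mul_one, div_one,
    ← not_lt, Real.arccos_lt_pi_div_two, not_lt]

theorem mem_confAngle_iff_isObtuse {N : ℕ} {U : Fin N → S2} :
    U ∈ confAngle N (Real.pi / 2) ↔ IsObtuse fun i => (U i : E3) := by
  rw [mem_confAngle_iff]
  refine ⟨fun h => ⟨fun i => inner_self_S2 _, fun i j hij => ?_⟩,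
    fun h i j hij => h.inner_le i j hij.ne⟩
  rcases lt_or_gt_of_ne hij with h' | h'
  · exact h i j h'
  · rw [real_inner_comm]; exact h j i h'

theorem exists_perm_apply_eq {i j : Fin 5} (hij : i ≠ j) :
    ∃ p : Equiv.Perm (Fin 5), p 0 = i ∧ p 1 = j := by
  refine ⟨Equiv.swap 0 i * Equiv.swap 1 (Equiv.swap 0 i j), ?_, ?_⟩
  · rw [Equiv.Perm.mul_apply, Equiv.swap_apply_of_ne_of_ne Fin.zero_ne_one,
      Equiv.swap_apply_left]
    intro h
    have := congrArg (Equiv.swap 0 i) h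
    rw [Equiv.swap_apply_left, Equiv.swap_apply_self] at this
    exact hij this
  · simp

/-- The three vectors orthogonal to an antipodal pair, in a frame of which they span a plane. -/
theorem IsObtuse.exists_isFrame {u : Fin 5 → E3} (h : IsObtuse u) (hu : u 1 = -u 0) :
    ∃ (y : E3) (w w' t t' : ℝ), IsFrame (u 0) y (u 2) ∧
      u 3 = w • y + t • u 2 ∧ u 4 = w' • y + t' • u 2 ∧ w ^ 2 + t ^ 2 = 1 ∧ w' ^ 2 + t' ^ 2 = 1 ∧
      t ≤ 0 ∧ t' ≤ 0 ∧ w * w' + t * t' ≤ 0 := by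
  have hf := isFrame_cross (h.inner_self 0) (h.inner_self 2)
    (h.inner_eq_zero_of_eq_neg (k := 2) hu (by decide) (by decide))
  have e3 := hf.eq_sum (u 3)
  have e4 := hf.eq_sum (u 4)
  rw [h.inner_eq_zero_of_eq_neg (k := 3) hu (by decide) (by decide), zero_smul, zero_add] at e3
  rw [h.inner_eq_zero_of_eq_neg (k := 4) hu (by decide) (by decide), zero_smul, zero_add] at e4
  have n3 := h.inner_self 3
  have n4 := h.inner_self 4
  have s34 := h.inner_le 3 4 (by decide)
  have zy := (real_inner_comm (u 2) (cross (u 2) (u 0))).symm.trans hf.yz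
  refine ⟨cross (u 2) (u 0), _, _, _, _, hf, e3, e4, ?_, ?_, h.inner_le 2 3 (by decide),
    h.inner_le 2 4 (by decide), ?_⟩
  all_goals
    generalize inner ℝ (cross (u 2) (u 0)) (u 3) = w at *
    generalize inner ℝ (u 2) (u 3) = t at *
    generalize inner ℝ (cross (u 2) (u 0)) (u 4) = w' at *
    generalize inner ℝ (u 2) (u 4) = t' at *
    rw [e3] at n3 s34
    rw [e4] at n4 s34
    simp only [inner_add_left, inner_add_right, inner_smul_left, inner_smul_right, hf.yy, hf.zz,
      hf.yz, zy, conj_trivial] at n3 n4 s34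
    linarith

/-- With the angles taken as arcsines, `cos (a + b) = -(w * w' + t * t') ≥ 0`, which forces `a + b ≤
π / 2`. -/
theorem exists_isParam {w w' t t' : ℝ} (h : w ^ 2 + t ^ 2 = 1) (h' : w' ^ 2 + t' ^ 2 = 1)
    (ht : t ≤ 0) (ht' : t' ≤ 0) (hle : w * w' + t * t' ≤ 0) (hw : 0 ≤ w) (hw' : w' ≤ 0) :
    ∃ a b, IsParam a b ∧ Real.cos a = w ∧ Real.sin a = -t ∧ Real.cos b = -w' ∧
      Real.sin b = -t' := by
  have c3 : Real.cos (Real.arcsin (-t)) = w := by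
    rw [Real.cos_arcsin, show 1 - (-t) ^ 2 = w ^ 2 by linear_combination -h, Real.sqrt_sq hw]
  have c4 : Real.cos (Real.arcsin (-t')) = -w' := by
    rw [Real.cos_arcsin, show 1 - (-t') ^ 2 = (-w') ^ 2 by linear_combination -h',
      Real.sqrt_sq (by linarith)]
  have d3 : Real.sin (Real.arcsin (-t)) = -t := Real.sin_arcsin (by linarith) (by nlinarith)
  have d4 : Real.sin (Real.arcsin (-t')) = -t' := Real.sin_arcsin (by linarith) (by nlinarith)
  refine ⟨_, _, ⟨Real.arcsin_nonneg.2 (by linarith), Real.arcsin_nonneg.2 (by linarith), ?_⟩,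
    c3, d3, c4, d4⟩
  by_contra hcon
  push Not at hcon
  have := Real.cos_neg_of_pi_div_two_lt_of_lt hcon (by
    linarith [Real.arcsin_le_pi_div_two (-t), Real.arcsin_le_pi_div_two (-t'), Real.pi_pos])
  rw [Real.cos_add, c3, c4, d3, d4] at this
  linarith

/-- Five vectors at pairwise angles at least `π / 2` form a free pair configuration. -/
theorem IsObtuse.exists_freePt {u : Fin 5 → E3} (h : IsObtuse u) :
    ∃ (p : Equiv.Perm (Fin 5)) (x y z : E3) (a b : ℝ), IsFrame x y z ∧ IsParam a b ∧
      ∀ i, u (p i) = freePt x y z a b i := by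
  obtain ⟨i, j, hij, hu⟩ := h.exists_eq_neg
  obtain ⟨p, rfl, rfl⟩ := exists_perm_apply_eq hij
  obtain ⟨y, w, w', t, t', hf, e3, e4, h3, h4, ht, ht', hle⟩ :=
    (h.comp p.injective).exists_isFrame hu
  have hw : w * w' ≤ 0 := by nlinarith [mul_nonneg_of_nonpos_of_nonpos ht ht']
  -- The two free points lie on opposite sides of the axis through `u 2`; if they come in the wrong
  -- order, labels 3 and 4 are exchanged.
  rcases mul_nonpos_iff.1 hw with ⟨hw, hw'⟩ | ⟨hw, hw'⟩
  · obtain ⟨a, b, hab, ca, sa, cb, sb⟩ := exists_isParam h3 h4 ht ht' hle hw hw'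
    refine ⟨p, _, _, _, a, b, hf, hab, fun i => ?_⟩
    fin_cases i
    · rfl
    · exact hu
    · rfl
    · simpa [freePt, ca, sa] using e3
    · simpa [freePt, cb, sb] using e4
  · obtain ⟨a, b, hab, ca, sa, cb, sb⟩ := exists_isParam h4 h3 ht' ht (by linarith) hw' hw
    refine ⟨p * Equiv.swap 3 4, _, _, _, a, b, hf, hab, fun i => ?_⟩
    fin_cases i
    · rfl
    · exact hu
    · rfl
    · simpa [freePt, ca, sa] using e4
    · simpa [freePt, cb, sb] using e3

theorem sqrt_two_facts : Real.sqrt 2 ^ 2 = 2 ∧ 0 < Real.sqrt 2 :=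
  ⟨Real.sq_sqrt (by norm_num), by positivity⟩

theorem confAngle_subset_confRadius {N : ℕ} {r : ℝ} (h0 : 0 < r) (hr : r ≤ 1 + Real.sqrt 2) :
    confAngle N (Real.pi / 2) ⊆ confRadius N r := by
  intro U hU
  rw [mem_confAngle_iff] at hU
  rw [mem_confRadius_iff h0]
  intro i j hij
  have := mul_nonneg (sq_nonneg (1 + r)) (neg_nonneg.2 (hU i j hij))
  obtain ⟨h2, h2'⟩ := sqrt_two_facts
  have : (r - 1) ^ 2 ≤ 2 := by
    have h1 : 1 < Real.sqrt 2 := by nlinarith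
    rw [← h2, sq_le_sq, abs_of_pos h2', abs_le]
    constructor <;> linarith
  linarith

theorem confRadius_eq_confAngle (N : ℕ) :
    confRadius N (1 + Real.sqrt 2) = confAngle N (Real.pi / 2) := by
  obtain ⟨h2, h2'⟩ := sqrt_two_facts
  refine (confAngle_subset_confRadius (by linarith) le_rfl).antisymm' fun U hU => ?_
  rw [mem_confAngle_iff]
  rw [mem_confRadius_iff (by linarith)] at hU
  intro i j hij
  have := hU i j hij
  rw [show 2 - (1 + Real.sqrt 2 - 1) ^ 2 = 0 by linear_combination -h2] at this
  exact nonpos_of_mul_nonpos_right this (by positivity)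

/-- Past this radius all inner products are strictly negative, yet five such points contain an
antipodal pair, to which any third point is orthogonal. -/
theorem confRadius_five_eq_empty {r : ℝ} (hr : 1 + Real.sqrt 2 < r) : confRadius 5 r = ∅ := by
  obtain ⟨h2, h2'⟩ := sqrt_two_facts
  rw [Set.eq_empty_iff_forall_notMem]
  intro U hU
  rw [mem_confRadius_iff (by linarith)] at hU
  have hlt : ∀ i j, i < j → inner ℝ (U i : E3) (U j : E3) < 0 := by
    intro i j hij
    have h := hU i j hij
    by_contra hcon
    have : 0 ≤ (1 + r) ^ 2 * inner ℝ (U i : E3) (U j : E3) :=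
      mul_nonneg (sq_nonneg _) (not_lt.1 hcon)
    nlinarith
  have hlt' : ∀ i j, i ≠ j → inner ℝ (U i : E3) (U j : E3) < 0 := by
    intro i j hij
    rcases lt_or_gt_of_ne hij with h' | h'
    · exact hlt i j h'
    · rw [real_inner_comm]; exact hlt j i h'
  have ho : IsObtuse fun i => (U i : E3) := ⟨fun i => inner_self_S2 _, fun i j hij =>
    (hlt' i j hij).le⟩
  obtain ⟨i, j, hij, e⟩ := ho.exists_eq_neg
  obtain ⟨k, hi, hj⟩ : ∃ k : Fin 5, k ≠ i ∧ k ≠ j :=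
    (by decide : ∀ i j : Fin 5, ∃ k, k ≠ i ∧ k ≠ j) i j
  exact (hlt' i k hi.symm).ne (ho.inner_eq_zero_of_eq_neg e hi hj)

/-- The configuration `U` with the given unit vectors. -/
def toConf {N : ℕ} {u : Fin N → E3} (h : IsObtuse u) : confAngle N (Real.pi / 2) :=
  ⟨fun i => ⟨u i, by
    rw [mem_sphere_zero_iff_norm, ← sq_eq_sq₀ (norm_nonneg _) zero_le_one,
      ← real_inner_self_eq_norm_sq, h.inner_self, one_pow]⟩, mem_confAngle_iff_isObtuse.2 h⟩

theorem IsFrame.isObtuse {x y z : E3} (h : IsFrame x y z) {a b : ℝ} (hab : IsParam a b) :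
    IsObtuse (freePt x y z a b) :=
  freePt_isObtuse h.xx h.yy h.zz h.xy h.xz h.yz hab

theorem isObtuse_freePairPoint (e : OrthonormalBasis (Fin 3) ℝ E3) {a b : ℝ} (hab : IsParam a b) :
    IsObtuse (freePairPoint e a b) := by
  apply freePt_isObtuse (hab := hab) <;> simp

theorem isParam_zero : IsParam 0 0 := ⟨le_rfl, le_rfl, by linarith [Real.pi_pos]⟩

theorem isGreatest_admissibleRadii : IsGreatest (admissibleRadii 5) (1 + Real.sqrt 2) := by
  refine ⟨⟨by positivity, ?_⟩, fun r hr => ?_⟩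
  · rw [confRadius_eq_confAngle]
    exact ⟨_, (toConf (isObtuse_freePairPoint (EuclideanSpace.basisFun _ _) isParam_zero)).2⟩
  · by_contra hcon
    have := hr.2
    rw [confRadius_five_eq_empty (not_le.1 hcon)] at this
    exact this.ne_empty rfl

theorem rMax_five : rMax 5 = 1 + Real.sqrt 2 := isGreatest_admissibleRadii.csSup_eq

theorem mem_confAngle_iff_exists_isFreePairConfig (U : Fin 5 → S2) :
    U ∈ confAngle 5 (Real.pi / 2) ↔ ∃ e σ, IsFreePairConfig e σ U := by
  constructor
  · intro hU
    obtain ⟨p, x, y, z, a, b, hf, hab, h⟩ := (mem_confAngle_iff_isObtuse.1 hU).exists_freePt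
    obtain ⟨e, rfl, rfl, rfl⟩ := hf.exists_orthonormalBasis
    refine ⟨e, p⁻¹, a, b, hab.left, hab.right, hab.add, fun i => ?_⟩
    simpa [freePairPoint_eq] using h (p⁻¹ i)
  · rintro ⟨e, σ, a, b, ha, hb, hab, h⟩
    rw [mem_confAngle_iff_isObtuse]
    have := (isObtuse_freePairPoint e ⟨ha, hb, hab⟩).comp σ.injective
    convert this using 2 with i
    exact h i

end SphereConf

end

/-! ### Rotation classes of labelled configurations and their symmetries -/

section

open SphereConf

namespace SphereConf

theorem toEuclideanLin_apply_coord (A : Matrix (Fin 3) (Fin 3) ℝ) (v : E3) (i : Fin 3) :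
    Matrix.toEuclideanLin A v i = A i 0 * v 0 + A i 1 * v 1 + A i 2 * v 2 := by
  simp [Matrix.toLpLin_apply, Matrix.mulVec, dotProduct, Fin.sum_univ_three]

theorem det3_toEuclideanLin {A : Matrix (Fin 3) (Fin 3) ℝ}
    (hA : A ∈ Matrix.specialOrthogonalGroup (Fin 3) ℝ) (x y z : E3) :
    det3 (Matrix.toEuclideanLin A x) (Matrix.toEuclideanLin A y) (Matrix.toEuclideanLin A z) =
      det3 x y z := by
  have hd := (Matrix.mem_specialOrthogonalGroup_iff.1 hA).2
  rw [Matrix.det_fin_three] at hd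
  simp only [det3, toEuclideanLin_apply_coord]
  linear_combination (x 0 * (y 1 * z 2 - y 2 * z 1) - x 1 * (y 0 * z 2 - y 2 * z 0) +
    x 2 * (y 0 * z 1 - y 1 * z 0)) * hd

theorem inner_toEuclideanLin {A : Matrix (Fin 3) (Fin 3) ℝ}
    (hA : A ∈ Matrix.specialOrthogonalGroup (Fin 3) ℝ) (x y : E3) :
    inner ℝ (Matrix.toEuclideanLin A x) (Matrix.toEuclideanLin A y) = inner ℝ x y := by
  have hA' : star A * A = 1 := ((Matrix.mem_specialOrthogonalGroup_iff.1 hA).1).1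
  have h : ∀ i j, A 0 i * A 0 j + A 1 i * A 1 j + A 2 i * A 2 j = (1 : Matrix _ _ ℝ) i j := by
    intro i j
    rw [← hA', Matrix.mul_apply, Fin.sum_univ_three]
    simp [Matrix.star_apply]
  have h00 := h 0 0
  have h01 := h 0 1
  have h02 := h 0 2
  have h11 := h 1 1
  have h12 := h 1 2
  have h22 := h 2 2
  simp only [Matrix.one_apply, Fin.isValue, if_true, Fin.reduceEq, if_false] at h00 h01 h02 h11 h12 h22
  simp only [inner_E3, toEuclideanLin_apply_coord]
  linear_combination (x 0 * y 0) * h00 + (x 0 * y 1 + x 1 * y 0) * h01 +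
    (x 0 * y 2 + x 2 * y 0) * h02 + (x 1 * y 1) * h11 + (x 1 * y 2 + x 2 * y 1) * h12 +
    (x 2 * y 2) * h22

/-- The standard frame. -/
noncomputable def stdVec (i : Fin 3) : E3 := EuclideanSpace.single i 1

theorem isFrame_stdVec : IsFrame (stdVec 0) (stdVec 1) (stdVec 2) := by
  constructor <;> simp [inner_E3, det3, stdVec]

/-- A rotation carries the standard frame to a given one. -/
theorem IsFrame.exists_rotation {x y z : E3} (h : IsFrame x y z) :
    ∃ A ∈ Matrix.specialOrthogonalGroup (Fin 3) ℝ, Matrix.toEuclideanLin A (stdVec 0) = x ∧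
      Matrix.toEuclideanLin A (stdVec 1) = y ∧ Matrix.toEuclideanLin A (stdVec 2) = z := by
  refine ⟨!![x 0, y 0, z 0; x 1, y 1, z 1; x 2, y 2, z 2], ?_, ?_, ?_, ?_⟩
  · rw [Matrix.mem_specialOrthogonalGroup_iff, Matrix.mem_orthogonalGroup_iff']
    have xx := h.xx
    have yy := h.yy
    have zz := h.zz
    have xy := h.xy
    have xz := h.xz
    have yz := h.yz
    rw [inner_E3] at xx yy zz xy xz yz
    constructor
    · ext i j
      rw [Matrix.mul_apply, Fin.sum_univ_three]
      fin_cases i <;> fin_cases j <;> simp <;> linarith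
    · have := h.det
      rw [Matrix.det_fin_three]
      simp only [det3] at this
      simp
      linear_combination this
  all_goals
    ext i
    rw [toEuclideanLin_apply_coord]
    fin_cases i <;> simp [stdVec]

theorem freePt_map (L : E3 →ₗ[ℝ] E3) (x y z : E3) (a b : ℝ) (i : Fin 5) :
    L (freePt x y z a b i) = freePt (L x) (L y) (L z) a b i := by
  fin_cases i <;> simp [freePt]

/-- The reduced space of five points at angular distance at least `π / 2`. -/
abbrev X5 : Type := BConfAngle 5 (Real.pi / 2)

/-- The class of a configuration. -/
def toClass {u : Fin 5 → E3} (h : IsObtuse u) : X5 := Quotient.mk _ (toConf h)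

/-- The class of the free pair configuration whose label at the `i`th position is `p i`. -/
noncomputable def cls (p : Equiv.Perm (Fin 5)) {a b : ℝ} (hab : IsParam a b) : X5 :=
  toClass ((isFrame_stdVec.isObtuse hab).comp p⁻¹.injective)

theorem mk_eq_cls {p : Equiv.Perm (Fin 5)} {a b : ℝ} (hab : IsParam a b)
    {U : confAngle 5 (Real.pi / 2)} {x y z : E3} (hf : IsFrame x y z)
    (h : ∀ i, (U.1 (p i) : E3) = freePt x y z a b i) :
    (Quotient.mk (rotationSetoid _) U : X5) = cls p hab := by
  obtain ⟨A, hA, rfl, rfl, rfl⟩ := hf.exists_rotation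
  symm
  refine Quotient.sound ⟨A, hA, fun i => ?_⟩
  have := h (p⁻¹ i)
  rw [← freePt_map, show p (p⁻¹ i) = i from p.apply_symm_apply i] at this
  exact this

/-- A relabelling of the standard configuration that can be undone by moving the frame does not
change the class. All identifications between labellings come from this. -/
theorem cls_eq_cls {p q : Equiv.Perm (Fin 5)} {a b a' b' : ℝ} (hab : IsParam a b)
    (hab' : IsParam a' b') {x y z : E3} (hf : IsFrame x y z)
    (h : ∀ i, freePt (stdVec 0) (stdVec 1) (stdVec 2) a b (q i) = freePt x y z a' b' i) :
    cls (p * q) hab' = cls p hab := by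
  refine (mk_eq_cls hab' hf fun i => ?_).symm
  rw [← h]
  simp [toConf]

theorem exists_eq_cls (c : X5) :
    ∃ (p : Equiv.Perm (Fin 5)) (a b : ℝ) (hab : IsParam a b), c = cls p hab := by
  induction c using Quotient.inductionOn with | _ U
  obtain ⟨p, x, y, z, a, b, hf, hab, h⟩ := (mem_confAngle_iff_isObtuse.1 U.2).exists_freePt
  exact ⟨p, a, b, hab, mk_eq_cls hab hf h⟩

/-- Exchange of the two antipodal vertices and of the two points of the free pair. -/
def swapPerm : Equiv.Perm (Fin 5) := Equiv.swap 0 1 * Equiv.swap 3 4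

/-- Rotation of the three coplanar points: `3 ↦ 2 ↦ 4 ↦ 3`. -/
def rotPerm : Equiv.Perm (Fin 5) := Equiv.swap 3 4 * Equiv.swap 2 3

/-- Rotation of a pair of orthogonal antipodal pairs: `0 ↦ 2 ↦ 1 ↦ 3 ↦ 0`. -/
def quarterPerm : Equiv.Perm (Fin 5) := Equiv.swap 0 3 * Equiv.swap 0 1 * Equiv.swap 0 2

theorem swapPerm_apply (i : Fin 5) : swapPerm i = ![1, 0, 2, 4, 3] i := by
  revert i; decide

theorem rotPerm_apply (i : Fin 5) : rotPerm i = ![0, 1, 4, 2, 3] i := by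
  revert i; decide

theorem quarterPerm_apply (i : Fin 5) : quarterPerm i = ![2, 3, 1, 0, 4] i := by
  revert i; decide

theorem IsParam.swap {a b : ℝ} (h : IsParam a b) : IsParam b a :=
  ⟨h.right, h.left, by linarith [h.add]⟩

theorem IsParam.rot {a b : ℝ} (h : IsParam a b) : IsParam b (Real.pi / 2 - a - b) :=
  ⟨h.right, by linarith [h.add], by linarith [h.left]⟩

theorem isParam_corner : IsParam (Real.pi / 2) 0 :=
  ⟨by positivity, le_rfl, by simp⟩

/-- The half turn about the third axis. -/
theorem cls_mul_swapPerm (p : Equiv.Perm (Fin 5)) {a b : ℝ} (hab : IsParam a b) :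
    cls (p * swapPerm) hab.swap = cls p hab := by
  refine cls_eq_cls (x := -stdVec 0) (y := -stdVec 1) (z := stdVec 2) hab hab.swap ?_ ?_
  · constructor <;> simp [inner_E3, det3, stdVec]
  · intro i
    rw [swapPerm_apply]
    fin_cases i <;> simp [freePt]

/-- The three coplanar points have gaps exceeding `π / 2` by `a`, `b` and `π / 2 - a - b`. Any of
them may serve as the third frame vector; taking the fifth point permutes the excesses cyclically.
-/
theorem cls_mul_rotPerm (p : Equiv.Perm (Fin 5)) {a b : ℝ} (hab : IsParam a b) :
    cls (p * rotPerm) hab.rot = cls p hab := by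
  have eb := Real.sin_sq_add_cos_sq b
  refine cls_eq_cls (x := stdVec 0) (y := Real.cos b • stdVec 2 - Real.sin b • stdVec 1)
    (z := -(Real.cos b • stdVec 1) - Real.sin b • stdVec 2) hab hab.rot ?_ ?_
  · constructor <;> simp [-inner_self_eq_norm_sq_to_K, inner_E3, det3, stdVec] <;> linarith
  · have e1 : Real.cos (Real.pi / 2 - a - b) = Real.sin (a + b) := by
      rw [← Real.cos_pi_div_two_sub]; ring_nf
    have e2 : Real.sin (Real.pi / 2 - a - b) = Real.cos (a + b) := by
      rw [← Real.sin_pi_div_two_sub]; ring_nf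
    intro i
    rw [rotPerm_apply, freePt, freePt, e1, e2, Real.sin_add, Real.cos_add]
    fin_cases i <;> simp only [Fin.zero_eta, Fin.mk_one, Fin.reduceFinMk, Matrix.cons_val]
    · ext k
      fin_cases k <;> simp [stdVec] <;> linarith
    · ext k
      fin_cases k <;> simp [stdVec]
      · linear_combination -Real.cos a * eb
      · linear_combination Real.sin a * eb

/-- The class of the configuration of five vertices of an octahedron with `p 0, p 1` and
`p 2, p 3` antipodal. -/
noncomputable def vx (p : Equiv.Perm (Fin 5)) : X5 := cls p isParam_corner

/-- At this corner there are two orthogonal antipodal pairs, and the quarter turn about the axis of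
the fifth point exchanges them. This is where distinct families are glued. -/
theorem vx_mul_quarterPerm (p : Equiv.Perm (Fin 5)) : vx (p * quarterPerm) = vx p := by
  refine cls_eq_cls (x := stdVec 2) (y := stdVec 1) (z := -stdVec 0) isParam_corner
    isParam_corner ?_ ?_
  · constructor <;> simp [inner_E3, det3, stdVec]
  · intro i
    have h0 : ∀ j, freePt (stdVec 0) (stdVec 1) (stdVec 2) (Real.pi / 2) 0 j =
      ![stdVec 0, -stdVec 0, stdVec 2, -stdVec 2, -stdVec 1] j := by
      intro j
      fin_cases j <;> simp [freePt]
    rw [h0]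
    rw [quarterPerm_apply]
    fin_cases i <;> simp [freePt]

end SphereConf

end

/-! ### The groups of labellings fixing a family or a corner -/

section

open SphereConf

namespace SphereConf

/-- The classes of the free pair configurations with labels assigned by `p`. -/
def family (p : Equiv.Perm (Fin 5)) : Set X5 :=
  {c | ∃ (a b : ℝ) (hab : IsParam a b), c = cls p hab}

theorem mem_freePairFamily_iff {e : OrthonormalBasis (Fin 3) ℝ E3} {σ p : Equiv.Perm (Fin 5)}
    {x y z : E3} (hf : IsFrame x y z)
    (h : ∀ a b i, freePairPoint e a b (σ (p i)) = freePt x y z a b i) :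
    freePairFamily e σ = family p := by
  ext c
  constructor
  · rintro ⟨U, ⟨a, b, ha, hb, hab, hU⟩, rfl⟩
    exact ⟨a, b, ⟨ha, hb, hab⟩, mk_eq_cls _ hf fun i => by rw [hU, h]⟩
  · rintro ⟨a, b, hab, rfl⟩
    refine ⟨toConf ((isObtuse_freePairPoint e hab).comp σ.injective),
      ⟨a, b, hab.left, hab.right, hab.add, fun i => rfl⟩, ?_⟩
    exact (mk_eq_cls hab hf fun i => h a b i).symm

/-- For a negatively oriented basis, reversing the first vector repairs the orientation and merely
exchanges the first two points. -/
theorem exists_freePairFamily_eq (e : OrthonormalBasis (Fin 3) ℝ E3) (σ : Equiv.Perm (Fin 5)) :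
    ∃ p, freePairFamily e σ = family p := by
  rcases isFrame_or_isFrame_neg e with h | h
  · exact ⟨σ⁻¹, mem_freePairFamily_iff h fun a b i => by
      rw [show σ (σ⁻¹ i) = i from σ.apply_symm_apply i, freePairPoint_eq]⟩
  · refine ⟨σ⁻¹ * Equiv.swap 0 1, mem_freePairFamily_iff h fun a b i => ?_⟩
    rw [Equiv.Perm.mul_apply, show ∀ j, σ (σ⁻¹ j) = j from σ.apply_symm_apply, freePairPoint_eq,
      show Equiv.swap 0 1 i = ![1, 0, 2, 3, 4] i by revert i; decide]
    fin_cases i <;> simp [freePt]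

theorem setOf_freePairFamily :
    {T | ∃ e σ, T = freePairFamily e σ} = {T | ∃ p, T = family p} := by
  ext T
  constructor
  · rintro ⟨e, σ, rfl⟩
    exact exists_freePairFamily_eq e σ
  · rintro ⟨p, rfl⟩
    obtain ⟨e, h0, h1, h2⟩ := isFrame_stdVec.exists_orthonormalBasis
    refine ⟨e, p⁻¹, (mem_freePairFamily_iff isFrame_stdVec fun a b i => ?_).symm⟩
    rw [show p⁻¹ (p i) = i from p.symm_apply_apply i, freePairPoint_eq, h0, h1, h2]

/-- The labellings giving the same octahedral configuration. -/
def cornerFinset : Finset (Equiv.Perm (Fin 5)) :=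
  Finset.univ.image fun k : Fin 4 => quarterPerm ^ (k : ℕ)

/-- The labellings giving the same family of free pair configurations. -/
def familyFinset : Finset (Equiv.Perm (Fin 5)) :=
  Finset.univ.image fun k : Fin 3 × Fin 2 => rotPerm ^ (k.1 : ℕ) * swapPerm ^ (k.2 : ℕ)

/-- The group of labellings giving the same octahedral configuration. -/
def cornerGroup : Subgroup (Equiv.Perm (Fin 5)) where
  carrier := cornerFinset
  mul_mem' {x y} hx hy := by
    have : ∀ x ∈ cornerFinset, ∀ y ∈ cornerFinset, x * y ∈ cornerFinset := by decide +kernel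
    exact this x hx y hy
  one_mem' := by
    have : 1 ∈ cornerFinset := by decide +kernel
    exact this
  inv_mem' {x} hx := by
    have : ∀ x ∈ cornerFinset, x⁻¹ ∈ cornerFinset := by decide +kernel
    exact this x hx

/-- The group of labellings giving the same family of free pair configurations. -/
def familyGroup : Subgroup (Equiv.Perm (Fin 5)) where
  carrier := familyFinset
  mul_mem' {x y} hx hy := by
    have : ∀ x ∈ familyFinset, ∀ y ∈ familyFinset, x * y ∈ familyFinset := by decide +kernel
    exact this x hx y hy
  one_mem' := by
    have : 1 ∈ familyFinset := by decide +kernel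
    exact this
  inv_mem' {x} hx := by
    have : ∀ x ∈ familyFinset, x⁻¹ ∈ familyFinset := by decide +kernel
    exact this x hx

theorem natCard_cornerGroup : Nat.card cornerGroup = 4 := by
  change Nat.card cornerFinset = 4
  rw [Nat.card_eq_fintype_card, Fintype.card_coe]
  decide +kernel

theorem natCard_familyGroup : Nat.card familyGroup = 6 := by
  change Nat.card familyFinset = 6
  rw [Nat.card_eq_fintype_card, Fintype.card_coe]
  decide +kernel

/-- Either the antipodal positions 0 and 1 together form one of the pairs `{g 0, g 1}`, `{g 2, g
3}`, giving 12 labellings of each orientation, or exactly one of them lies in one of these pairs. -/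
theorem perm_cases (g : Equiv.Perm (Fin 5)) :
    (∃ (i : Fin 3) (k : Fin 4), g = rotPerm ^ (i : ℕ) * quarterPerm ^ (k : ℕ)) ∨
    (∃ (i : Fin 3) (k : Fin 4), g = rotPerm ^ (i : ℕ) * quarterPerm ^ (k : ℕ) * Equiv.swap 0 1) ∨
    (g 0 < 2 ∧ ¬ g 1 < 2) ∨ (¬ g 0 < 2 ∧ g 1 < 2) ∨ (g 2 < 2 ∧ ¬ g 3 < 2) ∨
      (¬ g 2 < 2 ∧ g 3 < 2) := by
  revert g
  decide +kernel

/-- Families sharing two corners coincide. Solving the first condition for `g` leaves a finite check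
over the four elements of the corner group and the indices. -/
theorem mem_familyGroup_of (g : Equiv.Perm (Fin 5)) (i i' j j' : Fin 3) (hij : i ≠ j)
    (hij' : i' ≠ j')
    (h : (rotPerm ^ (i' : ℕ))⁻¹ * g * rotPerm ^ (i : ℕ) ∈ cornerFinset)
    (h' : (rotPerm ^ (j' : ℕ))⁻¹ * g * rotPerm ^ (j : ℕ) ∈ cornerFinset) : g ∈ familyFinset := by
  have key : ∀ i i' j j' : Fin 3, i ≠ j → i' ≠ j' → ∀ k ∈ cornerFinset,
      (rotPerm ^ (j' : ℕ))⁻¹ * (rotPerm ^ (i' : ℕ) * k * (rotPerm ^ (i : ℕ))⁻¹) * rotPerm ^ (j : ℕ)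
        ∈ cornerFinset → (rotPerm ^ (i' : ℕ) * k * (rotPerm ^ (i : ℕ))⁻¹) ∈ familyFinset := by
    decide +kernel
  have := key i i' j j' hij hij' _ h
  have e : rotPerm ^ (i' : ℕ) * ((rotPerm ^ (i' : ℕ))⁻¹ * g * rotPerm ^ (i : ℕ)) *
    (rotPerm ^ (i : ℕ))⁻¹ = g := by group
  rw [e] at this
  exact this h'

end SphereConf

end

/-! ### Barycentric coordinates as functions of the configuration -/

section

open SphereConf

namespace SphereConf

/-- The angle between two vectors, rescaled to vanish at right angles and to be `1` at
antipodes. -/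
noncomputable def alpha (u v : E3) : ℝ := 2 * InnerProductGeometry.angle u v / Real.pi - 1

theorem alpha_comm (u v : E3) : alpha u v = alpha v u := by
  rw [alpha, alpha, InnerProductGeometry.angle_comm]

theorem alpha_eq {u v : E3} (hu : inner ℝ u u = 1) (hv : inner ℝ v v = 1) {t : ℝ} (h0 : 0 ≤ t)
    (hpi : t ≤ Real.pi) (h : inner ℝ u v = Real.cos t) : alpha u v = 2 * t / Real.pi - 1 := by
  rw [real_inner_self_eq_norm_sq, pow_eq_one_iff_of_nonneg (norm_nonneg u) two_ne_zero] at hu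
  rw [real_inner_self_eq_norm_sq, pow_eq_one_iff_of_nonneg (norm_nonneg v) two_ne_zero] at hv
  rw [alpha, InnerProductGeometry.angle, hu, hv, h, mul_one, div_one, Real.arccos_cos h0 hpi]

/-- The barycentric coordinate, at the vertex with label `q`, of a configuration. -/
noncomputable def coord (q : Equiv.Perm (Fin 5)) (u : Fin 5 → E3) : ℝ :=
  if 0 < det3 (u (q 0)) (u (q 2)) (u (q 4)) then
    alpha (u (q 0)) (u (q 1)) * alpha (u (q 2)) (u (q 3)) else 0

theorem alpha_toEuclideanLin {A : Matrix (Fin 3) (Fin 3) ℝ}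
    (hA : A ∈ Matrix.specialOrthogonalGroup (Fin 3) ℝ) (x y : E3) :
    alpha (Matrix.toEuclideanLin A x) (Matrix.toEuclideanLin A y) = alpha x y := by
  have hn : ∀ x, ‖Matrix.toEuclideanLin A x‖ = ‖x‖ := fun x => by
    rw [← sq_eq_sq₀ (norm_nonneg _) (norm_nonneg _), ← real_inner_self_eq_norm_sq,
      ← real_inner_self_eq_norm_sq, inner_toEuclideanLin hA]
  rw [alpha, alpha, InnerProductGeometry.angle, InnerProductGeometry.angle, hn, hn,
    inner_toEuclideanLin hA]

theorem coord_toEuclideanLin {A : Matrix (Fin 3) (Fin 3) ℝ}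
    (hA : A ∈ Matrix.specialOrthogonalGroup (Fin 3) ℝ) (q : Equiv.Perm (Fin 5))
    (u : Fin 5 → E3) : coord q (fun i => Matrix.toEuclideanLin A (u i)) = coord q u := by
  simp only [coord, det3_toEuclideanLin hA, alpha_toEuclideanLin hA]

/-- The free pair configuration on the standard frame. -/
noncomputable def stdPt (a b : ℝ) : Fin 5 → E3 := freePt (stdVec 0) (stdVec 1) (stdVec 2) a b

/-- The barycentric coordinates of a free pair. -/
noncomputable def weight (a b : ℝ) : Fin 3 → ℝ :=
  ![2 * a / Real.pi, 2 * b / Real.pi, 1 - 2 * (a + b) / Real.pi]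

section

variable {a b : ℝ}

theorem IsParam.isObtuse_stdPt (hab : IsParam a b) : IsObtuse (stdPt a b) :=
  isFrame_stdVec.isObtuse hab

theorem inner_stdPt_cross {i j : Fin 5} (hi : i < 2) (hj : ¬ j < 2) :
    inner ℝ (stdPt a b i) (stdPt a b j) = 0 := by
  fin_cases i <;> fin_cases j <;>
    first
    | exact absurd (by decide) hj
    | exact absurd hi (by decide)
    | simp [stdPt, freePt, stdVec, inner_E3]

theorem IsParam.alpha_cross (hab : IsParam a b) {i j : Fin 5} (hi : i < 2) (hj : ¬ j < 2) :
    alpha (stdPt a b i) (stdPt a b j) = 0 := by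
  have ho := hab.isObtuse_stdPt
  rw [alpha_eq (ho.inner_self i) (ho.inner_self j) (t := Real.pi / 2) (by positivity)
    (by linarith [Real.pi_pos])]
  · have := Real.pi_ne_zero
    field_simp; ring
  · rw [Real.cos_pi_div_two, inner_stdPt_cross hi hj]

theorem IsParam.alpha_zero_one (hab : IsParam a b) :
    alpha (stdPt a b 0) (stdPt a b 1) = 1 := by
  have ho := hab.isObtuse_stdPt
  rw [alpha_eq (ho.inner_self 0) (ho.inner_self 1) (t := Real.pi) Real.pi_nonneg le_rfl]
  · have := Real.pi_ne_zero
    field_simp; ring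
  · simp [stdPt, freePt, stdVec]

theorem IsParam.alpha_two_three (hab : IsParam a b) :
    alpha (stdPt a b 2) (stdPt a b 3) = weight a b 0 := by
  have ho := hab.isObtuse_stdPt
  have h := hab.left
  have h' := hab.right
  have h'' := hab.add
  rw [alpha_eq (ho.inner_self 2) (ho.inner_self 3) (t := a + Real.pi / 2)
    (by positivity) (by linarith)]
  · have := Real.pi_ne_zero
    simp only [weight, Matrix.cons_val]
    field_simp; ring
  · rw [Real.cos_add_pi_div_two]
    simp [stdPt, freePt, stdVec, inner_E3]

theorem IsParam.alpha_two_four (hab : IsParam a b) :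
    alpha (stdPt a b 2) (stdPt a b 4) = weight a b 1 := by
  have ho := hab.isObtuse_stdPt
  have h := hab.left
  have h' := hab.right
  have h'' := hab.add
  rw [alpha_eq (ho.inner_self 2) (ho.inner_self 4) (t := b + Real.pi / 2)
    (by positivity) (by linarith)]
  · have := Real.pi_ne_zero
    simp only [weight, Matrix.cons_val]
    field_simp; ring
  · rw [Real.cos_add_pi_div_two]
    simp [stdPt, freePt, stdVec, inner_E3]

theorem IsParam.alpha_three_four (hab : IsParam a b) :
    alpha (stdPt a b 3) (stdPt a b 4) = weight a b 2 := by
  have ho := hab.isObtuse_stdPt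
  have h := hab.left
  have h' := hab.right
  have h'' := hab.add
  rw [alpha_eq (ho.inner_self 3) (ho.inner_self 4) (t := Real.pi - (a + b))
    (by linarith [Real.pi_pos]) (by linarith)]
  · have := Real.pi_ne_zero
    simp only [weight, Matrix.cons_val]
    field_simp; ring
  · rw [Real.cos_pi_sub, Real.cos_add]
    simp [stdPt, freePt, stdVec, inner_E3]
    ring

theorem IsParam.cos_left (hab : IsParam a b) : 0 ≤ Real.cos a ∧ (Real.cos a = 0 → a = Real.pi / 2) := by
  have h := hab.left
  have h' := hab.right
  have h'' := hab.add
  have := Real.pi_pos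
  refine ⟨Real.cos_nonneg_of_mem_Icc ⟨by linarith, by linarith⟩, fun h0 => ?_⟩
  by_contra hne
  have h1 : a < Real.pi / 2 := lt_of_le_of_ne (by linarith) hne
  exact (Real.cos_pos_of_mem_Ioo ⟨by linarith, h1⟩).ne' h0

theorem IsParam.sin_add (hab : IsParam a b) :
    0 ≤ Real.sin (a + b) ∧ (Real.sin (a + b) = 0 → a = 0 ∧ b = 0) := by
  have h := hab.left
  have h' := hab.right
  have h'' := hab.add
  have := Real.pi_pos
  refine ⟨Real.sin_nonneg_of_nonneg_of_le_pi (by linarith) (by linarith), fun h0 => ?_⟩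
  by_contra hne
  have h1 : 0 < a + b := by
    by_contra hcon
    exact hne ⟨by linarith, by linarith⟩
  exact (Real.sin_pos_of_pos_of_lt_pi h1 (by linarith)).ne' h0

/-- The values of the labellings near the six corners of a family. -/
def cornerLabel (i : Fin 3) (k : Fin 4) : Fin 5 → Fin 5 :=
  ![![![0, 1, 2, 3, 4], ![2, 3, 1, 0, 4], ![1, 0, 3, 2, 4], ![3, 2, 0, 1, 4]],
    ![![0, 1, 4, 2, 3], ![4, 2, 1, 0, 3], ![1, 0, 2, 4, 3], ![2, 4, 0, 1, 3]],
    ![![0, 1, 3, 4, 2], ![3, 4, 1, 0, 2], ![1, 0, 4, 3, 2], ![4, 3, 0, 1, 2]]] i k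

theorem cornerLabel_eq (i : Fin 3) (k : Fin 4) (j : Fin 5) :
    (rotPerm ^ (i : ℕ) * quarterPerm ^ (k : ℕ)) j = cornerLabel i k j := by
  revert i k j; decide +kernel

/-- The triple products at the corners. -/
noncomputable def cornerDet (a b : ℝ) (i : Fin 3) (k : Fin 4) : ℝ :=
  ![![Real.cos b, Real.cos b, Real.sin (a + b), Real.sin (a + b)],
    ![Real.sin (a + b), Real.sin (a + b), Real.cos a, Real.cos a],
    ![Real.cos a, Real.cos a, Real.cos b, Real.cos b]] i k

theorem det3_corner (a b : ℝ) (i : Fin 3) (k : Fin 4) :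
    det3 (stdPt a b (cornerLabel i k 0)) (stdPt a b (cornerLabel i k 2))
      (stdPt a b (cornerLabel i k 4)) = cornerDet a b i k := by
  fin_cases i <;> fin_cases k <;>
    simp [cornerLabel, cornerDet, stdPt, freePt, det3, stdVec, Real.sin_add] <;> ring

/-- Writing `l` for the labels at index `k`, those at `k + 1` (modulo 4) are `l 2, l 3, l 1, l 0, l
4`, so the sign comes from the antisymmetry of the triple product. -/
theorem det3_corner_swap (a b : ℝ) (i : Fin 3) (k : Fin 4) :
    det3 (stdPt a b (cornerLabel i k 1)) (stdPt a b (cornerLabel i k 2))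
      (stdPt a b (cornerLabel i k 4)) = -cornerDet a b i (k + 1) := by
  fin_cases i <;> fin_cases k <;>
    simp [cornerLabel, cornerDet, stdPt, freePt, det3, stdVec, Real.sin_add] <;> ring

theorem IsParam.cornerDet_nonneg (hab : IsParam a b) (i : Fin 3) (k : Fin 4) :
    0 ≤ cornerDet a b i k := by
  have h1 := hab.cos_left.1
  have h2 := hab.swap.cos_left.1
  have h3 := hab.sin_add.1
  fin_cases i <;> fin_cases k <;> assumption

/-- The triple products at corner `i` degenerate only at the other two vertices of the triangle,
where the `i`th weight is zero. -/
theorem IsParam.weight_eq_zero (hab : IsParam a b) {i : Fin 3} {k : Fin 4}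
    (h : cornerDet a b i k = 0) : weight a b i = 0 := by
  have hpi := Real.pi_ne_zero
  have ha := hab.left
  have hb := hab.right
  have hle := hab.add
  have h1 : Real.cos a = 0 → a = Real.pi / 2 ∧ b = 0 := fun h0 => by
    have := hab.cos_left.2 h0
    exact ⟨this, by linarith⟩
  have h2 : Real.cos b = 0 → b = Real.pi / 2 ∧ a = 0 := fun h0 => by
    have := hab.swap.cos_left.2 h0
    exact ⟨this, by linarith⟩
  have h3 := hab.sin_add.2
  have w1 : Real.cos a = 0 → weight a b 1 = 0 ∧ weight a b 2 = 0 := fun h0 => by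
    obtain ⟨rfl, rfl⟩ := h1 h0
    constructor <;> simp [weight]
    field_simp
    ring
  have w2 : Real.cos b = 0 → weight a b 0 = 0 ∧ weight a b 2 = 0 := fun h0 => by
    obtain ⟨rfl, rfl⟩ := h2 h0
    constructor <;> simp [weight]
    field_simp
    ring
  have w3 : Real.sin (a + b) = 0 → weight a b 0 = 0 ∧ weight a b 1 = 0 := fun h0 => by
    obtain ⟨rfl, rfl⟩ := h3 h0
    constructor <;> simp [weight]
  fin_cases i <;> fin_cases k <;>
    first
    | exact (w1 h).1
    | exact (w1 h).2
    | exact (w2 h).1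
    | exact (w2 h).2
    | exact (w3 h).1
    | exact (w3 h).2

theorem IsParam.alpha_corner (hab : IsParam a b) (i : Fin 3) (k : Fin 4) :
    alpha (stdPt a b (cornerLabel i k 0)) (stdPt a b (cornerLabel i k 1)) *
      alpha (stdPt a b (cornerLabel i k 2)) (stdPt a b (cornerLabel i k 3)) = weight a b i := by
  have h01 := hab.alpha_zero_one
  have h23 := hab.alpha_two_three
  have h24 := hab.alpha_two_four
  have h34 := hab.alpha_three_four
  have h10 := (alpha_comm _ _).trans h01
  have h32 := (alpha_comm _ _).trans h23
  have h42 := (alpha_comm _ _).trans h24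
  have h43 := (alpha_comm _ _).trans h34
  fin_cases i <;> fin_cases k <;> simp [cornerLabel, h01, h10, h23, h32, h24, h42, h34, h43]

theorem perm_corner_apply {g : Equiv.Perm (Fin 5)} {i : Fin 3} {k : Fin 4}
    (h : g = rotPerm ^ (i : ℕ) * quarterPerm ^ (k : ℕ)) (j : Fin 5) : g j = cornerLabel i k j := by
  rw [h, cornerLabel_eq]

theorem perm_corner_swap_apply {g : Equiv.Perm (Fin 5)} {i : Fin 3} {k : Fin 4}
    (h : g = rotPerm ^ (i : ℕ) * quarterPerm ^ (k : ℕ) * Equiv.swap 0 1) :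
    g 0 = cornerLabel i k 1 ∧ g 1 = cornerLabel i k 0 ∧ g 2 = cornerLabel i k 2 ∧
      g 3 = cornerLabel i k 3 ∧ g 4 = cornerLabel i k 4 := by
  simp only [h, Equiv.Perm.mul_apply (_ * _), cornerLabel_eq]
  simp [Equiv.swap_apply_def]

theorem IsParam.alpha_mul_alpha_eq_zero (hab : IsParam a b) {g : Equiv.Perm (Fin 5)}
    (h : (g 0 < 2 ∧ ¬ g 1 < 2) ∨ (¬ g 0 < 2 ∧ g 1 < 2) ∨ (g 2 < 2 ∧ ¬ g 3 < 2) ∨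
      (¬ g 2 < 2 ∧ g 3 < 2)) :
    alpha (stdPt a b (g 0)) (stdPt a b (g 1)) * alpha (stdPt a b (g 2)) (stdPt a b (g 3)) = 0 := by
  rcases h with ⟨h, h'⟩ | ⟨h, h'⟩ | ⟨h, h'⟩ | ⟨h, h'⟩
  · rw [hab.alpha_cross h h', zero_mul]
  · rw [alpha_comm (stdPt a b (g 0)), hab.alpha_cross h' h, zero_mul]
  · rw [hab.alpha_cross h h', mul_zero]
  · rw [alpha_comm (stdPt a b (g 2)), hab.alpha_cross h' h, mul_zero]

/-- Where the triple product in the definition of `coord` vanishes, so does the product. -/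
theorem IsParam.alpha_mul_alpha_eq_zero_of_det3 (hab : IsParam a b) (g : Equiv.Perm (Fin 5))
    (h : det3 (stdPt a b (g 0)) (stdPt a b (g 2)) (stdPt a b (g 4)) = 0) :
    alpha (stdPt a b (g 0)) (stdPt a b (g 1)) * alpha (stdPt a b (g 2)) (stdPt a b (g 3)) = 0 := by
  rcases perm_cases g with ⟨i, k, hg⟩ | ⟨i, k, hg⟩ | hg
  · simp only [perm_corner_apply hg] at h ⊢
    rw [det3_corner] at h
    rw [hab.alpha_corner, hab.weight_eq_zero h]
  · obtain ⟨h0, h1, h2, h3, h4⟩ := perm_corner_swap_apply hg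
    rw [h0, h2, h4, det3_corner_swap, neg_eq_zero] at h
    rw [h0, h1, h2, h3, alpha_comm (stdPt a b (cornerLabel i k 1)), hab.alpha_corner,
      hab.weight_eq_zero h]
  · exact hab.alpha_mul_alpha_eq_zero hg

/-- A labelling belonging to one of the three corners picks out the weight there. Its mirror image
has nonpositive triple product, and any other labelling pairs orthogonal points, so both contribute
zero. -/
theorem IsParam.coord_stdPt (hab : IsParam a b) (g : Equiv.Perm (Fin 5)) :
    coord g (stdPt a b) =
      ∑ i : Fin 3, if (rotPerm ^ (i : ℕ))⁻¹ * g ∈ cornerFinset then weight a b i else 0 := by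
  rcases perm_cases g with ⟨i, k, hg⟩ | ⟨i, k, hg⟩ | hg
  · have hmem : ∀ (i j : Fin 3) (k : Fin 4), (rotPerm ^ (j : ℕ))⁻¹ *
        (rotPerm ^ (i : ℕ) * quarterPerm ^ (k : ℕ)) ∈ cornerFinset ↔ i = j := by decide +kernel
    have hmem' : ∀ j : Fin 3, (rotPerm ^ (j : ℕ))⁻¹ * g ∈ cornerFinset ↔ i = j := by
      rw [hg]; exact fun j => hmem i j k
    simp only [hmem', Finset.sum_ite_eq, Finset.mem_univ, if_true]
    simp only [coord, perm_corner_apply hg, det3_corner, hab.alpha_corner]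
    rw [ite_eq_left_iff]
    intro h0
    exact (hab.weight_eq_zero (le_antisymm (not_lt.1 h0) (hab.cornerDet_nonneg i k))).symm
  · have hmem : ∀ (i j : Fin 3) (k : Fin 4), (rotPerm ^ (j : ℕ))⁻¹ *
        (rotPerm ^ (i : ℕ) * quarterPerm ^ (k : ℕ) * Equiv.swap 0 1) ∉ cornerFinset := by
      decide +kernel
    have hmem' : ∀ j : Fin 3, (rotPerm ^ (j : ℕ))⁻¹ * g ∉ cornerFinset := by
      rw [hg]; exact fun j => hmem i j k
    simp only [hmem', if_false, Finset.sum_const_zero]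
    obtain ⟨h0, h1, h2, h3, h4⟩ := perm_corner_swap_apply hg
    rw [coord, h0, h2, h4, det3_corner_swap, if_neg]
    linarith [hab.cornerDet_nonneg i (k + 1)]
  · have hmem : ∀ (j : Fin 3), ∀ k ∈ cornerFinset,
        ¬ (((rotPerm ^ (j : ℕ) * k) 0 < 2 ∧ ¬ (rotPerm ^ (j : ℕ) * k) 1 < 2) ∨
        (¬ (rotPerm ^ (j : ℕ) * k) 0 < 2 ∧ (rotPerm ^ (j : ℕ) * k) 1 < 2) ∨
        ((rotPerm ^ (j : ℕ) * k) 2 < 2 ∧ ¬ (rotPerm ^ (j : ℕ) * k) 3 < 2) ∨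
        (¬ (rotPerm ^ (j : ℕ) * k) 2 < 2 ∧ (rotPerm ^ (j : ℕ) * k) 3 < 2)) := by
      decide +kernel
    have hmem' : ∀ j : Fin 3, (rotPerm ^ (j : ℕ))⁻¹ * g ∉ cornerFinset := by
      intro j hj
      have := hmem j _ hj
      rw [mul_inv_cancel_left] at this
      exact this hg
    simp only [hmem', if_false, Finset.sum_const_zero, coord, hab.alpha_mul_alpha_eq_zero hg,
      ite_self]

end

end SphereConf

end

/-! ### The incidence structure of corners and triangles -/

section

open SphereConf

namespace SphereConf

open CoordinateComplex

/-- The classes of labellings of an octahedron with one vertex removed. -/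
abbrev Corner : Type := Equiv.Perm (Fin 5) ⧸ cornerGroup

/-- The families of free pair configurations. -/
abbrev Triangle : Type := Equiv.Perm (Fin 5) ⧸ familyGroup

theorem natCard_corner : Nat.card Corner = 30 := by
  have := Subgroup.card_eq_card_quotient_mul_card_subgroup cornerGroup
  rw [natCard_cornerGroup, Nat.card_eq_fintype_card, Fintype.card_perm, Fintype.card_fin] at this
  have h : Nat.factorial 5 = 120 := rfl
  rw [h] at this
  change Nat.card (Equiv.Perm (Fin 5) ⧸ cornerGroup) = 30
  omega

theorem natCard_triangle : Nat.card Triangle = 20 := by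
  have := Subgroup.card_eq_card_quotient_mul_card_subgroup familyGroup
  rw [natCard_familyGroup, Nat.card_eq_fintype_card, Fintype.card_perm, Fintype.card_fin] at this
  have h : Nat.factorial 5 = 120 := rfl
  rw [h] at this
  change Nat.card (Equiv.Perm (Fin 5) ⧸ familyGroup) = 20
  omega

/-- A numbering of the corners. -/
noncomputable def cornerEquiv : Corner ≃ Fin 30 := Finite.equivFinOfCardEq natCard_corner

/-- The number of the `i`th corner of the family with labelling `p`. -/
noncomputable def corner (p : Equiv.Perm (Fin 5)) (i : Fin 3) : Fin 30 :=
  cornerEquiv (QuotientGroup.mk (p * rotPerm ^ (i : ℕ)))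

theorem corner_eq_corner_iff {p q : Equiv.Perm (Fin 5)} {i j : Fin 3} :
    corner p i = corner q j ↔
      (rotPerm ^ (i : ℕ))⁻¹ * (p⁻¹ * q) * rotPerm ^ (j : ℕ) ∈ cornerFinset := by
  rw [corner, corner, cornerEquiv.apply_eq_iff_eq, QuotientGroup.eq, mul_inv_rev]
  simp only [mul_assoc]
  rfl

theorem corner_injective (p : Equiv.Perm (Fin 5)) : Function.Injective (corner p) := by
  intro i j h
  rw [corner_eq_corner_iff, inv_mul_cancel] at h
  revert i j
  decide +kernel

/-- The corners of a family. -/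
noncomputable def corners (p : Equiv.Perm (Fin 5)) : Finset (Fin 30) :=
  Finset.univ.image (corner p)

theorem card_corners (p : Equiv.Perm (Fin 5)) : (corners p).card = 3 := by
  rw [corners, Finset.card_image_of_injective _ (corner_injective p)]; rfl

theorem corner_mem_corners (p : Equiv.Perm (Fin 5)) (i : Fin 3) : corner p i ∈ corners p :=
  Finset.mem_image_of_mem _ (Finset.mem_univ i)

theorem corners_subset_corners {p q : Equiv.Perm (Fin 5)} (h : p⁻¹ * q ∈ familyGroup) :
    corners p ⊆ corners q := by
  intro v hv
  obtain ⟨i, -, rfl⟩ := Finset.mem_image.1 hv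
  have key : ∀ d ∈ familyFinset, ∀ i : Fin 3, ∃ j : Fin 3,
      (rotPerm ^ (i : ℕ))⁻¹ * d * rotPerm ^ (j : ℕ) ∈ cornerFinset := by decide +kernel
  obtain ⟨j, hj⟩ := key _ h i
  rw [corner_eq_corner_iff.2 hj]
  exact corner_mem_corners q j

theorem corners_eq_corners {p q : Equiv.Perm (Fin 5)}
    (h : (QuotientGroup.mk p : Triangle) = QuotientGroup.mk q) : corners p = corners q :=
  (corners_subset_corners (QuotientGroup.eq.1 h)).antisymm
    (corners_subset_corners (QuotientGroup.eq.1 h.symm))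

/-- The corners of a triangle. -/
noncomputable def tri (t : Triangle) : Finset (Fin 30) := corners t.out

theorem tri_mk (p : Equiv.Perm (Fin 5)) : tri (QuotientGroup.mk p) = corners p :=
  corners_eq_corners (QuotientGroup.out_eq' _)

theorem card_tri (t : Triangle) : (tri t).card = 3 := card_corners _

theorem card_corners_inter_le {p q : Equiv.Perm (Fin 5)}
    (h : (QuotientGroup.mk p : Triangle) ≠ QuotientGroup.mk q) :
    (corners p ∩ corners q).card ≤ 1 := by
  rw [Finset.card_le_one]
  intro v hv w hw
  obtain ⟨hv, hv'⟩ := Finset.mem_inter.1 hv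
  obtain ⟨hw, hw'⟩ := Finset.mem_inter.1 hw
  obtain ⟨i, -, rfl⟩ := Finset.mem_image.1 hv
  obtain ⟨i', -, e⟩ := Finset.mem_image.1 hv'
  obtain ⟨j, -, rfl⟩ := Finset.mem_image.1 hw
  obtain ⟨j', -, e'⟩ := Finset.mem_image.1 hw'
  by_contra hne
  refine h (QuotientGroup.eq.2 ?_)
  exact mem_familyGroup_of _ i' i j' j (fun h => hne (by rw [← e, ← e', h]))
    (fun h => hne (by rw [h])) (corner_eq_corner_iff.1 e.symm) (corner_eq_corner_iff.1 e'.symm)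

theorem card_tri_inter_le (t t' : Triangle) (h : t ≠ t') : (tri t ∩ tri t').card ≤ 1 := by
  apply card_corners_inter_le
  rwa [QuotientGroup.out_eq', QuotientGroup.out_eq']

theorem exists_corner_eq (v : Fin 30) : ∃ p, corner p 0 = v := by
  obtain ⟨c, rfl⟩ := cornerEquiv.surjective v
  obtain ⟨p, rfl⟩ := QuotientGroup.mk_surjective c
  exact ⟨p, by simp [corner]⟩

theorem exists_mem_tri (v : Fin 30) : ∃ t, v ∈ tri t := by
  obtain ⟨p, rfl⟩ := exists_corner_eq v
  exact ⟨QuotientGroup.mk p, by rw [tri_mk]; exact corner_mem_corners p 0⟩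

theorem family_subset_family_mul {p d : Equiv.Perm (Fin 5)} (hd : d ∈ familyGroup) :
    family p ⊆ family (p * d) := by
  have hs : ∀ p, family p ⊆ family (p * swapPerm) := by
    rintro p _ ⟨a, b, hab, rfl⟩
    exact ⟨_, _, _, (cls_mul_swapPerm p hab).symm⟩
  have hr : ∀ p, family p ⊆ family (p * rotPerm) := by
    rintro p _ ⟨a, b, hab, rfl⟩
    exact ⟨_, _, _, (cls_mul_rotPerm p hab).symm⟩
  have hr' : ∀ (k : ℕ) p, family p ⊆ family (p * rotPerm ^ k) := by
    intro k
    induction k with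
    | zero => intro p; rw [pow_zero, mul_one]
    | succ k ih => intro p; rw [pow_succ, ← mul_assoc]; exact (ih p).trans (hr _)
  have hs' : ∀ (k : ℕ) p, family p ⊆ family (p * swapPerm ^ k) := by
    intro k
    induction k with
    | zero => intro p; rw [pow_zero, mul_one]
    | succ k ih => intro p; rw [pow_succ, ← mul_assoc]; exact (ih p).trans (hs _)
  obtain ⟨⟨i, j⟩, -, rfl⟩ := Finset.mem_image.1 (show d ∈ familyFinset from hd)
  rw [← mul_assoc]
  exact (hr' _ p).trans (hs' _ _)

theorem family_eq_family {p q : Equiv.Perm (Fin 5)}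
    (h : (QuotientGroup.mk p : Triangle) = QuotientGroup.mk q) : family p = family q := by
  refine Set.Subset.antisymm ?_ ?_
  · have := family_subset_family_mul (p := p) (QuotientGroup.eq.1 h)
    rwa [mul_inv_cancel_left] at this
  · have := family_subset_family_mul (p := q) (QuotientGroup.eq.1 h.symm)
    rwa [mul_inv_cancel_left] at this

theorem vx_eq_vx {p q : Equiv.Perm (Fin 5)} (h : p⁻¹ * q ∈ cornerGroup) : vx p = vx q := by
  obtain ⟨k, -, hk⟩ := Finset.mem_image.1 (show p⁻¹ * q ∈ cornerFinset from h)
  have : ∀ (k : ℕ), vx (p * quarterPerm ^ k) = vx p := by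
    intro k
    induction k with
    | zero => rw [pow_zero, mul_one]
    | succ k ih => rw [pow_succ, ← mul_assoc, vx_mul_quarterPerm, ih]
  have h' := this k
  rw [hk, mul_inv_cancel_left] at h'
  exact h'.symm

theorem vx_eq_of_corner_eq {p q : Equiv.Perm (Fin 5)} {i j : Fin 3} (h : corner p i = corner q j) :
    vx (p * rotPerm ^ (i : ℕ)) = vx (q * rotPerm ^ (j : ℕ)) := by
  apply vx_eq_vx
  rw [corner, corner, cornerEquiv.apply_eq_iff_eq, QuotientGroup.eq] at h
  exact h

section

variable {a b : ℝ}

theorem IsParam.weight_nonneg (hab : IsParam a b) (i : Fin 3) : 0 ≤ weight a b i := by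
  have h1 := hab.left
  have h2 := hab.right
  have h3 := hab.add
  have hpi := Real.pi_pos
  fin_cases i
  · exact div_nonneg (by linarith) hpi.le
  · exact div_nonneg (by linarith) hpi.le
  · refine sub_nonneg.2 ((div_le_one hpi).2 (by linarith))

theorem sum_weight (a b : ℝ) : ∑ i, weight a b i = 1 := by
  rw [Fin.sum_univ_three]
  simp only [weight, Matrix.cons_val]
  ring

theorem eq_of_weight_eq {a' b' : ℝ} (h : ∀ i, weight a b i = weight a' b' i) :
    a = a' ∧ b = b' := by
  have h0 := h 0
  have h1 := h 1
  have hpi := Real.pi_ne_zero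
  simp only [weight, Matrix.cons_val] at h0 h1
  field_simp at h0 h1
  exact ⟨h0, h1⟩

theorem exists_weight_eq {w : Fin 3 → ℝ} (h0 : ∀ i, 0 ≤ w i) (h1 : ∑ i, w i = 1) :
    ∃ a b, IsParam a b ∧ weight a b = w := by
  have hpi := Real.pi_pos
  rw [Fin.sum_univ_three] at h1
  refine ⟨Real.pi / 2 * w 0, Real.pi / 2 * w 1, ⟨mul_nonneg (by positivity) (h0 0),
    mul_nonneg (by positivity) (h0 1), ?_⟩, ?_⟩
  · have := h0 2
    rw [← mul_add]
    exact mul_le_of_le_one_right (by positivity) (by linarith)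
  · ext i
    fin_cases i <;> simp [weight] <;> field_simp
    linarith

theorem weight_rot {i : Fin 3} (hi : weight a b (i + 1) = 1) :
    weight b (Real.pi / 2 - a - b) i = 1 := by
  have hpi := Real.pi_ne_zero
  have hs := sum_weight a b
  rw [Fin.sum_univ_three] at hs
  rw [← hi]
  fin_cases i <;> simp [weight] <;> field_simp <;> ring

theorem IsParam.eq_corner (hab : IsParam a b) (h : weight a b 0 = 1) : a = Real.pi / 2 ∧ b = 0 := by
  have hpi := Real.pi_ne_zero
  simp only [weight, Matrix.cons_val] at h
  field_simp at h
  exact ⟨by linarith, by linarith [hab.right, hab.add]⟩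

/-- Cyclic rotation of the three coplanar points brings the vertex of weight 1 to index 0. -/
theorem cls_eq_vx {p : Equiv.Perm (Fin 5)} (hab : IsParam a b) {i : Fin 3}
    (h : weight a b i = 1) : cls p hab = vx (p * rotPerm ^ (i : ℕ)) := by
  have h0 : ∀ {a b : ℝ} (hab : IsParam a b) (p : Equiv.Perm (Fin 5)), weight a b 0 = 1 →
      cls p hab = vx p := by
    intro a b hab p h
    obtain ⟨rfl, rfl⟩ := hab.eq_corner h
    rfl
  have h1 : ∀ {a b : ℝ} (hab : IsParam a b) (p : Equiv.Perm (Fin 5)), weight a b 1 = 1 →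
      cls p hab = vx (p * rotPerm) := by
    intro a b hab p h
    rw [← cls_mul_rotPerm]
    exact h0 _ _ (weight_rot h)
  fin_cases i
  · simpa using h0 hab p h
  · simpa using h1 hab p h
  · rw [← cls_mul_rotPerm, h1 _ _ (weight_rot h)]
    simp [pow_two, mul_assoc]

end

/-- The barycentric coordinates on the reduced space. -/
noncomputable def coordClass (q : Equiv.Perm (Fin 5)) (c : X5) : ℝ :=
  Quotient.liftOn c (fun U => coord q fun i => (U.1 i : E3)) (by
    rintro U V ⟨A, hA, h⟩
    simp only [h, coord_toEuclideanLin hA])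

/-- The map to coordinate space which triangulates the reduced space. -/
noncomputable def triangulation (c : X5) : EuclideanSpace ℝ (Fin 30) :=
  WithLp.toLp 2 fun v => coordClass (cornerEquiv.symm v).out c

/-- The globally defined coordinates restrict on each family to an affine parametrization of a
coordinate triangle. Injectivity and surjectivity onto the complex follow from this formula. -/
theorem triangulation_cls (p : Equiv.Perm (Fin 5)) {a b : ℝ} (hab : IsParam a b) :
    triangulation (cls p hab) = ∑ i, weight a b i • basisVec (corner p i) := by
  ext v
  obtain ⟨c, rfl⟩ := cornerEquiv.surjective v
  have h1 : triangulation (cls p hab) (cornerEquiv c) = coord (p⁻¹ * c.out) (stdPt a b) := by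
    simp only [triangulation, PiLp.toLp_apply, Equiv.symm_apply_apply]
    rfl
  have h2 : ∀ i : Fin 3, (rotPerm ^ (i : ℕ))⁻¹ * (p⁻¹ * c.out) ∈ cornerFinset ↔
      cornerEquiv c = corner p i := by
    intro i
    rw [corner, cornerEquiv.apply_eq_iff_eq, eq_comm]
    conv_rhs => rw [← QuotientGroup.out_eq' c, QuotientGroup.eq, mul_inv_rev, mul_assoc]
    rfl
  rw [h1, hab.coord_stdPt]
  simp only [h2, WithLp.ofLp_sum, Finset.sum_apply, PiLp.smul_apply, PiLp.single_apply,
    smul_eq_mul, mul_ite, mul_one, mul_zero]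

end SphereConf

end

/-! ### The triangulating homeomorphism -/

section

open SphereConf

namespace SphereConf

open CoordinateComplex

theorem triangulation_image_family (p : Equiv.Perm (Fin 5)) :
    triangulation '' family p = hull (corners p) := by
  ext x
  constructor
  · rintro ⟨_, ⟨a, b, hab, rfl⟩, rfl⟩
    rw [triangulation_cls]
    exact (convex_hull _).sum_mem (fun i _ => hab.weight_nonneg i) (sum_weight a b)
      fun i _ => basisVec_mem_hull (corner_mem_corners p i)
  · rintro ⟨h0, h1, h2⟩
    have hsum : ∀ f : Fin 30 → ℝ, (∀ v ∉ corners p, f v = 0) → ∑ v, f v = ∑ i, f (corner p i) := by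
      intro f hf
      rw [← Finset.sum_subset (Finset.subset_univ (corners p)) fun v _ hv => hf v hv, corners,
        Finset.sum_image fun i _ j _ h => corner_injective p h]
    obtain ⟨a, b, hab, hw⟩ := exists_weight_eq (w := fun i => x (corner p i)) (fun i => h0 _)
      (by rw [← hsum _ h2, h1])
    refine ⟨cls p hab, ⟨a, b, hab, rfl⟩, ?_⟩
    rw [triangulation_cls, hw]
    ext v
    simp only [WithLp.ofLp_sum, Finset.sum_apply, PiLp.smul_apply, PiLp.single_apply,
      smul_eq_mul, mul_ite, mul_one, mul_zero]
    by_cases hv : v ∈ corners p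
    · obtain ⟨i, -, rfl⟩ := Finset.mem_image.1 hv
      simp [(corner_injective p).eq_iff]
    · rw [h2 v hv]
      refine Finset.sum_eq_zero fun i _ => if_neg ?_
      rintro rfl
      exact hv (corner_mem_corners p i)

theorem triangulation_cls_corner (p : Equiv.Perm (Fin 5)) {a b : ℝ} (hab : IsParam a b)
    (i : Fin 3) : triangulation (cls p hab) (corner p i) = weight a b i := by
  rw [triangulation_cls]
  simp [Pi.single_apply, (corner_injective p).eq_iff]

theorem cls_eq_vx_of_triangulation {p : Equiv.Perm (Fin 5)} {a b : ℝ} (hab : IsParam a b)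
    {i : Fin 3} (h : triangulation (cls p hab) = basisVec (corner p i)) :
    cls p hab = vx (p * rotPerm ^ (i : ℕ)) := by
  apply cls_eq_vx hab
  rw [← triangulation_cls_corner p hab, h]
  simp

theorem cls_mem_family (p : Equiv.Perm (Fin 5)) {a b : ℝ} (hab : IsParam a b) :
    cls p hab ∈ family p := ⟨a, b, hab, rfl⟩

/-- Within one family the weights determine the parameters. Images from two different families meet
only in a common corner, and the corner determines the class. -/
theorem triangulation_injective : Function.Injective triangulation := by
  intro c c' h
  obtain ⟨p, a, b, hab, rfl⟩ := exists_eq_cls c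
  obtain ⟨q, a', b', hab', rfl⟩ := exists_eq_cls c'
  by_cases hpq : (QuotientGroup.mk p : Triangle) = QuotientGroup.mk q
  · obtain ⟨a', b', hab', e⟩ : cls q hab' ∈ family p := by
      rw [family_eq_family hpq]; exact cls_mem_family q hab'
    rw [e] at h ⊢
    obtain ⟨rfl, rfl⟩ := eq_of_weight_eq (a := a) (b := b) (a' := a') (b' := b') fun i => by
      rw [← triangulation_cls_corner p hab, h, triangulation_cls_corner]
    rfl
  · have hp : triangulation (cls p hab) ∈ hull (corners p) := by
      rw [← triangulation_image_family]
      exact Set.mem_image_of_mem _ (cls_mem_family p hab)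
    have hq : triangulation (cls p hab) ∈ hull (corners q) := by
      rw [← triangulation_image_family, h]
      exact Set.mem_image_of_mem _ (cls_mem_family q hab')
    obtain ⟨v, hv, hx⟩ := exists_eq_basisVec_of_mem_hull (card_corners_inter_le hpq) hp hq
    obtain ⟨hv, hv'⟩ := Finset.mem_inter.1 hv
    obtain ⟨i, -, rfl⟩ := Finset.mem_image.1 hv
    obtain ⟨j, -, e⟩ := Finset.mem_image.1 hv'
    rw [cls_eq_vx_of_triangulation hab hx, vx_eq_of_corner_eq e.symm]
    rw [h, ← e] at hx
    rw [cls_eq_vx_of_triangulation hab' hx]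

theorem triangulation_mem_space (c : X5) : triangulation c ∈ (complex tri).space := by
  obtain ⟨p, a, b, hab, rfl⟩ := exists_eq_cls c
  rw [mem_space card_tri]
  refine ⟨QuotientGroup.mk p, ?_⟩
  rw [tri_mk, ← triangulation_image_family]
  exact Set.mem_image_of_mem _ (cls_mem_family p hab)

theorem exists_triangulation_eq {x : EuclideanSpace ℝ (Fin 30)} (hx : x ∈ (complex tri).space) :
    ∃ c, triangulation c = x := by
  obtain ⟨t, ht⟩ := (mem_space card_tri).1 hx
  rw [tri, ← triangulation_image_family] at ht
  obtain ⟨c, -, rfl⟩ := ht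
  exact ⟨c, rfl⟩

theorem exists_rotation_eq (U : confAngle 5 (Real.pi / 2)) :
    ∃ (p : Equiv.Perm (Fin 5)) (a b : ℝ), IsParam a b ∧
      ∃ A ∈ Matrix.specialOrthogonalGroup (Fin 3) ℝ,
        ∀ i, (U.1 i : E3) = Matrix.toEuclideanLin A (stdPt a b (p⁻¹ i)) := by
  obtain ⟨p, a, b, hab, h⟩ := exists_eq_cls (Quotient.mk _ U)
  obtain ⟨A, hA, h⟩ := Quotient.exact h.symm
  exact ⟨p, a, b, hab, A, hA, h⟩

theorem continuous_det3 {α : Type*} [TopologicalSpace α] {f g h : α → E3} (hf : Continuous f)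
    (hg : Continuous g) (hh : Continuous h) : Continuous fun x => det3 (f x) (g x) (h x) := by
  unfold det3
  fun_prop

theorem continuous_alpha {α : Type*} [TopologicalSpace α] {f g : α → S2} (hf : Continuous f)
    (hg : Continuous g) : Continuous fun x => alpha (f x : E3) (g x : E3) := by
  unfold alpha
  refine Continuous.sub (Continuous.div_const (Continuous.mul continuous_const ?_) _)
    continuous_const
  refine continuous_iff_continuousAt.2 fun x => ?_
  refine ContinuousAt.comp (g := fun y : E3 × E3 => InnerProductGeometry.angle y.1 y.2)
    (f := fun x => ((f x : E3), (g x : E3))) (x := x)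
    (InnerProductGeometry.continuousAt_angle ?_ ?_) (by fun_prop)
  · exact ne_zero_of_mem_unit_sphere _
  · exact ne_zero_of_mem_unit_sphere _

/-- The cut-off can only jump where the triple product is zero, and on obtuse configurations the
product of angles vanishes there too. -/
theorem continuous_coordClass (q : Equiv.Perm (Fin 5)) : Continuous (coordClass q) := by
  refine Continuous.quotient_liftOn' (s := rotationSetoid _) ?_ _
  have hU : ∀ i, Continuous fun U : confAngle 5 (Real.pi / 2) => U.1 i := fun i =>
    (continuous_apply i).comp continuous_subtype_val
  have hV : ∀ i, Continuous fun U : confAngle 5 (Real.pi / 2) => (U.1 i : E3) := fun i =>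
    continuous_subtype_val.comp (hU i)
  unfold coord
  refine Continuous.if (fun U hU => ?_) ((continuous_alpha (hU _) (hU _)).mul
    (continuous_alpha (hU _) (hU _))) continuous_const
  have h0 := frontier_lt_subset_eq continuous_const (continuous_det3 (hV _) (hV _) (hV _)) hU
  obtain ⟨p, a, b, hab, A, hA, h⟩ := exists_rotation_eq U
  simp only [Set.mem_ofPred_eq, h, det3_toEuclideanLin hA, alpha_toEuclideanLin hA] at h0 ⊢
  exact hab.alpha_mul_alpha_eq_zero_of_det3 (p⁻¹ * q) h0.symm

theorem continuous_triangulation : Continuous triangulation := by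
  refine (PiLp.continuous_toLp 2 _).comp (continuous_pi fun v => continuous_coordClass _)

theorem isClosed_confAngle : IsClosed (confAngle 5 (Real.pi / 2)) := by
  have : confAngle 5 (Real.pi / 2) =
      {U | ∀ i j, i < j → inner ℝ (U i : E3) (U j : E3) ≤ 0} := by
    ext U; exact mem_confAngle_iff
  rw [this]
  simp only [Set.ofPred_forall]
  refine isClosed_iInter fun i => isClosed_iInter fun j => isClosed_iInter fun _ => ?_
  exact isClosed_le (by fun_prop) continuous_const

instance : CompactSpace (confAngle 5 (Real.pi / 2)) :=
  isCompact_iff_compactSpace.1 isClosed_confAngle.isCompact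

/-- The reduced space is homeomorphic to a simplicial complex. -/
noncomputable def triangulationHomeo : X5 ≃ₜ (complex tri).space :=
  Continuous.homeoOfEquivCompactToT2
    (f := Equiv.ofBijective (fun c => (⟨triangulation c, triangulation_mem_space c⟩ : (complex tri).space))
      ⟨fun c c' h => triangulation_injective (congrArg Subtype.val h), fun x => by
        obtain ⟨c, hc⟩ := exists_triangulation_eq x.2
        exact ⟨c, Subtype.ext hc⟩⟩)
    (continuous_triangulation.subtype_mk _)

theorem coe_triangulationHomeo (c : X5) :
    (triangulationHomeo c : EuclideanSpace ℝ (Fin 30)) = triangulation c := rfl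

end SphereConf

end

/-! ### Vertices, Euler characteristic and connectedness -/

section

open SphereConf

namespace SphereConf

open CoordinateComplex SingularChains

theorem triangulation_vx (p : Equiv.Perm (Fin 5)) : triangulation (vx p) = basisVec (corner p 0) := by
  have hpi := Real.pi_ne_zero
  have h : 2 * (Real.pi / 2) / Real.pi = 1 := by field_simp
  rw [vx, triangulation_cls, Fin.sum_univ_three]
  simp [weight, h]

theorem triangulation_mem_vertices_iff {c : X5} :
    triangulation c ∈ (complex tri).vertices ↔ ∃ p, c = vx p := by
  rw [mem_vertices]
  constructor
  · rintro ⟨t, v, -, h⟩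
    obtain ⟨p, rfl⟩ := exists_corner_eq v
    exact ⟨p, triangulation_injective (by rw [h, triangulation_vx])⟩
  · rintro ⟨p, rfl⟩
    exact ⟨QuotientGroup.mk p, _, by rw [tri_mk]; exact corner_mem_corners p 0, triangulation_vx p⟩

theorem IsFrame.map {x y z : E3} (h : IsFrame x y z) {A : Matrix (Fin 3) (Fin 3) ℝ}
    (hA : A ∈ Matrix.specialOrthogonalGroup (Fin 3) ℝ) :
    IsFrame (Matrix.toEuclideanLin A x) (Matrix.toEuclideanLin A y)
      (Matrix.toEuclideanLin A z) := by
  constructor <;> simp only [inner_toEuclideanLin hA, det3_toEuclideanLin hA]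
  exacts [h.xx, h.yy, h.zz, h.xy, h.xz, h.yz, h.det]

theorem stdPt_corner (j : Fin 5) : ∃ k, stdPt (Real.pi / 2) 0 j = stdVec k ∨
    stdPt (Real.pi / 2) 0 j = -stdVec k := by
  fin_cases j
  · exact ⟨0, Or.inl rfl⟩
  · exact ⟨0, Or.inr rfl⟩
  · exact ⟨2, Or.inl rfl⟩
  · exact ⟨2, Or.inr (by simp [stdPt, freePt])⟩
  · exact ⟨1, Or.inr (by simp [stdPt, freePt])⟩

theorem inner_eq_of_onOctahedron {N : ℕ} {U : Fin N → S2} (h : OnOctahedron U) (i j : Fin N) :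
    inner ℝ (U i : E3) (U j : E3) = 0 ∨ inner ℝ (U i : E3) (U j : E3) = 1 ∨
      inner ℝ (U i : E3) (U j : E3) = -1 := by
  obtain ⟨e, h⟩ := h
  obtain ⟨k, hi⟩ := h i
  obtain ⟨l, hj⟩ := h j
  rcases hi with hi | hi <;> rcases hj with hj | hj <;> rw [hi, hj] <;>
    simp only [inner_neg_left, inner_neg_right, inner_orthonormalBasis] <;> split_ifs <;> simp

theorem IsParam.eq_of_sin {a b : ℝ} (hab : IsParam a b)
    (h : Real.sin a = 0 ∨ Real.sin a = 1 ∨ Real.sin a = -1) : a = 0 ∨ a = Real.pi / 2 := by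
  have h1 := hab.left
  have h2 := hab.right
  have h3 := hab.add
  have hpi := Real.pi_pos
  have hs : 0 ≤ Real.sin a := Real.sin_nonneg_of_nonneg_of_le_pi h1 (by linarith)
  rcases h with h | h | h
  · left
    have := (Real.sin_eq_zero_iff_of_lt_of_lt (by linarith) (by linarith)).1 h
    exact this
  · right
    refine hab.cos_left.2 ?_
    have := Real.sin_sq_add_cos_sq a
    rw [h] at this
    exact pow_eq_zero_iff (two_ne_zero) |>.1 (by linarith)
  · linarith

/-- Octahedron vertices have inner products in `{0, 1, -1}`, which forces `a` and `b` to be `0` or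
`π / 2`; with `a + b ≤ π / 2` only the three corners of the triangle remain. -/
theorem onOctahedron_iff (U : confAngle 5 (Real.pi / 2)) :
    OnOctahedron U.1 ↔ ∃ p, (Quotient.mk (rotationSetoid _) U : X5) = vx p := by
  constructor
  · intro h
    obtain ⟨p, a, b, hab, hc⟩ := exists_eq_cls (Quotient.mk _ U)
    obtain ⟨A, hA, hU⟩ := Quotient.exact hc.symm
    replace hU : ∀ i, (U.1 i : E3) = Matrix.toEuclideanLin A (stdPt a b (p⁻¹ i)) := hU
    have hU' : ∀ i, (U.1 (p i) : E3) = Matrix.toEuclideanLin A (stdPt a b i) := fun i => by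
      rw [hU, show p⁻¹ (p i) = i from p.symm_apply_apply i]
    rw [hc]
    have hin := fun i j => inner_eq_of_onOctahedron h (p i) (p j)
    simp only [hU', inner_toEuclideanLin hA] at hin
    have h23 := hin 2 3
    have h24 := hin 2 4
    have e23 : inner ℝ (stdPt a b 2) (stdPt a b 3) = -Real.sin a := by
      simp [stdPt, freePt, stdVec, inner_E3]
    have e24 : inner ℝ (stdPt a b 2) (stdPt a b 4) = -Real.sin b := by
      simp [stdPt, freePt, stdVec, inner_E3]
    rw [e23, neg_eq_zero, neg_inj, neg_eq_iff_eq_neg] at h23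
    rw [e24, neg_eq_zero, neg_inj, neg_eq_iff_eq_neg] at h24
    have ha := hab.eq_of_sin (by tauto)
    have hb := hab.swap.eq_of_sin (by tauto)
    have hpi := Real.pi_ne_zero
    have hpi' := Real.pi_pos
    rcases ha with rfl | rfl
    · rcases hb with rfl | rfl
      · exact ⟨_, cls_eq_vx hab (i := 2) (by simp [weight])⟩
      · exact ⟨_, cls_eq_vx hab (i := 1) (by simp [weight]; field_simp)⟩
    · rcases hb with rfl | rfl
      · exact ⟨_, cls_eq_vx hab (i := 0) (by simp [weight]; field_simp)⟩
      · linarith [hab.add]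
  · rintro ⟨p, hc⟩
    obtain ⟨A, hA, hU⟩ := Quotient.exact hc.symm
    obtain ⟨e, h0, h1, h2⟩ := (isFrame_stdVec.map hA).exists_orthonormalBasis
    have he : ∀ k, e k = Matrix.toEuclideanLin A (stdVec k) := by
      intro k; fin_cases k <;> assumption
    refine ⟨e, fun i => ?_⟩
    obtain ⟨k, hk⟩ := stdPt_corner (p⁻¹ i)
    refine ⟨k, ?_⟩
    rw [hU, he, ← map_neg]
    rcases hk with hk | hk
    · exact Or.inl (congrArg _ hk)
    · exact Or.inr (congrArg _ hk)

theorem isFreePairTriangulation :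
    IsFreePairTriangulation (complex tri) triangulationHomeo.symm := by
  refine ⟨fun U => ?_, ?_⟩
  · rw [Homeomorph.symm_symm, coe_triangulationHomeo, triangulation_mem_vertices_iff,
      onOctahedron_iff]
  · rw [setOf_freePairFamily]
    have key : ∀ p, triangulationHomeo.symm '' {x | (x : EuclideanSpace ℝ (Fin 30)) ∈
        hull (corners p)} = family p := by
      intro p
      ext c
      rw [← triangulation_image_family]
      constructor
      · rintro ⟨x, ⟨c', hc', e⟩, rfl⟩
        have : x = triangulationHomeo c' := Subtype.ext e.symm
        rwa [this, Homeomorph.symm_apply_apply]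
      · intro hc
        exact ⟨triangulationHomeo c, ⟨c, hc, rfl⟩, Homeomorph.symm_apply_apply _ _⟩
    ext S
    constructor
    · rintro ⟨s, hs, h3, rfl⟩
      obtain ⟨t, rfl⟩ := (faces_card_three card_tri s).1 ⟨hs, h3⟩
      refine ⟨t.out, ?_⟩
      rw [convexHull_image_basisVec]
      exact key _
    · rintro ⟨p, rfl⟩
      obtain ⟨hs, h3⟩ := (faces_card_three card_tri _).2 ⟨QuotientGroup.mk p, rfl⟩
      refine ⟨_, hs, h3, ?_⟩
      rw [convexHull_image_basisVec, tri_mk, key]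

noncomputable instance : Fintype Triangle := Fintype.ofFinite _

theorem card_triangle : Fintype.card Triangle = 20 := by
  rw [← Nat.card_eq_fintype_card, natCard_triangle]

theorem hasGraphHomology_X5 : HasGraphHomology (singularChains X5) (-10) := by
  have h := hasGraphHomology card_tri card_tri_inter_le exists_mem_tri
  rw [card_triangle] at h
  exact h.of_iso fun k => homologyIso triangulationHomeo.symm.toHomotopyEquiv k

/-- A contractible space has Euler characteristic 1. -/
theorem not_contractibleSpace_X5 : ¬ ContractibleSpace X5 := by
  intro h
  obtain ⟨e⟩ := h.hequiv_unit
  have h1 := (hasDiscreteHomology_of_homotopyEquiv e).hasGraphHomology.homologyEulerChar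
  rw [hasGraphHomology_X5.homologyEulerChar] at h1
  simp at h1

theorem isInducing_triangulation : Topology.IsInducing triangulation :=
  Topology.IsInducing.subtypeVal.comp triangulationHomeo.isInducing

theorem isPreconnected_family (p : Equiv.Perm (Fin 5)) : IsPreconnected (family p) := by
  rw [← isInducing_triangulation.isPreconnected_image, triangulation_image_family]
  exact (convex_hull _).isPreconnected

theorem vx_mem_family (p : Equiv.Perm (Fin 5)) : vx p ∈ family p := cls_mem_family p _

theorem connectedComponent_vx_mul_rotPerm (p : Equiv.Perm (Fin 5)) :
    connectedComponent (vx (p * rotPerm)) = connectedComponent (vx p) := by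
  have h : vx (p * rotPerm) ∈ family p := by
    rw [family_eq_family (p := p) (q := p * rotPerm)]
    · exact vx_mem_family _
    · rw [QuotientGroup.eq, inv_mul_cancel_left]
      have : rotPerm ∈ familyFinset := by decide +kernel
      exact this
  exact (connectedComponent_eq
    ((isPreconnected_family p).subset_connectedComponent (vx_mem_family p) h)).symm

/-- Rotating labels within a family stays in one component and the quarter turn does not move the
class; these two permutations generate the symmetric group. -/
theorem connectedComponent_vx (p : Equiv.Perm (Fin 5)) :
    connectedComponent (vx p) = connectedComponent (vx 1) := by
  let H : Submonoid (Equiv.Perm (Fin 5)) :=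
    { carrier := {g | ∀ p, connectedComponent (vx (p * g)) = connectedComponent (vx p)}
      mul_mem' := fun {x y} hx hy p => by rw [← mul_assoc, hy, hx]
      one_mem' := fun p => by rw [mul_one] }
  have hc : quarterPerm ∈ H := fun p => by rw [vx_mul_quarterPerm]
  have hr : rotPerm ∈ H := connectedComponent_vx_mul_rotPerm
  have hw : ∀ w : List Bool, (w.map fun b => if b then quarterPerm else rotPerm).prod ∈ H := by
    intro w
    refine Submonoid.list_prod_mem _ fun g hg => ?_
    obtain ⟨b, -, rfl⟩ := List.mem_map.1 hg
    cases b
    · exact hr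
    · exact hc
  have htop : H = ⊤ := by
    rw [eq_top_iff, ← Equiv.Perm.mclosure_swap_castSucc_succ 4, Submonoid.closure_le]
    rintro _ ⟨i, rfl⟩
    -- Explicit words for the adjacent transpositions; `true` stands for `quarterPerm`, `false` for
    -- `rotPerm`.
    have hwords : ∀ i : Fin 4, Equiv.swap i.castSucc i.succ =
        ((![[true, false, true, false, false, true, false, false, true, false, true, false],
          [false, true, false, true, false, true],
          [true, false, true, false, true, false, false, true, false, false, true, false],
          [true, false, true, false, true, false, false, true, false, false, true]] i).map
            fun b => if b then quarterPerm else rotPerm).prod := by decide +kernel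
    simp only [hwords]
    exact hw _
  have := (htop ▸ Submonoid.mem_top p : p ∈ H) 1
  rwa [one_mul] at this

instance : ConnectedSpace X5 := by
  rw [connectedSpace_iff_connectedComponent]
  refine ⟨vx 1, Set.eq_univ_of_forall fun c => ?_⟩
  obtain ⟨p, a, b, hab, rfl⟩ := exists_eq_cls c
  rw [← connectedComponent_vx p]
  exact (isPreconnected_family p).subset_connectedComponent (vx_mem_family p) (cls_mem_family p hab)

end SphereConf

end

/-! ### Winding as a rational singular cocycle -/

section

open SphereConf

namespace SingularChains

open SphereConf (singularChains SingularCohomology Cochain coboundary)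

variable {B : Type} [TopologicalSpace B]

instance (n : ℕ) : ContractibleSpace (Simplex n) :=
  (convex_stdSimplex ℝ (Fin (n + 1))).contractibleSpace ⟨_, (stdSimplex.vertex (S := ℝ) 0).2⟩

instance (n : ℕ) : LocallyPathConnectedSpace (Simplex n) :=
  (convex_stdSimplex ℝ (Fin (n + 1))).locallyPathConnectedSpace

/-- Uniqueness and existence of continuous logarithms on simplices. -/
theorem existsUnique_log {n : ℕ} (f : C(Simplex n, ℂ)) (hf : ∀ x, f x ≠ 0) (x₀ : Simplex n)
    {z : ℂ} (hz : Complex.exp z = f x₀) :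
    ∃! l : C(Simplex n, ℂ), l x₀ = z ∧ Complex.exp ∘ l = f :=
  Complex.isCoveringMapOn_exp.existsUnique_continuousMap_lifts f hz hf

theorem exists_log {n : ℕ} (f : C(Simplex n, ℂ)) (hf : ∀ x, f x ≠ 0) :
    ∃ l : C(Simplex n, ℂ), ∀ x, Complex.exp (l x) = f x := by
  obtain ⟨l, ⟨-, h⟩, -⟩ := existsUnique_log f hf (stdSimplex.vertex 0) (Complex.exp_log (hf _))
  exact ⟨l, congrFun h⟩

/-- Translating `l'` to agree with `l` at `y` gives two lifts of one function through the
exponential, equal by uniqueness of lifts. -/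
theorem log_sub_log {n : ℕ} {l l' : C(Simplex n, ℂ)}
    (h : ∀ x, Complex.exp (l x) = Complex.exp (l' x)) (x y : Simplex n) :
    l x - l y = l' x - l' y := by
  let f : C(Simplex n, ℂ) := ⟨fun x => Complex.exp (l x), by fun_prop⟩
  have hu := (existsUnique_log f (fun x => Complex.exp_ne_zero _) y (z := l y) rfl).unique
    (y₁ := l) (y₂ := l' + ContinuousMap.const _ (l y - l' y)) ⟨rfl, rfl⟩ ⟨by simp, by
      ext x
      simp [f, Complex.exp_add, Complex.exp_sub, h]⟩
  have := congrArg (fun F : C(Simplex n, ℂ) => F x) hu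
  simp only [ContinuousMap.add_apply, ContinuousMap.const_apply] at this
  linear_combination this

open Classical in
/-- The change of a continuous logarithm of a function along the standard interval. -/
noncomputable def logIncrement (f : C(Simplex 1, ℂ)) : ℂ :=
  if h : ∃ l : C(Simplex 1, ℂ), ∀ x, Complex.exp (l x) = f x then
    h.choose (stdSimplex.vertex 1) - h.choose (stdSimplex.vertex 0) else 0

theorem logIncrement_eq {f l : C(Simplex 1, ℂ)} (h : ∀ x, Complex.exp (l x) = f x) :
    logIncrement f = l (stdSimplex.vertex 1) - l (stdSimplex.vertex 0) := by
  have h' : ∃ l : C(Simplex 1, ℂ), ∀ x, Complex.exp (l x) = f x := ⟨l, h⟩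
  rw [logIncrement, dif_pos h']
  exact log_sub_log (fun x => by rw [h, h'.choose_spec]) _ _

/-- One logarithm on the whole triangle serves all three edges, and its increments cancel. This is
the cocycle condition. -/
theorem logIncrement_faces (f : C(Simplex 2, ℂ)) (hf : ∀ x, f x ≠ 0) :
    logIncrement (f.comp (face 0)) - logIncrement (f.comp (face 1)) +
      logIncrement (f.comp (face 2)) = 0 := by
  obtain ⟨l, hl⟩ := exists_log f hf
  have h : ∀ i : Fin 3, logIncrement (f.comp (face i)) =
      l (stdSimplex.vertex (i.succAbove 1)) - l (stdSimplex.vertex (i.succAbove 0)) := fun i => by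
    rw [logIncrement_eq (l := l.comp (face i)) fun x => hl _]
    simp only [ContinuousMap.comp_apply, face, ContinuousMap.coe_mk, stdSimplex.map_vertex]
  rw [h, h, h]
  change l (stdSimplex.vertex 2) - l (stdSimplex.vertex 1) -
    (l (stdSimplex.vertex 2) - l (stdSimplex.vertex 0)) +
    (l (stdSimplex.vertex 1) - l (stdSimplex.vertex 0)) = 0
  ring

/-- The cochain with given values on the singular simplices. -/
noncomputable def cochain {n : ℕ} (w : C(Simplex n, B) → ℚ) : Cochain B n :=
  Finsupp.linearCombination ℚ w ∘ₗ (chainEquiv B n).symm.toLinearMap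

theorem cochain_simplexChain {n : ℕ} (w : C(Simplex n, B) → ℚ) (σ : C(Simplex n, B)) :
    cochain w (simplexChain σ) = w σ := by
  have h : simplexChain σ = chainEquiv B n (Finsupp.single σ 1) := by
    rw [chainEquiv_single, one_smul]
  rw [h, cochain, LinearMap.comp_apply, LinearEquiv.coe_coe, LinearEquiv.symm_apply_apply,
    Finsupp.linearCombination_single, one_smul]

/-- If the first cohomology vanishes, the winding of a function without zeros along paths is a
difference of the values of a potential. -/
theorem exists_potential (hB : Subsingleton (SingularCohomology B 1)) (g : C(B, ℂ))
    (hg : ∀ x, g x ≠ 0) (f : ℂ →ₗ[ℚ] ℚ) :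
    ∃ φ : B → ℚ, ∀ σ : C(Simplex 1, B), f (logIncrement (g.comp σ)) =
      φ (σ (stdSimplex.vertex 1)) - φ (σ (stdSimplex.vertex 0)) := by
  -- Increments of logarithms are complex; the functional `f` turns them into a rational cochain.
  set θ : Cochain B 1 := cochain fun σ => f (logIncrement (g.comp σ)) with hθ
  have hker : θ ∈ LinearMap.ker (coboundary B 1 2) := by
    rw [LinearMap.mem_ker]
    refine LinearMap.ext_on (span_simplexChain B 2) ?_
    rintro _ ⟨σ, rfl⟩
    change θ (((singularChains B).d 2 1).hom (simplexChain σ)) = 0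
    rw [d_simplexChain, map_sum, Fin.sum_univ_three]
    simp only [map_smul, hθ, cochain_simplexChain, ← ContinuousMap.comp_assoc]
    have := congrArg f (logIncrement_faces (g.comp σ) fun x => hg _)
    simp only [map_add, map_sub, map_zero] at this
    rw [← this]
    simp
    ring
  have hsub : (⟨θ, hker⟩ : LinearMap.ker (coboundary B 1 2)) ∈
      (LinearMap.range (coboundary B (1 - 1) 1)).submoduleOf (LinearMap.ker (coboundary B 1 2)) := by
    rw [← Submodule.Quotient.mk_eq_zero]
    exact Subsingleton.elim _ _
  -- The degree `1 - 1` is `0`, so the cocycle is the coboundary of a function on points.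
  obtain ⟨ψ, hψ⟩ : θ ∈ LinearMap.range (coboundary B 0 1) := hsub
  refine ⟨fun b => ψ (simplexChain (ContinuousMap.const _ b)), fun σ => ?_⟩
  have h := congrArg (fun c : Cochain B 1 => c (simplexChain σ)) hψ
  change ψ (((singularChains B).d 1 0).hom (simplexChain σ)) = θ (simplexChain σ) at h
  rw [d_simplexChain, map_sum, Fin.sum_univ_two, hθ, cochain_simplexChain] at h
  have hc : ∀ i : Fin 2, σ.comp (face i) =
      ContinuousMap.const _ (σ (stdSimplex.vertex (i.succAbove 0))) := by
    intro i
    ext x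
    rw [Subsingleton.elim x (stdSimplex.vertex 0)]
    simp only [ContinuousMap.comp_apply, face, ContinuousMap.coe_mk, stdSimplex.map_vertex,
      ContinuousMap.const_apply]
  rw [← h, hc, hc]
  simp
  ring

end SingularChains

end

/-! ### A nonvanishing condition surviving below the maximal radius -/

section

open SphereConf

namespace SphereConf

open SingularChains

/-- The total amount by which the inner products exceed zero. -/
noncomputable def excess (U : Fin 5 → S2) : ℝ :=
  ∑ i, ∑ j, if i < j then max (inner ℝ (U i : E3) (U j : E3)) 0 else 0

theorem continuous_excess : Continuous excess := by
  refine continuous_finsetSum _ fun i _ => continuous_finsetSum _ fun j _ => ?_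
  split_ifs
  · fun_prop
  · exact continuous_const

theorem excess_pos {U : Fin 5 → S2} (h : U ∉ confAngle 5 (Real.pi / 2)) : 0 < excess U := by
  rw [mem_confAngle_iff] at h
  push Not at h
  obtain ⟨i, j, hij, h⟩ := h
  have h0 : ∀ i j : Fin 5, 0 ≤ if i < j then max (inner ℝ (U i : E3) (U j : E3)) 0 else 0 := by
    intro i j
    split_ifs
    · exact le_max_right _ _
    · exact le_rfl
  refine Finset.sum_pos' (fun i _ => Finset.sum_nonneg fun j _ => h0 i j)
    ⟨i, Finset.mem_univ _, Finset.sum_pos' (fun j _ => h0 i j) ⟨j, Finset.mem_univ _, ?_⟩⟩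
  rw [if_pos hij]
  exact lt_max_of_lt_left h

theorem excess_le {U : Fin 5 → S2} {κ : ℝ} (hκ : 0 ≤ κ)
    (h : ∀ i j, i < j → inner ℝ (U i : E3) (U j : E3) ≤ κ) : excess U ≤ 25 * κ := by
  have h0 : ∀ i j : Fin 5, (if i < j then max (inner ℝ (U i : E3) (U j : E3)) 0 else 0) ≤ κ := by
    intro i j
    split_ifs with hij
    · exact max_le (h i j hij) hκ
    · exact hκ
  calc excess U ≤ ∑ _i : Fin 5, ∑ _j : Fin 5, κ :=
        Finset.sum_le_sum fun i _ => Finset.sum_le_sum fun j _ => h0 i j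
    _ = 25 * κ := by simp; ring

/-- For a configuration at angles at least `π / 2`, one of two complementary pairs of points is
orthogonal or antipodal. -/
theorem not_half_half {U : Fin 5 → S2} (hU : U ∈ confAngle 5 (Real.pi / 2)) :
    ¬ (inner ℝ (U 0 : E3) (U 1 : E3) = -1 / 2 ∧ inner ℝ (U 2 : E3) (U 3 : E3) = -1 / 2) := by
  obtain ⟨p, a, b, hab, A, hA, h⟩ := exists_rotation_eq ⟨U, hU⟩
  simp only at h
  rw [h, h, h, h, inner_toEuclideanLin hA, inner_toEuclideanLin hA]
  rintro ⟨h1, h2⟩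
  have cross : ∀ i j : Fin 5, i < 2 → ¬ j < 2 → inner ℝ (stdPt a b i) (stdPt a b j) ≠ -1 / 2 := by
    intro i j hi hj
    rw [inner_stdPt_cross hi hj]
    norm_num
  have anti : ∀ i j : Fin 5, i < 2 → j < 2 → i ≠ j →
      inner ℝ (stdPt a b i) (stdPt a b j) ≠ -1 / 2 := by
    intro i j hi hj hij
    have h01 : inner ℝ (stdPt a b 0) (stdPt a b 1) ≠ -1 / 2 := by
      simp [stdPt, freePt, stdVec]; norm_num
    rcases (by omega : (i = 0 ∧ j = 1) ∨ (i = 1 ∧ j = 0)) with ⟨rfl, rfl⟩ | ⟨rfl, rfl⟩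
    · exact h01
    · rwa [real_inner_comm]
  -- The two pairs use four of the five positions, hence at least one of the antipodal positions 0
  -- and 1; the pair containing it has inner product 0 or -1.
  have key : ∀ g : Equiv.Perm (Fin 5), (g 0 < 2 ∧ ¬ g 1 < 2) ∨ (¬ g 0 < 2 ∧ g 1 < 2) ∨
      (g 2 < 2 ∧ ¬ g 3 < 2) ∨ (¬ g 2 < 2 ∧ g 3 < 2) ∨ (g 0 < 2 ∧ g 1 < 2) ∨
      (g 2 < 2 ∧ g 3 < 2) := by decide +kernel
  rcases key p⁻¹ with ⟨h, h'⟩ | ⟨h, h'⟩ | ⟨h, h'⟩ | ⟨h, h'⟩ | ⟨h, h'⟩ | ⟨h, h'⟩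
  · exact cross _ _ h h' h1
  · rw [real_inner_comm] at h1; exact cross _ _ h' h h1
  · exact cross _ _ h h' h2
  · rw [real_inner_comm] at h2; exact cross _ _ h' h h2
  · exact anti _ _ h h' (p⁻¹.injective.ne (by decide)) h1
  · exact anti _ _ h h' (p⁻¹.injective.ne (by decide)) h2

/-- The forbidden set is compact and disjoint from the optimal configurations, so the excess is
bounded below on it by a positive number, whereas the excess of configurations of radius `r` tends
to zero as `r` tends to the maximum. -/
theorem exists_radius {ε : ℝ} (hε : 0 < ε) : ∃ r, rMax 5 - ε < r ∧ r < rMax 5 ∧ 0 < r ∧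
    ∀ U ∈ confRadius 5 r,
      ¬ (inner ℝ (U 0 : E3) (U 1 : E3) = -1 / 2 ∧ inner ℝ (U 2 : E3) (U 3 : E3) = -1 / 2) := by
  rw [rMax_five]
  obtain ⟨s2, s2'⟩ := sqrt_two_facts
  set Z : Set (Fin 5 → S2) := {U | inner ℝ (U 0 : E3) (U 1 : E3) = -1 / 2 ∧
    inner ℝ (U 2 : E3) (U 3 : E3) = -1 / 2} with hZ
  have hclosed : IsClosed Z :=
    (isClosed_eq (by fun_prop) continuous_const).inter (isClosed_eq (by fun_prop) continuous_const)
  obtain ⟨μ, hμ, hle⟩ : ∃ μ, 0 < μ ∧ ∀ U ∈ Z, μ ≤ excess U := by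
    rcases Z.eq_empty_or_nonempty with h | h
    · exact ⟨1, one_pos, fun U hU => by rw [h] at hU; exact hU.elim⟩
    · obtain ⟨U, hU, hmin⟩ := hclosed.isCompact.exists_isMinOn h continuous_excess.continuousOn
      exact ⟨excess U, excess_pos fun hc => not_half_half hc hU, fun V hV => hmin hV⟩
  -- The upper bound for inner products at radius `r`.
  set κ : ℝ → ℝ := fun r => (2 - (r - 1) ^ 2) / (1 + r) ^ 2 with hκ
  have hcont : ContinuousAt κ (1 + Real.sqrt 2) := by
    refine ContinuousAt.div (by fun_prop) (by fun_prop) ?_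
    positivity
  have hκ0 : κ (1 + Real.sqrt 2) = 0 := by
    simp only [hκ]
    rw [show 2 - (1 + Real.sqrt 2 - 1) ^ 2 = 0 by linear_combination -s2, zero_div]
  have hev : ∀ᶠ r in nhds (1 + Real.sqrt 2), 25 * κ r < μ := by
    have : Filter.Tendsto (fun r => 25 * κ r) (nhds (1 + Real.sqrt 2)) (nhds (25 * 0)) := by
      rw [← hκ0]; exact hcont.tendsto.const_mul 25
    exact this.eventually_lt_const (by simpa using hμ)
  -- Keeping `r` above 1 ensures both `0 < r` and `0 ≤ κ r`.
  obtain ⟨r, ⟨h1, h2⟩, h3⟩ : ∃ r, r ∈ Set.Ioo (max (1 + Real.sqrt 2 - ε) 1) (1 + Real.sqrt 2) ∧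
      25 * κ r < μ := by
    have hmem := Ioo_mem_nhdsLT (a := max (1 + Real.sqrt 2 - ε) 1) (b := 1 + Real.sqrt 2)
      (max_lt (by linarith) (by linarith))
    exact (Filter.Eventually.and hmem (hev.filter_mono nhdsWithin_le_nhds)).exists
  have h1' := (max_lt_iff.1 h1).1
  have h1'' := (max_lt_iff.1 h1).2
  refine ⟨r, h1', h2, by linarith, fun U hU hZU => ?_⟩
  have hin := (mem_confRadius_iff (by linarith)).1 hU
  have hk0 : 0 ≤ κ r := div_nonneg (by nlinarith) (by positivity)
  have := excess_le hk0 fun i j hij => by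
    rw [hκ, le_div_iff₀ (by positivity), mul_comm]; exact hin i j hij
  linarith [hle U hZU]

end SphereConf

end

/-! ### The pairing function and its winding along quarter turns -/

section

open SphereConf

namespace SphereConf

open SingularChains

/-- Two inner products of a configuration, as a complex number. -/
noncomputable def pairing (u : Fin 5 → E3) : ℂ :=
  ((inner ℝ (u 0) (u 1) + 1 / 2 : ℝ) : ℂ) + ((inner ℝ (u 2) (u 3) + 1 / 2 : ℝ) : ℂ) * Complex.I

/-- Used with `s = -1`: the pairing does not distinguish a configuration from its mirror image. -/
theorem pairing_smul (u : Fin 5 → E3) {s : ℝ} (hs : s * s = 1) :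
    pairing (fun i => s • u i) = pairing u := by
  simp only [pairing, inner_smul_left, inner_smul_right, conj_trivial, ← mul_assoc, hs, one_mul]

theorem pairing_toEuclideanLin {A : Matrix (Fin 3) (Fin 3) ℝ}
    (hA : A ∈ Matrix.specialOrthogonalGroup (Fin 3) ℝ) (u : Fin 5 → E3) :
    pairing (fun i => Matrix.toEuclideanLin A (u i)) = pairing u := by
  simp only [pairing, inner_toEuclideanLin hA]

theorem IsObtuse.smul {ι : Type*} {u : ι → E3} (h : IsObtuse u) {s : ℝ} (hs : s * s = 1) :
    IsObtuse fun i => s • u i := by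
  constructor
  · intro i
    rw [inner_smul_left, inner_smul_right, conj_trivial, ← mul_assoc, hs, one_mul, h.inner_self]
  · intro i j hij
    rw [inner_smul_left, inner_smul_right, conj_trivial, ← mul_assoc, hs, one_mul]
    exact h.inner_le i j hij

theorem IsObtuse.toEuclideanLin {ι : Type*} {u : ι → E3} (h : IsObtuse u)
    {A : Matrix (Fin 3) (Fin 3) ℝ} (hA : A ∈ Matrix.specialOrthogonalGroup (Fin 3) ℝ) :
    IsObtuse fun i => Matrix.toEuclideanLin A (u i) :=
  ⟨fun i => by rw [inner_toEuclideanLin hA, h.inner_self],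
    fun i j hij => by rw [inner_toEuclideanLin hA]; exact h.inner_le i j hij⟩

/-- The configuration in which the `m`th point has turned by the angle `t` towards `q`. -/
noncomputable def turn (u : Fin 5 → E3) (m : Fin 5) (q : E3) (t : ℝ) : Fin 5 → E3 :=
  Function.update u m (Real.cos t • u m + Real.sin t • q)

theorem turn_zero (u : Fin 5 → E3) (m : Fin 5) (q : E3) : turn u m q 0 = u := by
  simp [turn]

theorem turn_pi_div_two (u : Fin 5 → E3) (m : Fin 5) (q : E3) :
    turn u m q (Real.pi / 2) = Function.update u m q := by
  simp [turn]

/-- The moving point is a combination of its two end positions with nonnegative coefficients, so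
nonpositivity at both ends persists in between. -/
theorem IsObtuse.turn {u : Fin 5 → E3} {m : Fin 5} {q : E3} (h : IsObtuse u)
    (h' : IsObtuse (Function.update u m q)) (hq : inner ℝ (u m) q = 0) {t : ℝ} (h0 : 0 ≤ t)
    (ht : t ≤ Real.pi / 2) : IsObtuse (turn u m q t) := by
  have hc : 0 ≤ Real.cos t := Real.cos_nonneg_of_mem_Icc ⟨by linarith, ht⟩
  have hs : 0 ≤ Real.sin t := Real.sin_nonneg_of_nonneg_of_le_pi h0 (by linarith)
  have hqq := h'.inner_self m
  rw [Function.update_self] at hqq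
  have hle : ∀ i, i ≠ m → inner ℝ (u i) (Real.cos t • u m + Real.sin t • q) ≤ 0 := by
    intro i hi
    have h1 := h.inner_le i m hi
    have h2 := h'.inner_le i m hi
    rw [Function.update_self, Function.update_of_ne hi] at h2
    rw [inner_add_right, inner_smul_right, inner_smul_right]
    exact add_nonpos (mul_nonpos_of_nonneg_of_nonpos hc h1) (mul_nonpos_of_nonneg_of_nonpos hs h2)
  constructor
  · intro i
    by_cases hi : i = m
    · subst hi
      have := Real.sin_sq_add_cos_sq t
      rw [SphereConf.turn, Function.update_self, inner_add_add_self]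
      simp only [inner_smul_left, inner_smul_right, conj_trivial, h.inner_self, hqq, hq,
        (real_inner_comm (u i) q).trans hq]
      linarith
    · rw [SphereConf.turn, Function.update_of_ne hi, h.inner_self]
  · intro i j hij
    by_cases hi : i = m
    · subst hi
      rw [SphereConf.turn, Function.update_self, Function.update_of_ne hij.symm, real_inner_comm]
      exact hle j hij.symm
    · by_cases hj : j = m
      · subst hj
        rw [SphereConf.turn, Function.update_self, Function.update_of_ne hi]
        exact hle i hi
      · rw [SphereConf.turn, Function.update_of_ne hi, Function.update_of_ne hj]
        exact h.inner_le i j hij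

/-- The change of the logarithm from `1 + i` to `1 - i`. -/
noncomputable def quarterLog : ℂ := Complex.log (1 - Complex.I) - Complex.log (1 + Complex.I)

theorem quarterLog_ne_zero : quarterLog ≠ 0 := by
  intro h
  have h1 : (1 - Complex.I) ≠ 0 := by intro h; simpa using congrArg Complex.re h
  have h2 : (1 + Complex.I) ≠ 0 := by intro h; simpa using congrArg Complex.re h
  have := congrArg Complex.exp (sub_eq_zero.1 h)
  rw [Complex.exp_log h1, Complex.exp_log h2] at this
  have := congrArg Complex.im this
  norm_num at this

/-- Each side of a square centred at the origin has this form with `k` its midpoint. After division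
by `k` the path has real part 1, so the principal logarithm is available, and `log k` cancels. -/
theorem logIncrement_eq_quarterLog {f : C(Simplex 1, ℂ)} {k : ℂ} (hk : k ≠ 0)
    {y : Simplex 1 → ℝ} (hy : Continuous y) (h : ∀ x, f x = k * (1 + y x * Complex.I))
    (h0 : y (stdSimplex.vertex 0) = 1) (h1 : y (stdSimplex.vertex 1) = -1) :
    logIncrement f = quarterLog := by
  have hs : ∀ x, 1 + (y x : ℂ) * Complex.I ∈ Complex.slitPlane := fun x => by
    left; simp
  let l : C(Simplex 1, ℂ) := ⟨fun x => Complex.log (1 + y x * Complex.I) + Complex.log k, by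
    exact (Continuous.clog (by fun_prop) hs).add continuous_const⟩
  rw [logIncrement_eq (l := l) fun x => ?_]
  · simp only [l, ContinuousMap.coe_mk, h0, h1, quarterLog]
    push_cast
    ring_nf
  · simp only [l, ContinuousMap.coe_mk]
    rw [Complex.exp_add, Complex.exp_log (Complex.slitPlane_ne_zero (hs x)), Complex.exp_log hk, h,
      mul_comm]

theorem logIncrement_eq_zero {f : C(Simplex 1, ℂ)} {k : ℂ} (hk : k ≠ 0) (h : ∀ x, f x = k) :
    logIncrement f = 0 := by
  rw [logIncrement_eq (l := ContinuousMap.const _ (Complex.log k)) fun x => ?_]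
  · simp
  · rw [ContinuousMap.const_apply, Complex.exp_log hk, h]

section

variable {r : ℝ} (hr : 0 < r) (hr' : r ≤ 1 + Real.sqrt 2)

/-- The inclusion of the reduced spaces. -/
def inclusion (hr : 0 < r) (hr' : r ≤ 1 + Real.sqrt 2) (U : confAngle 5 (Real.pi / 2)) :
    BConfRadius 5 r :=
  Quotient.mk _ ⟨U.1, confAngle_subset_confRadius hr hr' U.2⟩

theorem continuous_inclusion : Continuous (inclusion hr hr') :=
  continuous_quotient_mk'.comp (continuous_subtype_val.subtype_mk _)

/-- The function `pairing` on the reduced space. -/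
noncomputable def pairingMap (r : ℝ) : C(BConfRadius 5 r, ℂ) where
  toFun := Quotient.lift (fun U => pairing fun i => (U.1 i : E3)) (by
    rintro U V ⟨A, hA, h⟩
    simp only [h, pairing_toEuclideanLin hA])
  continuous_toFun := by
    refine Continuous.quotient_lift ?_ _
    have hU : ∀ i, Continuous fun U : confRadius 5 r => (U.1 i : E3) := fun i =>
      continuous_subtype_val.comp ((continuous_apply i).comp continuous_subtype_val)
    have h0 := hU 0
    have h1 := hU 1
    have h2 := hU 2
    have h3 := hU 3
    unfold pairing
    fun_prop

theorem pairingMap_ne_zero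
    (h : ∀ U ∈ confRadius 5 r, ¬ (inner ℝ (U 0 : E3) (U 1 : E3) = -1 / 2 ∧
      inner ℝ (U 2 : E3) (U 3 : E3) = -1 / 2)) (c : BConfRadius 5 r) : pairingMap r c ≠ 0 := by
  induction c using Quotient.inductionOn with | _ U
  intro h0
  change pairing (fun i => (U.1 i : E3)) = 0 at h0
  have hre := congrArg Complex.re h0
  have him := congrArg Complex.im h0
  simp only [pairing, Complex.add_re, Complex.ofReal_re, Complex.re_ofReal_mul, Complex.I_re,
    mul_zero, add_zero, Complex.zero_re, Complex.add_im, Complex.ofReal_im, Complex.im_ofReal_mul,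
    Complex.I_im, mul_one, zero_add, Complex.zero_im] at hre him
  exact h U.1 U.2 ⟨by linarith, by linarith⟩

open Classical in
/-- The value of a function on the reduced space at the class of a configuration. -/
noncomputable def valueAt (hr : 0 < r) (hr' : r ≤ 1 + Real.sqrt 2) (φ : BConfRadius 5 r → ℚ)
    (u : Fin 5 → E3) : ℚ :=
  -- The default `0` is never read: it allows plain tuples as arguments, and every evaluation
  -- supplies obtuseness.
  if h : IsObtuse u then φ (inclusion hr hr' (toConf h)) else 0

theorem valueAt_eq (φ : BConfRadius 5 r → ℚ) {u : Fin 5 → E3} (h : IsObtuse u) :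
    valueAt hr hr' φ u = φ (inclusion hr hr' (toConf h)) := dif_pos h

theorem valueAt_toEuclideanLin (φ : BConfRadius 5 r → ℚ) {u : Fin 5 → E3} (h : IsObtuse u)
    {A : Matrix (Fin 3) (Fin 3) ℝ} (hA : A ∈ Matrix.specialOrthogonalGroup (Fin 3) ℝ) :
    valueAt hr hr' φ (fun i => Matrix.toEuclideanLin A (u i)) = valueAt hr hr' φ u := by
  rw [valueAt_eq hr hr' φ h, valueAt_eq hr hr' φ (h.toEuclideanLin hA)]
  have e : inclusion hr hr' (toConf h) = inclusion hr hr' (toConf (h.toEuclideanLin hA)) :=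
    Quotient.sound (by exact ⟨A, hA, fun i => rfl⟩)
  rw [e]

/-- The path of classes traced by a turning point. -/
theorem exists_turnPath {u : Fin 5 → E3} {m : Fin 5} {q : E3} (h : IsObtuse u)
    (h' : IsObtuse (Function.update u m q)) (hq : inner ℝ (u m) q = 0) {s : ℝ} (hs : s * s = 1) :
    ∃ σ : C(Simplex 1, BConfRadius 5 r),
      (∀ x, pairingMap r (σ x) = pairing (turn u m q (Real.pi / 2 * x.1 1))) ∧
      ∀ φ, φ (σ (stdSimplex.vertex 0)) = valueAt hr hr' φ (fun i => s • u i) ∧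
        φ (σ (stdSimplex.vertex 1)) = valueAt hr hr' φ (fun i => s • Function.update u m q i) := by
  have hpi := Real.pi_pos
  have hx : ∀ x : Simplex 1, IsObtuse (turn u m q (Real.pi / 2 * x.1 1)) := fun x =>
    h.turn h' hq (mul_nonneg (by positivity) (x.2.1 1))
      (mul_le_of_le_one_right (by positivity) (by
        rw [← x.2.2]; exact Finset.single_le_sum (fun i _ => x.2.1 i) (Finset.mem_univ 1)))
  have hcont : Continuous fun x : Simplex 1 => toConf ((hx x).smul hs) := by
    refine Continuous.subtype_mk (continuous_pi fun i => Continuous.subtype_mk ?_ _) _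
    have hx1 : Continuous fun x : Simplex 1 => Real.pi / 2 * x.1 1 :=
      continuous_const.mul ((continuous_apply 1).comp continuous_subtype_val)
    unfold turn
    by_cases hi : i = m
    · subst hi
      simp only [Function.update_self]
      exact (((Real.continuous_cos.comp hx1).smul continuous_const).add
        ((Real.continuous_sin.comp hx1).smul continuous_const)).const_smul s
    · simp only [Function.update_of_ne hi]
      exact continuous_const
  have h0 : turn u m q (Real.pi / 2 * (stdSimplex.vertex (S := ℝ) (0 : Fin 2)).1 1) = u := by
    simp [turn_zero]
  have h1 : turn u m q (Real.pi / 2 * (stdSimplex.vertex (S := ℝ) (1 : Fin 2)).1 1) =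
      Function.update u m q := by
    simp [turn_pi_div_two]
  refine ⟨⟨fun x => inclusion hr hr' (toConf ((hx x).smul hs)),
    (continuous_inclusion hr hr').comp hcont⟩, fun x => ?_, fun φ => ⟨?_, ?_⟩⟩
  · exact pairing_smul _ hs
  · have e : (fun i => s • u i) =
        fun i => s • turn u m q (Real.pi / 2 * (stdSimplex.vertex (S := ℝ) (0 : Fin 2)).1 1) i := by
      rw [h0]
    rw [e, valueAt_eq hr hr' φ ((hx _).smul hs)]
    rfl
  · have e : (fun i => s • Function.update u m q i) =
        fun i => s • turn u m q (Real.pi / 2 * (stdSimplex.vertex (S := ℝ) (1 : Fin 2)).1 1) i := by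
      rw [h1]
    rw [e, valueAt_eq hr hr' φ ((hx _).smul hs)]
    rfl

/-- A quarter turn around a corner of the square of values of `pairing` changes the potential by a
fixed amount. -/
theorem valueAt_quarterTurn {φ : BConfRadius 5 r → ℚ} {f : ℂ →ₗ[ℚ] ℚ}
    (hφ : ∀ σ : C(Simplex 1, BConfRadius 5 r), f (logIncrement ((pairingMap r).comp σ)) =
      φ (σ (stdSimplex.vertex 1)) - φ (σ (stdSimplex.vertex 0)))
    {u : Fin 5 → E3} {m : Fin 5} {q : E3} (h : IsObtuse u)
    (h' : IsObtuse (Function.update u m q)) (hq : inner ℝ (u m) q = 0) {s : ℝ} (hs : s * s = 1)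
    {k : ℂ} (hk : k ≠ 0) {y : ℝ → ℝ} (hy : Continuous y) (h0 : y 0 = 1) (h1 : y (Real.pi / 2) = -1)
    (hp : ∀ t, pairing (turn u m q t) = k * (1 + y t * Complex.I)) :
    valueAt hr hr' φ (fun i => s • Function.update u m q i) =
      valueAt hr hr' φ (fun i => s • u i) + f quarterLog := by
  obtain ⟨σ, hσ, hv⟩ := exists_turnPath hr hr' h h' hq hs
  have hx1 : Continuous fun x : Simplex 1 => x.1 1 :=
    (continuous_apply 1).comp continuous_subtype_val
  have := hφ σ
  rw [(hv φ).1, (hv φ).2, logIncrement_eq_quarterLog hk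
    (y := fun x => y (Real.pi / 2 * x.1 1)) (hy.comp (continuous_const.mul hx1)) (fun x => by
      rw [ContinuousMap.comp_apply, hσ, hp]) (by simp [h0]) (by simp [h1])] at this
  linarith

/-- A quarter turn which does not change `pairing` does not change the potential. -/
theorem valueAt_constantTurn {φ : BConfRadius 5 r → ℚ} {f : ℂ →ₗ[ℚ] ℚ}
    (hφ : ∀ σ : C(Simplex 1, BConfRadius 5 r), f (logIncrement ((pairingMap r).comp σ)) =
      φ (σ (stdSimplex.vertex 1)) - φ (σ (stdSimplex.vertex 0)))
    {u : Fin 5 → E3} {m : Fin 5} {q : E3} (h : IsObtuse u)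
    (h' : IsObtuse (Function.update u m q)) (hq : inner ℝ (u m) q = 0) {s : ℝ} (hs : s * s = 1)
    {k : ℂ} (hk : k ≠ 0) (hp : ∀ t, pairing (turn u m q t) = k) :
    valueAt hr hr' φ (fun i => s • Function.update u m q i) =
      valueAt hr hr' φ (fun i => s • u i) := by
  obtain ⟨σ, hσ, hv⟩ := exists_turnPath hr hr' h h' hq hs
  have := hφ σ
  rw [(hv φ).1, (hv φ).2, logIncrement_eq_zero hk fun x => by
    rw [ContinuousMap.comp_apply, hσ, hp], map_zero] at this
  linarith

end

end SphereConf

end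

/-! ### The path to the mirror image and the failure of purity -/

section

open SphereConf

namespace SphereConf

open SingularChains

/-- Octahedral configurations through which quarter turns of single points lead from a
configuration to its mirror image. -/
noncomputable def station : Fin 6 → Fin 5 → E3 :=
  ![![stdVec 0, -stdVec 0, stdVec 2, -stdVec 2, stdVec 1],
    ![stdVec 0, -stdVec 0, stdVec 2, -stdVec 1, stdVec 1],
    ![-stdVec 2, -stdVec 0, stdVec 2, -stdVec 1, stdVec 1],
    ![-stdVec 2, -stdVec 0, stdVec 2, -stdVec 1, stdVec 0],
    ![-stdVec 2, -stdVec 0, stdVec 1, -stdVec 1, stdVec 0],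
    ![-stdVec 2, stdVec 2, stdVec 1, -stdVec 1, stdVec 0]]

theorem isObtuse_station (k : Fin 6) : IsObtuse (station k) := by
  constructor
  · intro i
    fin_cases k <;> fin_cases i <;> simp [station, stdVec]
  · intro i j hij
    fin_cases k <;> fin_cases i <;> fin_cases j <;>
      first
      | exact absurd rfl hij
      | simp [station, stdVec, inner_E3]

theorem station_succ : station 1 = Function.update (station 0) 3 (-stdVec 1) ∧
    station 2 = Function.update (station 1) 0 (-stdVec 2) ∧
    station 3 = Function.update (station 2) 4 (stdVec 0) ∧
    station 4 = Function.update (station 3) 2 (stdVec 1) ∧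
    station 5 = Function.update (station 4) 1 (stdVec 2) := by
  refine ⟨?_, ?_, ?_, ?_, ?_⟩ <;> ext i : 1 <;> fin_cases i <;> simp [station, Function.update]

section

variable {r : ℝ} (hr : 0 < r) (hr' : r ≤ 1 + Real.sqrt 2)

/-- Along the stations the pairing runs once clockwise around the square with corners `(±1 ± i) /
2`, starting at `(-1 - i) / 2`: four sides, and one move which leaves it fixed. -/
theorem valueAt_station {φ : BConfRadius 5 r → ℚ} {f : ℂ →ₗ[ℚ] ℚ}
    (hφ : ∀ σ : C(Simplex 1, BConfRadius 5 r), f (logIncrement ((pairingMap r).comp σ)) =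
      φ (σ (stdSimplex.vertex 1)) - φ (σ (stdSimplex.vertex 0))) {s : ℝ} (hs : s * s = 1) :
    valueAt hr hr' φ (fun i => s • station 5 i) =
      valueAt hr hr' φ (fun i => s • station 0 i) + 4 * f quarterLog := by
  obtain ⟨e1, e2, e3, e4, e5⟩ := station_succ
  have hI := Complex.I_sq
  have h1 := valueAt_quarterTurn hr hr' hφ (isObtuse_station 0) (e1 ▸ isObtuse_station 1)
    (by simp [station, stdVec, inner_E3]) hs (k := -1 / 2) (by norm_num)
    (y := fun t => 2 * Real.cos t - 1) (by fun_prop) (by simp; norm_num) (by simp) (fun t => by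
      simp [pairing, turn, station, stdVec, inner_E3]; ring)
  have h2 := valueAt_quarterTurn hr hr' hφ (isObtuse_station 1) (e2 ▸ isObtuse_station 2)
    (by simp [station, stdVec, inner_E3]) hs (k := Complex.I / 2) (by simp)
    (y := fun t => 2 * Real.cos t - 1) (by fun_prop) (by simp; norm_num) (by simp) (fun t => by
      simp [pairing, turn, station, stdVec, inner_E3]
      linear_combination ((1 : ℂ) / 2 - Complex.cos t) * hI)
  -- The label 4 does not enter the pairing; moving it vacates the vertex that the label 2 occupies
  -- next.
  have h3 := valueAt_constantTurn hr hr' hφ (isObtuse_station 2) (e3 ▸ isObtuse_station 3)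
    (by simp [station, stdVec, inner_E3]) hs (k := 1 / 2 + 1 / 2 * Complex.I)
    (fun h => by simpa using congrArg Complex.re h) (fun t => by
      simp [pairing, turn, station, stdVec, inner_E3])
  have h4 := valueAt_quarterTurn hr hr' hφ (isObtuse_station 3) (e4 ▸ isObtuse_station 4)
    (by simp [station, stdVec, inner_E3]) hs (k := 1 / 2) (by norm_num)
    (y := fun t => 1 - 2 * Real.sin t) (by fun_prop) (by simp) (by simp; norm_num) (fun t => by
      simp [pairing, turn, station, stdVec, inner_E3]; ring)
  have h5 := valueAt_quarterTurn hr hr' hφ (isObtuse_station 4) (e5 ▸ isObtuse_station 5)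
    (by simp [station, stdVec, inner_E3]) hs (k := -Complex.I / 2) (by simp)
    (y := fun t => 1 - 2 * Real.sin t) (by fun_prop) (by simp) (by simp; norm_num) (fun t => by
      simp [pairing, turn, station, stdVec, inner_E3]
      linear_combination ((1 : ℂ) / 2 - Complex.sin t) * hI)
  rw [← e1] at h1
  rw [← e2] at h2
  rw [← e3] at h3
  rw [← e4] at h4
  rw [← e5] at h5
  rw [h5, h4, h3, h2, h1]
  ring

/-- The last station is a rotation of the mirror image of the first. -/
theorem exists_rotation_station : ∃ A ∈ Matrix.specialOrthogonalGroup (Fin 3) ℝ,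
    ∀ s : ℝ, (fun i => s • station 5 i) =
      fun i => Matrix.toEuclideanLin A ((-s) • station 0 i) := by
  have hf : IsFrame (stdVec 2) (-stdVec 0) (-stdVec 1) := by
    constructor <;> simp [inner_E3, det3, stdVec]
  obtain ⟨A, hA, h0, h1, h2⟩ := hf.exists_rotation
  refine ⟨A, hA, fun s => ?_⟩
  ext i : 1
  rw [map_smul]
  fin_cases i <;> simp [station, h0, h1, h2]

theorem not_purityProperty : ¬ PurityProperty 5 := by
  rintro ⟨ε, hε, h⟩
  obtain ⟨r, h1, h2, hr, hU⟩ := exists_radius hε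
  obtain ⟨-, -, -, hH⟩ := h r h1 h2
  have hr' : r ≤ 1 + Real.sqrt 2 := by rw [← rMax_five]; exact h2.le
  -- A rational functional on the complex numbers that still detects a quarter of a winding.
  obtain ⟨f, hf⟩ := Module.Projective.exists_dual_ne_zero ℚ quarterLog_ne_zero
  obtain ⟨φ, hφ⟩ := exists_potential (hH 1 le_rfl) (pairingMap r) (pairingMap_ne_zero hU) f
  obtain ⟨A, hA, hm⟩ := exists_rotation_station
  have e1 := valueAt_station hr hr' hφ (s := 1) (by norm_num)
  have e2 := valueAt_station hr hr' hφ (s := -1) (by norm_num)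
  rw [hm, valueAt_toEuclideanLin hr hr' φ ((isObtuse_station 0).smul (by norm_num)) hA] at e1 e2
  rw [neg_neg] at e2
  -- The path to the mirror image and the mirrored path back each add `4 * f quarterLog` to the
  -- potential, so `8 * f quarterLog = 0`.
  apply hf
  linarith

end

end SphereConf

end

theorem mainTheorem9 :
    -- the maximal radius for five spheres is attained and equals `1 + √2`
    (IsGreatest (SphereConf.admissibleRadii 5) (SphereConf.rMax 5) ∧
      SphereConf.rMax 5 = 1 + Real.sqrt 2) ∧
    -- the optimal configurations are those with angular separation `π / 2`
    SphereConf.confRadius 5 (SphereConf.rMax 5) = SphereConf.confAngle 5 (Real.pi / 2) ∧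
    -- they are the octahedron-vertex configurations with a free pair
    (∀ U : Fin 5 → SphereConf.S2, U ∈ SphereConf.confAngle 5 (Real.pi / 2) ↔
      ∃ e σ, SphereConf.IsFreePairConfig e σ U) ∧
    -- the reduced space is a two-dimensional simplicial complex
    (∃ (n : ℕ) (K : Geometry.SimplicialComplex ℝ (EuclideanSpace ℝ (Fin n)))
      (h : K.space ≃ₜ SphereConf.BConfAngle 5 (Real.pi / 2)),
      SphereConf.IsFinitePureTwoComplex K ∧ SphereConf.IsFreePairTriangulation K h) ∧
    -- it is connected, not contractible, and has Euler characteristic `-10`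
    ConnectedSpace (SphereConf.BConfAngle 5 (Real.pi / 2)) ∧
    ¬ ContractibleSpace (SphereConf.BConfAngle 5 (Real.pi / 2)) ∧
    SphereConf.HasEulerCharacteristic (SphereConf.BConfAngle 5 (Real.pi / 2)) (-10) ∧
    -- the Purity Property fails
    ¬ SphereConf.PurityProperty 5 := by
  open SphereConf in
  refine ⟨⟨?_, rMax_five⟩, ?_, mem_confAngle_iff_exists_isFreePairConfig,
    ⟨30, CoordinateComplex.complex tri, triangulationHomeo.symm,
      CoordinateComplex.isFinitePureTwoComplex card_tri, isFreePairTriangulation⟩,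
    inferInstance, not_contractibleSpace_X5, hasGraphHomology_X5.hasEulerCharacteristic,
    not_purityProperty⟩
  · rw [rMax_five]
    exact isGreatest_admissibleRadii
  · rw [rMax_five]
    exact confRadius_eq_confAngle 5
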